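/- Let $d\ge 2$ be an integer and $\mathbb T^d=(\mathbb R/2\pi\mathbb Z)^d$. Write vector fields on $\mathbb T^d$ as $v=\sum_{k\in\mathbb Z^d}v_k e_k$, with $e_k(x)=(2\pi)^{-d/2}e^{ik\cdot x}$ and $v_k\in\mathbb C^d$. For real $m$ let $\mathbb H^m_{\Sigma 0}$ be the space of real ($v_{-k}=\overline{v_k}$), zero mean ($v_0=0$), divergence free ($k\cdot v_k=0$ for all $k$) vector fields with $\|v\|_m^2:=\sum_{k\ne 0}|k|^{2m}|v_k|^2<\infty$, with inner product $\langle v|w\rangle_m:=\sum_{k\neq 0}|k|^{2m}\,\overline{v_k}\cdot w_k$. Let $\mathscr P(v,w):=-\mathfrak L(v\cdot\partial w)$, where $(v\cdot\partial w)_r=\sum_s v_s\partial_s w_r$ and $\mathfrak L$ is the Leray projection onto divergence free fields. Fix a real $n>\frac d2+1$, a viscosity $\nu\ge 0$, and a constant $G_n>0$ such that the Kato inequality $$|\langle \mathscr P(v,w)|w\rangle_n|\le G_n\|v\|_n\|w\|_n^2\qquad (v\in\mathbb H^n_{\Sigma 0},\ w\in\mathbb H^{n+1}_{\Sigma 0})$$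 holds. Let $u_0\in\mathbb H^{n+2}_{\Sigma 0}$. A solution of the Euler/Navier–Stokes Cauchy problem with zero forcing on $[0,T)$, $T\in(0,+\infty]$, is a function $u\in C([0,T),\mathbb H^{n+2}_{\Sigma 0})\cap C^1([0,T),\mathbb H^{n}_{\Sigma 0})$ with $$\frac{du}{dt}=\nu\Delta u+\mathscr P(u,u)\ \text{ on }[0,T),\qquad u(0)=u_0;$$ it is maximal if it cannot be extended to a solution on a larger interval $[0,T')$. Put $$e_\nu(t)=\begin{cases}(1-e^{-\nu t})/\nu & (\nu>0)\\ t&(\nu=0)\end{cases},\qquad T_c=\begin{cases}+\infty & \text{if }\nu>0,\ \|u_0\|_n\le \nu/G_n,\\ -\frac1\nu\log\left(1-\frac{\nu}{G_n\|u_0\|_n}\right)&\text{if }\nu>0,\ \|u_0\|_n>\nu/G_n,\\ \frac{1}{G_n\|u_0\|_n}&\text{if }\nu=0,\end{cases}$$ where $1/(G_n\|u_0\|_n):=+\infty$ if $u_0=0$. Then a maximal solution exists, and for a maximal solution $u$, of domain $[0,T)$, one has $T\ge T_c$ and, for all $t\in[0,T_c)$, $1-G_n\|u_0\|_n e_\nu(t)>0$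 and $$\|u(t)\|_n\le\frac{\|u_0\|_n e^{-\nu t}}{1-G_n\|u_0\|_n e_\nu(t)}.$$ In particular, if $\|u_0\|_n\le \nu/G_n$, then $T=T_c=+\infty$, so that $u$ is global; if moreover $\nu>0$, then $u$ decays exponentially: there is a constant $C$ such that $\|u(t)\|_n\le Ce^{-\nu t}$ for all $t\ge 0$. -/

import Mathlib

open Filter Topology MeasureTheory

noncomputable section

namespace EulerNS

/-- The torus `𝕋^d`, with `𝕋 = ℝ / 2πℤ`; its `volume` is the product measure `dx`, of total mass
`(2π)^d`. -/
abbrev Torus (d : ℕ) : Type := Fin d → AddCircle (2 * Real.pi)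

instance fact_two_pi_pos : Fact (0 < 2 * Real.pi) := ⟨Real.two_pi_pos⟩

/-- A (complex, formal) vector field on `𝕋^d`, given by its Fourier coefficients `v k ∈ ℂ^d`,
`k ∈ ℤ^d`, with respect to the orthonormal family `e_k(x) = (2π)^(-d/2) exp(i k • x)`.
A distributional vector field is determined by its Fourier coefficients, and we identify the two. -/
abbrev VField (d : ℕ) : Type := (Fin d → ℤ) → EuclideanSpace ℂ (Fin d)

/-- The Euclidean length `|k|` of a wave vector. -/
def kabs {d : ℕ} (k : Fin d → ℤ) : ℝ := Real.sqrt (∑ s, (k s : ℝ) ^ 2)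

/-- `e_k(x) = (2π)^(-d/2) exp(i k • x)`. -/
def expo {d : ℕ} (k : Fin d → ℤ) (x : Torus d) : ℂ :=
  (((2 * Real.pi) ^ (-(d : ℝ) / 2) : ℝ) : ℂ) * ∏ s, fourier (k s) (x s)

/-- The value at `x ∈ 𝕋^d` of the vector field with Fourier coefficients `v`:
`v(x) = ∑_k v_k e_k(x)`. -/
def evalAt {d : ℕ} (v : VField d) (x : Torus d) : EuclideanSpace ℂ (Fin d) :=
  ∑' k, expo k x • v k

/-- The Fourier coefficients `∫ F(x) e_{-k}(x) dx` of a function `F` on the torus. -/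
def coeffs {d : ℕ} (F : Torus d → EuclideanSpace ℂ (Fin d)) : VField d :=
  fun k => ∫ x, expo (-k) x • F x

/-- The partial derivative `∂_s`. -/
def pderiv {d : ℕ} (s : Fin d) (w : VField d) : VField d :=
  fun k => (Complex.I * (k s : ℂ)) • w k

/-- The Laplacian. -/
def lap {d : ℕ} (v : VField d) : VField d :=
  fun k => (-(kabs k ^ 2)) • v k

/-- The Leray projection: `(𝔏v)_k = v_k - (k • v_k) k / |k|²` for `k ≠ 0` and `(𝔏v)_0 = v_0`
(for `k = 0` the formula below also gives `v_0`). -/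
def leray {d : ℕ} (v : VField d) : VField d :=
  fun k => v k - ((∑ s, (k s : ℂ) * v k s) / ((kabs k ^ 2 : ℝ) : ℂ)) •
    WithLp.toLp 2 (fun s => (k s : ℂ))

/-- The function `(v • ∂w)(x) = ∑_s v_s(x) (∂_s w)(x)` on the torus. -/
def advect {d : ℕ} (v w : VField d) (x : Torus d) : EuclideanSpace ℂ (Fin d) :=
  ∑ s, evalAt v x s • evalAt (pderiv s w) x

/-- The fundamental bilinear map `𝒫(v, w) = -𝔏(v • ∂w)`. -/
def bilin {d : ℕ} (v w : VField d) : VField d := -leray (coeffs (advect v w))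

/-- `v` belongs to `H^n_{Σ0}`: it is real, has zero mean, is divergence free, and
`∑_k |k|^(2n) |v_k|² < ∞`. -/
structure MemH {d : ℕ} (n : ℝ) (v : VField d) : Prop where
  real : ∀ k r, v (-k) r = (starRingEnd ℂ) (v k r)
  mean : v 0 = 0
  div : ∀ k, ∑ s, (k s : ℂ) * v k s = 0
  summable : Summable fun k => kabs k ^ (2 * n) * ‖v k‖ ^ 2

/-- The inner product `⟨v | w⟩_n = ∑_k |k|^(2n) conj(v_k) • w_k` (a real number, for real
vector fields). -/
def innerH {d : ℕ} (n : ℝ) (v w : VField d) : ℝ :=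
  ∑' k, kabs k ^ (2 * n) * (inner ℂ (v k) (w k)).re

/-- The norm `‖v‖_n = (∑_k |k|^(2n) |v_k|²)^(1/2)`. -/
def normH {d : ℕ} (n : ℝ) (v : VField d) : ℝ :=
  Real.sqrt (∑' k, kabs k ^ (2 * n) * ‖v k‖ ^ 2)

/-- `G` is a constant for which the Kato inequality
`|⟨𝒫(v,w) | w⟩_n| ≤ G ‖v‖_n ‖w‖_n²` holds for all `v ∈ H^n_{Σ0}`, `w ∈ H^{n+1}_{Σ0}`. -/
def IsKatoConstant (d : ℕ) (n G : ℝ) : Prop :=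
  0 < G ∧ ∀ v w : VField d, MemH n v → MemH (n + 1) w →
    |innerH n (bilin v w) w| ≤ G * normH n v * normH n w ^ 2

/-- The time interval `[0, T)`, for `T ∈ [-∞, +∞]`. -/
def timeIco (T : EReal) : Set ℝ := {t | 0 ≤ t ∧ (t : EReal) < T}

/-- `u ∈ C(I, H^n_{Σ0})`. -/
def ContH {d : ℕ} (n : ℝ) (I : Set ℝ) (u : ℝ → VField d) : Prop :=
  (∀ t ∈ I, MemH n (u t)) ∧
    ∀ t₀ ∈ I, Tendsto (fun t => normH n (u t - u t₀)) (𝓝[I] t₀) (𝓝 0)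

/-- `u` is differentiable on `I` with derivative `u'`, with respect to the norm of `H^n_{Σ0}`. -/
def HasDerivH {d : ℕ} (n : ℝ) (I : Set ℝ) (u u' : ℝ → VField d) : Prop :=
  ∀ t₀ ∈ I, Tendsto (fun t => normH n ((t - t₀)⁻¹ • (u t - u t₀) - u' t₀))
    (𝓝[I \ {t₀}] t₀) (𝓝 0)

/-- `u`, restricted to `[0, T)`, solves the Cauchy problem for the Euler/NS equations with
viscosity `ν`, forcing `f` and datum `u₀`: `u ∈ C([0,T), H^{n+2}_{Σ0}) ∩ C¹([0,T), H^n_{Σ0})`,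
`du/dt = ν Δu + 𝒫(u,u) + f` on `[0, T)` and `u(0) = u₀`. -/
structure IsSolution {d : ℕ} (n ν : ℝ) (f : ℝ → VField d) (u₀ : VField d)
    (T : EReal) (u : ℝ → VField d) : Prop where
  pos : 0 < T
  cont : ContH (n + 2) (timeIco T) u
  eqn : ∃ u' : ℝ → VField d, ContH n (timeIco T) u' ∧ HasDerivH n (timeIco T) u u' ∧
    ∀ t ∈ timeIco T, u' t = ν • lap (u t) + bilin (u t) (u t) + f t
  init : u 0 = u₀

/-- A maximal, i.e. nonextendable, solution, of domain `[0, T)`. -/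
def IsMaximalSolution {d : ℕ} (n ν : ℝ) (f : ℝ → VField d) (u₀ : VField d)
    (T : EReal) (u : ℝ → VField d) : Prop :=
  IsSolution n ν f u₀ T u ∧
    ¬ ∃ (T' : EReal) (v : ℝ → VField d), T < T' ∧ IsSolution n ν f u₀ T' v ∧
      Set.EqOn v u (timeIco T)

/-- `e_ν(t) = (1 - e^{-νt})/ν` if `ν > 0`, and `e_0(t) = t`. -/
def eNu (ν t : ℝ) : ℝ := if ν = 0 then t else (1 - Real.exp (-ν * t)) / ν

/-- The time `T_c` corresponding to the viscosity `ν ≥ 0`, the constant `G > 0` and the norm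
`a = ‖u₀‖_n` of the datum. -/
def Tc (ν G a : ℝ) : EReal :=
  if ν = 0 then
    (if a = 0 then ⊤ else ((1 / (G * a) : ℝ) : EReal))
  else if a ≤ ν / G then ⊤
  else ((-(1 / ν) * Real.log (1 - ν / (G * a)) : ℝ) : EReal)

end EulerNS

end

open EulerNS

/-!
The Galerkin truncations satisfy an energy estimate in `H^{n+2}` that is uniform in the truncation,
on a time depending only on the `H^n` norm of the datum. A commutator estimate for the weight
`|k|^p min(|k|/K, 1)` moreover bounds the high modes uniformly, so that, together with the stability
of the equation in `L²`, the truncations converge in `H^{n+2}`; the same stability gives uniqueness.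
Since the existence time is controlled by the `H^n` norm, a maximal solution on a bounded interval
has an unbounded `H^n` norm.

By the Kato inequality, `‖u‖_n` is a subsolution of the Riccati equation `B' = -νB + G B²`, whose
solution stays bounded before `T_c`. If `‖u₀‖_n = ν/G`, this only shows that `‖u‖_n ≤ ν/G`. However,
the energy inequality is strict: equality would require `‖u‖_n = ‖u‖_{n+1}`, so that `u` would be
supported on `|k| = 1`, where the nonlinear term does not contribute. Hence `‖u‖_n` drops below
`ν/G`, and decays exponentially from then on.
-/

noncomputable section

namespace EulerNS

variable {d : ℕ}

/-- The wave vector `k` as an element of `ℂ^d`. -/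
def kvec (k : Fin d → ℤ) : EuclideanSpace ℂ (Fin d) := WithLp.toLp 2 fun s => (k s : ℂ)

@[simp] lemma kvec_apply (k : Fin d → ℤ) (s : Fin d) : kvec k s = k s := rfl

lemma kvec_add (k l : Fin d → ℤ) : kvec (k + l) = kvec k + kvec l := by
  ext s; simp

lemma norm_kvec (k : Fin d → ℤ) : ‖kvec k‖ = kabs k := by
  simp [kabs, kvec, EuclideanSpace.norm_eq]

lemma inner_kvec (k : Fin d → ℤ) (v : EuclideanSpace ℂ (Fin d)) :
    inner ℂ (kvec k) v = ∑ s, (k s : ℂ) * v s := by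
  simp [PiLp.inner_apply, mul_comm]

lemma norm_sum_mul_le (k : Fin d → ℤ) (v : EuclideanSpace ℂ (Fin d)) :
    ‖∑ s, (k s : ℂ) * v s‖ ≤ kabs k * ‖v‖ := by
  rw [← inner_kvec, ← norm_kvec]
  exact norm_inner_le_norm _ _

lemma kabs_nonneg (k : Fin d → ℤ) : 0 ≤ kabs k := Real.sqrt_nonneg _

@[simp] lemma kabs_zero : kabs (0 : Fin d → ℤ) = 0 := by simp [kabs]

@[simp] lemma kabs_neg (k : Fin d → ℤ) : kabs (-k) = kabs k := by simp [kabs]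

lemma kabs_add_le (k l : Fin d → ℤ) : kabs (k + l) ≤ kabs k + kabs l := by
  simpa only [← norm_kvec, kvec_add] using norm_add_le (kvec k) (kvec l)

lemma kabs_le_sub_add (k l : Fin d → ℤ) : kabs k ≤ kabs (k - l) + kabs l := by
  simpa only [sub_add_cancel] using kabs_add_le (k - l) l

lemma abs_kabs_sub_le (k l : Fin d → ℤ) : |kabs k - kabs l| ≤ kabs (k - l) := by
  have hkl := kabs_le_sub_add k l
  have hlk := kabs_le_sub_add l k
  rw [← kabs_neg (l - k), neg_sub] at hlk
  exact abs_le.mpr ⟨by linarith, by linarith⟩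

lemma abs_apply_le_kabs (k : Fin d → ℤ) (s : Fin d) : |(k s : ℝ)| ≤ kabs k := by
  simpa [norm_kvec] using PiLp.norm_apply_le (kvec k) s

lemma one_le_kabs {k : Fin d → ℤ} (hk : k ≠ 0) : 1 ≤ kabs k := by
  obtain ⟨s, hs⟩ := Function.ne_iff.mp hk
  have h : 1 ≤ |k s| := Int.one_le_abs hs
  exact le_trans (by exact_mod_cast h) (abs_apply_le_kabs k s)

lemma kabs_pos {k : Fin d → ℤ} (hk : k ≠ 0) : 0 < kabs k := one_pos.trans_le (one_le_kabs hk)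

lemma finite_setOf_kabs_le (N : ℝ) : {k : Fin d → ℤ | kabs k ≤ N}.Finite := by
  refine (Set.Finite.pi' fun _ : Fin d => Set.finite_Icc (-⌈N⌉) ⌈N⌉).subset fun k hk s => ?_
  have h : |(k s : ℝ)| ≤ (⌈N⌉ : ℝ) := (abs_apply_le_kabs k s).trans (le_trans hk (Int.le_ceil N))
  exact abs_le.mp (by exact_mod_cast h)

lemma summable_kabs_rpow {r : ℝ} (hr : r < -(d : ℝ)) :
    Summable fun k : Fin d → ℤ => kabs k ^ r := by
  let b := (EuclideanSpace.basisFun (Fin d) ℝ).toBasis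
  let e := (b.restrictScalars ℤ).equivFun.symm
  have hrank : Module.finrank ℤ (Submodule.span ℤ (Set.range b)) = d := by
    rw [ZLattice.rank ℝ]; simp
  have he : ∀ k, ‖e k‖ = kabs k := fun k => by
    have : (e k : EuclideanSpace ℝ (Fin d)) = ∑ s, k s • b s := by
      simp [e, Module.Basis.equivFun_symm_apply]
    rw [Submodule.coe_norm, this]
    simp [b, kabs, EuclideanSpace.norm_eq, Pi.single_apply]
  have hsum := ZLattice.summable_norm_rpow (Submodule.span ℤ (Set.range b)) r (by rwa [hrank])
  exact (hsum.comp_injective e.injective).congr fun k => by rw [Function.comp_apply, he]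

lemma sq_kabs_rpow (k : Fin d → ℤ) (n : ℝ) : (kabs k ^ n) ^ 2 = kabs k ^ (2 * n) := by
  rw [mul_comm, Real.rpow_mul (kabs_nonneg k), Real.rpow_two]

/-! ### Weighted `ℓ²` spaces of Fourier coefficients -/

/-- The Hilbert space of square summable families of coefficients; the weighted spaces of vector
fields are studied through their images in it, see `toL2`. -/
abbrev L2 (d : ℕ) : Type := lp (fun _ : Fin d → ℤ => EuclideanSpace ℂ (Fin d)) 2

lemma L2.norm_sq_eq_tsum (x : L2 d) : ‖x‖ ^ 2 = ∑' k, ‖x k‖ ^ 2 := by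
  simpa using lp.norm_rpow_eq_tsum (p := 2) (by norm_num) x

/-- `v` is square summable with respect to the weight `φ`, i.e. `∑_k φ(k)² |v_k|² < ∞`. -/
def MemL2 (φ : (Fin d → ℤ) → ℝ) (v : VField d) : Prop := Memℓp (fun k => φ k • v k) 2

section MemL2

variable {φ ψ : (Fin d → ℤ) → ℝ} {v w : VField d}

lemma memL2_iff_summable : MemL2 φ v ↔ Summable fun k => φ k ^ 2 * ‖v k‖ ^ 2 := by
  simp [MemL2, memℓp_gen_iff, norm_smul, mul_pow]

lemma MemL2.add (hv : MemL2 φ v) (hw : MemL2 φ w) : MemL2 φ (v + w) := by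
  simp only [MemL2, Pi.add_apply, smul_add]
  exact Memℓp.add hv hw

lemma MemL2.smul (hv : MemL2 φ v) (c : ℝ) : MemL2 φ (c • v) := by
  simp only [MemL2, Pi.smul_apply, smul_comm _ c]
  exact Memℓp.const_smul hv c

lemma MemL2.neg (hv : MemL2 φ v) : MemL2 φ (-v) := by
  simpa only [neg_one_smul] using hv.smul (-1)

lemma MemL2.sub (hv : MemL2 φ v) (hw : MemL2 φ w) : MemL2 φ (v - w) := by
  simpa only [sub_eq_add_neg] using hv.add hw.neg

lemma MemL2.mono (hw : MemL2 ψ w) (h : ∀ k, ‖φ k • v k‖ ≤ ‖ψ k • w k‖) : MemL2 φ v :=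
  Memℓp.mono' hw h

open Classical in
/-- The family `φ(k) v_k` as an element of the Hilbert space of square summable families; the junk
value `0` is used for fields which are not square summable with respect to `φ`. -/
def toL2 (φ : (Fin d → ℤ) → ℝ) (v : VField d) : L2 d :=
  if h : MemL2 φ v then ⟨fun k => φ k • v k, h⟩ else 0

lemma toL2_apply (hv : MemL2 φ v) (k : Fin d → ℤ) : toL2 φ v k = φ k • v k := by
  rw [toL2, dif_pos hv]

lemma toL2_add (hv : MemL2 φ v) (hw : MemL2 φ w) : toL2 φ (v + w) = toL2 φ v + toL2 φ w := by
  ext1; funext k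
  simp [toL2_apply hv, toL2_apply hw, toL2_apply (hv.add hw)]

lemma toL2_sub (hv : MemL2 φ v) (hw : MemL2 φ w) : toL2 φ (v - w) = toL2 φ v - toL2 φ w := by
  ext1; funext k
  simp [toL2_apply hv, toL2_apply hw, toL2_apply (hv.sub hw), smul_sub]

lemma toL2_smul (hv : MemL2 φ v) (c : ℝ) : toL2 φ (c • v) = c • toL2 φ v := by
  ext1; funext k
  rw [toL2_apply (hv.smul c), lp.coeFn_smul, Pi.smul_apply, Pi.smul_apply, toL2_apply hv]
  exact smul_comm _ _ _

lemma norm_toL2_sq (φ : (Fin d → ℤ) → ℝ) (v : VField d) :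
    ‖toL2 φ v‖ ^ 2 = ∑' k, φ k ^ 2 * ‖v k‖ ^ 2 := by
  by_cases h : MemL2 φ v
  · simp only [L2.norm_sq_eq_tsum, toL2_apply h, norm_smul, mul_pow, Real.norm_eq_abs, sq_abs]
  · rw [tsum_eq_zero_of_not_summable (memL2_iff_summable.not.mp h), toL2, dif_neg h]
    simp

lemma re_inner_eq_real_inner (x y : EuclideanSpace ℂ (Fin d)) :
    (inner ℂ x y).re = inner ℝ x y := by
  simp [PiLp.inner_apply]

lemma inner_toL2 (hv : MemL2 φ v) (hw : MemL2 φ w) :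
    inner ℝ (toL2 φ v) (toL2 φ w) = ∑' k, φ k ^ 2 * (inner ℂ (v k) (w k)).re := by
  rw [lp.inner_eq_tsum]
  refine tsum_congr fun k => ?_
  rw [toL2_apply hv, toL2_apply hw, real_inner_smul_left, real_inner_smul_right,
    re_inner_eq_real_inner]
  ring

lemma norm_toL2_le (hw : MemL2 ψ w) (h : ∀ k, ‖φ k • v k‖ ≤ ‖ψ k • w k‖) :
    ‖toL2 φ v‖ ≤ ‖toL2 ψ w‖ := by
  have hv := hw.mono h
  rw [← sq_le_sq₀ (norm_nonneg _) (norm_nonneg _), norm_toL2_sq, norm_toL2_sq]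
  refine (memL2_iff_summable.mp hv).tsum_le_tsum (fun k => ?_) (memL2_iff_summable.mp hw)
  simpa only [norm_smul, mul_pow, Real.norm_eq_abs, sq_abs] using
    pow_le_pow_left₀ (norm_nonneg _) (h k) 2

end MemL2

/-! ### Sobolev spaces -/

/-- The weight `|k|^n`, for which `‖toL2 (sobolevWeight n) v‖` is the norm of `H^n_{Σ0}`. -/
def sobolevWeight (n : ℝ) (k : Fin d → ℤ) : ℝ := kabs k ^ n

lemma sobolevWeight_nonneg (n : ℝ) (k : Fin d → ℤ) : 0 ≤ sobolevWeight n k :=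
  Real.rpow_nonneg (kabs_nonneg k) n

lemma sobolevWeight_sq (n : ℝ) (k : Fin d → ℤ) : sobolevWeight n k ^ 2 = kabs k ^ (2 * n) :=
  sq_kabs_rpow k n

lemma norm_toL2_sobolevWeight (n : ℝ) (v : VField d) : ‖toL2 (sobolevWeight n) v‖ = normH n v := by
  rw [← Real.sqrt_sq (norm_nonneg _), norm_toL2_sq, normH]
  simp only [sobolevWeight_sq]

lemma memL2_sobolevWeight_iff {n : ℝ} {v : VField d} :
    MemL2 (sobolevWeight n) v ↔ Summable fun k => kabs k ^ (2 * n) * ‖v k‖ ^ 2 := by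
  simp only [memL2_iff_summable, sobolevWeight_sq]

lemma normH_nonneg (n : ℝ) (v : VField d) : 0 ≤ normH n v := Real.sqrt_nonneg _

lemma normH_sq (n : ℝ) (v : VField d) :
    normH n v ^ 2 = ∑' k, kabs k ^ (2 * n) * ‖v k‖ ^ 2 := by
  simp only [← norm_toL2_sobolevWeight, norm_toL2_sq, sobolevWeight_sq]

@[simp] lemma normH_zero (n : ℝ) : normH n (0 : VField d) = 0 := by simp [normH]

lemma normH_sub_comm (n : ℝ) (v w : VField d) : normH n (v - w) = normH n (w - v) := by
  simp only [normH, Pi.sub_apply, norm_sub_rev]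

namespace MemH

variable {m n : ℝ} {v w : VField d}

lemma memL2 (hv : MemH n v) : MemL2 (sobolevWeight n) v := memL2_sobolevWeight_iff.mpr hv.summable

lemma zero (n : ℝ) : MemH n (0 : VField d) :=
  ⟨fun k r => by simp, rfl, fun k => by simp, by simp⟩

lemma add (hv : MemH n v) (hw : MemH n w) : MemH n (v + w) where
  real k r := by simp [hv.real, hw.real]
  mean := by simp [hv.mean, hw.mean]
  div k := by simp [mul_add, Finset.sum_add_distrib, hv.div, hw.div]
  summable := memL2_sobolevWeight_iff.mp (hv.memL2.add hw.memL2)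

lemma smul (hv : MemH n v) (c : ℝ) : MemH n (c • v) where
  real k r := by simp [hv.real]
  mean := by simp [hv.mean]
  div k := by
    rw [← inner_kvec, Pi.smul_apply, ← Complex.coe_smul, inner_smul_right, inner_kvec, hv.div,
      mul_zero]
  summable := memL2_sobolevWeight_iff.mp (hv.memL2.smul c)

lemma neg (hv : MemH n v) : MemH n (-v) := by
  simpa only [neg_one_smul] using hv.smul (-1)

lemma sub (hv : MemH n v) (hw : MemH n w) : MemH n (v - w) := by
  simpa only [sub_eq_add_neg] using hv.add hw.neg

lemma norm_sobolevWeight_smul_mono (hmn : m ≤ n) (h0 : v 0 = 0) (k : Fin d → ℤ) :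
    ‖sobolevWeight m k • v k‖ ≤ ‖sobolevWeight n k • v k‖ := by
  rcases eq_or_ne k 0 with rfl | hk
  · simp [h0]
  · rw [norm_smul, norm_smul, Real.norm_of_nonneg (sobolevWeight_nonneg m k),
      Real.norm_of_nonneg (sobolevWeight_nonneg n k)]
    gcongr
    exact Real.rpow_le_rpow_of_exponent_le (one_le_kabs hk) hmn

lemma mono (hmn : m ≤ n) (hv : MemH n v) : MemH m v where
  real := hv.real
  mean := hv.mean
  div := hv.div
  summable := memL2_sobolevWeight_iff.mp
    (hv.memL2.mono (norm_sobolevWeight_smul_mono hmn hv.mean))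

lemma normH_mono (hmn : m ≤ n) (hv : MemH n v) : normH m v ≤ normH n v := by
  simpa only [norm_toL2_sobolevWeight] using
    norm_toL2_le hv.memL2 (norm_sobolevWeight_smul_mono hmn hv.mean)

lemma inner_toL2_sobolevWeight (hv : MemH n v) (hw : MemH n w) :
    inner ℝ (toL2 (sobolevWeight n) v) (toL2 (sobolevWeight n) w) = innerH n v w := by
  simp only [inner_toL2 hv.memL2 hw.memL2, innerH, sobolevWeight_sq]

lemma toL2_sub (hv : MemH n v) (hw : MemH n w) : toL2 (sobolevWeight n) (v - w) =
    toL2 (sobolevWeight n) v - toL2 (sobolevWeight n) w :=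
  EulerNS.toL2_sub hv.memL2 hw.memL2

lemma normH_add_le (hv : MemH n v) (hw : MemH n w) : normH n (v + w) ≤ normH n v + normH n w := by
  simpa only [← norm_toL2_sobolevWeight, toL2_add hv.memL2 hw.memL2] using norm_add_le _ _

lemma normH_sub_le (hv : MemH n v) (hw : MemH n w) : normH n (v - w) ≤ normH n v + normH n w := by
  simpa only [← norm_toL2_sobolevWeight, hv.toL2_sub hw] using norm_sub_le _ _

lemma normH_smul (hv : MemH n v) (c : ℝ) : normH n (c • v) = |c| * normH n v := by
  simp only [← norm_toL2_sobolevWeight, toL2_smul hv.memL2, norm_smul, Real.norm_eq_abs]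

lemma innerH_add_left {u : VField d} (hu : MemH n u) (hv : MemH n v) (hw : MemH n w) :
    innerH n (u + v) w = innerH n u w + innerH n v w := by
  simp only [← inner_toL2_sobolevWeight, hu, hv, hw, hu.add hv, toL2_add hu.memL2 hv.memL2,
    inner_add_left]

lemma innerH_smul_left (hv : MemH n v) (hw : MemH n w) (c : ℝ) :
    innerH n (c • v) w = c * innerH n v w := by
  simp only [← inner_toL2_sobolevWeight, hv, hw, hv.smul c, toL2_smul hv.memL2,
    real_inner_smul_left]

lemma innerH_le (hv : MemH n v) (hw : MemH n w) : innerH n v w ≤ normH n v * normH n w := by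
  simpa only [← hv.inner_toL2_sobolevWeight hw, ← norm_toL2_sobolevWeight] using
    real_inner_le_norm _ _

lemma eq_zero_of_normH_eq_zero (hv : MemH n v) (h : normH n v = 0) : v = 0 := by
  rw [← norm_toL2_sobolevWeight, norm_eq_zero] at h
  funext k
  rcases eq_or_ne k 0 with rfl | hk
  · exact hv.mean
  · have hk0 : sobolevWeight n k • v k = 0 := by rw [← toL2_apply hv.memL2, h]; rfl
    exact (smul_eq_zero.mp hk0).resolve_left (Real.rpow_pos_of_pos (kabs_pos hk) n).ne'

end MemH

/-! ### Sequence inequalities -/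

/-- The family `f` has `ℓ²` norm at most `M`; quantifying over finite partial sums includes the
square summability of `f`. -/
structure L2NormLE {ι : Type*} (f : ι → ℝ) (M : ℝ) : Prop where
  bound_nonneg : 0 ≤ M
  sum_sq_le : ∀ s : Finset ι, ∑ i ∈ s, f i ^ 2 ≤ M ^ 2

namespace L2NormLE

variable {ι : Type*} {f g : ι → ℝ} {M N : ℝ}

lemma of_tsum_sq_le (hM : 0 ≤ M) (hf : Summable fun i => f i ^ 2) (h : ∑' i, f i ^ 2 ≤ M ^ 2) :
    L2NormLE f M :=
  ⟨hM, fun s => (hf.sum_le_tsum s fun _ _ => sq_nonneg _).trans h⟩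

lemma summable_sq (hf : L2NormLE f M) : Summable fun i => f i ^ 2 :=
  summable_of_sum_le (fun _ => sq_nonneg _) hf.sum_sq_le

lemma tsum_sq_le (hf : L2NormLE f M) : ∑' i, f i ^ 2 ≤ M ^ 2 :=
  hf.summable_sq.tsum_le_of_sum_le hf.sum_sq_le

lemma abs_le (hf : L2NormLE f M) (i : ι) : |f i| ≤ M :=
  abs_le_of_sq_le_sq (by simpa using hf.sum_sq_le {i}) hf.bound_nonneg

lemma mono (hg : L2NormLE g M) (h : ∀ i, |f i| ≤ |g i|) : L2NormLE f M :=
  ⟨hg.bound_nonneg, fun s => (Finset.sum_le_sum fun i _ => sq_le_sq.mpr (h i)).trans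
    (hg.sum_sq_le s)⟩

lemma mono_bound (hf : L2NormLE f M) (h : M ≤ N) : L2NormLE f N :=
  ⟨hf.bound_nonneg.trans h, fun s =>
    (hf.sum_sq_le s).trans (pow_le_pow_left₀ hf.bound_nonneg h 2)⟩

lemma const_mul (hf : L2NormLE f M) {c : ℝ} (hc : 0 ≤ c) :
    L2NormLE (fun i => c * f i) (c * M) := by
  refine ⟨mul_nonneg hc hf.bound_nonneg, fun s => ?_⟩
  simp only [mul_pow, ← Finset.mul_sum]
  exact mul_le_mul_of_nonneg_left (hf.sum_sq_le s) (sq_nonneg c)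

lemma sum_mul_le (hf : L2NormLE f M) (hg : L2NormLE g N) (s : Finset ι) :
    ∑ i ∈ s, f i * g i ≤ M * N := by
  refine abs_le_of_sq_le_sq' ?_ (mul_nonneg hf.bound_nonneg hg.bound_nonneg) |>.2
  rw [mul_pow]
  exact (Finset.sum_mul_sq_le_sq_mul_sq s f g).trans
    (mul_le_mul (hf.sum_sq_le s) (hg.sum_sq_le s) (Finset.sum_nonneg fun i _ => sq_nonneg _)
      (sq_nonneg M))

lemma summable_mul (hf : L2NormLE f M) (hg : L2NormLE g N) : Summable fun i => f i * g i := by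
  refine Summable.of_norm_bounded (hf.summable_sq.add hg.summable_sq) fun i => ?_
  rw [Real.norm_eq_abs, abs_mul, ← sq_abs (f i), ← sq_abs (g i)]
  nlinarith [sq_nonneg (|f i| - |g i|), sq_nonneg (|f i|), sq_nonneg (|g i|)]

lemma tsum_mul_le (hf : L2NormLE f M) (hg : L2NormLE g N) : ∑' i, f i * g i ≤ M * N :=
  (hf.summable_mul hg).tsum_le_of_sum_le (hf.sum_mul_le hg)

lemma add (hf : L2NormLE f M) (hg : L2NormLE g N) : L2NormLE (fun i => f i + g i) (M + N) := by
  refine ⟨add_nonneg hf.bound_nonneg hg.bound_nonneg, fun s => ?_⟩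
  simp only [add_sq, Finset.sum_add_distrib, mul_assoc, ← Finset.mul_sum]
  linarith [hf.sum_sq_le s, hg.sum_sq_le s, hf.sum_mul_le hg s]

end L2NormLE

section Convolution

variable {G : Type*} [AddCommGroup G] {a b : G → ℝ}

/-- The bijection `(k, l) ↦ (k - l, l)`, which turns convolutions into products. -/
def subProdEquiv (G : Type*) [AddCommGroup G] : G × G ≃ G × G where
  toFun p := (p.1 - p.2, p.2)
  invFun p := (p.1 + p.2, p.2)
  left_inv p := by simp
  right_inv p := by simp

lemma summable_sub_mul (ha : Summable a) (hb : Summable b) :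
    Summable fun p : G × G => a (p.1 - p.2) * b p.2 :=
  (subProdEquiv G).summable_iff.mpr (summable_mul_of_summable_norm ha.norm hb.norm)

lemma tsum_sub_mul (ha : Summable a) (hb : Summable b) :
    ∑' p : G × G, a (p.1 - p.2) * b p.2 = (∑' k, a k) * ∑' k, b k := by
  rw [tsum_mul_tsum_of_summable_norm ha.norm hb.norm]
  exact (subProdEquiv G).tsum_eq fun p => a p.1 * b p.2

lemma summable_sub_mul_right {M : ℝ} (ha : Summable a) (hb : L2NormLE b M) (k : G) :
    Summable fun l => a (k - l) * b l := by
  refine Summable.of_norm_bounded (((Equiv.subLeft k).summable_iff.mpr ha).norm.mul_right M)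
    fun l => ?_
  rw [norm_mul]
  exact mul_le_mul_of_nonneg_left (hb.abs_le l) (norm_nonneg _)

lemma summable_sub_mul_left {M : ℝ} (ha : Summable a) (hb : L2NormLE b M) (k : G) :
    Summable fun l => b (k - l) * a l :=
  (Equiv.subLeft k).summable_iff.mp ((summable_sub_mul_right ha hb k).congr fun l => by
    simp [mul_comm])

lemma tsum_sub_mul_comm (a b : G → ℝ) (k : G) :
    ∑' l, b (k - l) * a l = ∑' l, a (k - l) * b l := by
  rw [← (Equiv.subLeft k).tsum_eq]
  exact tsum_congr fun l => by simp [mul_comm]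

section Young

variable {M : ℝ} (ha : Summable a) (ha0 : ∀ k, 0 ≤ a k) (hb : L2NormLE b M)
include ha ha0 hb

lemma sq_tsum_sub_mul_le (k : G) :
    (∑' l, a (k - l) * b l) ^ 2 ≤ (∑' l, a l) * ∑' l, a (k - l) * b l ^ 2 := by
  have hak : HasSum (fun l => a (k - l)) (∑' l, a l) :=
    (Equiv.subLeft k).hasSum_iff.mpr ha.hasSum
  have hab := (summable_sub_mul_right ha hb k).hasSum
  have hab2 := ((summable_sub_mul ha hb.summable_sq).prod_factor k).hasSum
  refine le_of_tendsto_of_tendsto' (hab.pow 2) (Tendsto.mul hak hab2) fun s => ?_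
  exact Finset.sum_sq_le_sum_mul_sum_of_sq_le_mul s (fun l _ => ha0 _)
    (fun l _ => mul_nonneg (ha0 _) (sq_nonneg _)) fun l _ => le_of_eq (by ring)

lemma L2NormLE.tsum_sub_mul : L2NormLE (fun k => ∑' l, a (k - l) * b l) ((∑' l, a l) * M) := by
  have hprod := summable_sub_mul ha hb.summable_sq
  have hsum : Summable fun k => (∑' l, a l) * ∑' l, a (k - l) * b l ^ 2 := hprod.prod.mul_left _
  have hle := sq_tsum_sub_mul_le ha ha0 hb
  have hsq := Summable.of_nonneg_of_le (fun _ => sq_nonneg _) hle hsum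
  refine .of_tsum_sq_le (mul_nonneg (tsum_nonneg ha0) hb.bound_nonneg) hsq ?_
  calc ∑' k, (∑' l, a (k - l) * b l) ^ 2
      ≤ ∑' k, (∑' l, a l) * ∑' l, a (k - l) * b l ^ 2 := hsq.tsum_le_tsum hle hsum
    _ = (∑' l, a l) * ((∑' l, a l) * ∑' l, b l ^ 2) := by
        rw [tsum_mul_left, ← hprod.tsum_prod, EulerNS.tsum_sub_mul ha hb.summable_sq]
    _ ≤ (∑' l, a l) * ((∑' l, a l) * M ^ 2) := by
        gcongr
        · exact tsum_nonneg ha0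
        · exact tsum_nonneg ha0
        · exact hb.tsum_sq_le
    _ = ((∑' l, a l) * M) ^ 2 := by ring

lemma L2NormLE.tsum_sub_mul' : L2NormLE (fun k => ∑' l, b (k - l) * a l) ((∑' l, a l) * M) := by
  simp only [tsum_sub_mul_comm a b]
  exact L2NormLE.tsum_sub_mul ha ha0 hb

end Young

end Convolution

/-! ### Fourier expansion of the bilinear map -/

/-- The normalization `(2π)^(-d/2)` of the Fourier basis. -/
def fourierNormalization (d : ℕ) : ℝ := (2 * Real.pi) ^ (-(d : ℝ) / 2)

lemma fourierNormalization_pos (d : ℕ) : 0 < fourierNormalization d :=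
  Real.rpow_pos_of_pos Real.two_pi_pos _

lemma fourierNormalization_sq_mul (d : ℕ) :
    fourierNormalization d ^ 2 * (2 * Real.pi) ^ d = 1 := by
  rw [fourierNormalization, ← Real.rpow_natCast, ← Real.rpow_mul Real.two_pi_pos.le,
    ← Real.rpow_natCast (2 * Real.pi) d, ← Real.rpow_add Real.two_pi_pos]
  simp

lemma norm_expo (k : Fin d → ℤ) (x : Torus d) : ‖expo k x‖ = fourierNormalization d := by
  rw [expo, norm_mul, norm_prod, Complex.norm_real,
    Real.norm_of_nonneg (Real.rpow_nonneg Real.two_pi_pos.le _)]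
  simp [fourier_apply, Circle.norm_coe, fourierNormalization]

lemma continuous_expo (k : Fin d → ℤ) : Continuous (expo k : Torus d → ℂ) := by
  unfold expo; fun_prop

lemma integral_fourier (j : ℤ) :
    ∫ x : AddCircle (2 * Real.pi), (fourier j x : ℂ) =
      if j = 0 then ((2 * Real.pi : ℝ) : ℂ) else 0 := by
  have h : ∫ x : AddCircle (2 * Real.pi), (fourier j x : ℂ) ∂AddCircle.haarAddCircle =
      (Pi.single j 1 : ℤ → ℂ) 0 := by
    rw [← fourierCoeff_fourier (T := 2 * Real.pi) j, fourierCoeff]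
    simp
  rw [AddCircle.volume_eq_smul_haarAddCircle, integral_smul_measure, h,
    ENNReal.toReal_ofReal Real.two_pi_pos.le]
  rcases eq_or_ne j 0 with rfl | hj
  · simp
  · simp [hj, hj.symm]

lemma integral_prod_fourier (j : Fin d → ℤ) :
    ∫ x : Torus d, ∏ s, (fourier (j s) (x s) : ℂ) =
      if j = 0 then ((2 * Real.pi : ℝ) : ℂ) ^ d else 0 := by
  rw [integral_fintype_prod_volume_eq_prod
    fun s (y : AddCircle (2 * Real.pi)) => (fourier (j s) y : ℂ)]
  simp only [integral_fourier]
  split_ifs with hj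
  · simp [hj]
  · obtain ⟨s, hs⟩ := Function.ne_iff.mp hj
    exact Finset.prod_eq_zero (Finset.mem_univ s) (if_neg hs)

lemma integral_expo_mul (k h l : Fin d → ℤ) :
    ∫ x : Torus d, expo (-k) x * (expo h x * expo l x) =
      if h = k - l then (fourierNormalization d : ℂ) else 0 := by
  have hprod : ∀ x : Torus d, expo (-k) x * (expo h x * expo l x) =
      (fourierNormalization d : ℂ) ^ 3 * ∏ s, fourier ((-k + h + l) s) (x s) := fun x => by
    simp only [expo, fourierNormalization, Pi.add_apply, fourier_add, Finset.prod_mul_distrib]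
    ring
  have hiff : -k + h + l = 0 ↔ h = k - l := by
    rw [← sub_eq_zero (a := h)]; abel_nf
  simp only [hprod, integral_const_mul, integral_prod_fourier, hiff]
  split_ifs
  · have hnorm : ((fourierNormalization d ^ 2 * (2 * Real.pi) ^ d : ℝ) : ℂ) = 1 := by
      rw [fourierNormalization_sq_mul, Complex.ofReal_one]
    push_cast at hnorm ⊢
    linear_combination (fourierNormalization d : ℂ) * hnorm
  · simp

lemma tsum_ite_fst_eq_sub {G E : Type*} [AddGroup G] [DecidableEq G] [AddCommMonoid E]
    [TopologicalSpace E] (A : G × G → E) (k : G) :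
    ∑' p : G × G, (if p.1 = k - p.2 then A p else 0) = ∑' l, A (k - l, l) := by
  have hinj : Function.Injective fun l : G => (k - l, l) := fun _ _ h => (Prod.mk.inj h).2
  rw [← hinj.tsum_eq (f := fun p : G × G => if p.1 = k - p.2 then A p else 0)]
  · simp only [if_true]
  · intro p hp
    have hp' : p.1 = k - p.2 := by by_contra h; simp [h] at hp
    exact ⟨p.2, Prod.ext hp'.symm rfl⟩

lemma coeffs_tsum_expo_mul {A : (Fin d → ℤ) × (Fin d → ℤ) → EuclideanSpace ℂ (Fin d)}
    (hA : Summable fun p => ‖A p‖) (k : Fin d → ℤ) :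
    coeffs (fun x => ∑' p, (expo p.1 x * expo p.2 x) • A p) k =
      (fourierNormalization d : ℂ) • ∑' l, A (k - l, l) := by
  let F p (x : Torus d) := (expo (-k) x * (expo p.1 x * expo p.2 x)) • A p
  have hF_cont : ∀ p, Continuous (F p) := fun p => by
    have := continuous_expo (-k)
    have := continuous_expo p.1
    have := continuous_expo p.2
    fun_prop
  have hF_int : ∀ p, Integrable (F p) := fun p =>
    (hF_cont p).integrable_of_hasCompactSupport (HasCompactSupport.of_compactSpace _)
  have hF_sum : Summable fun p => ∫ x, ‖F p x‖ := by
    simp only [F, norm_smul, norm_mul, norm_expo, integral_const]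
    exact (hA.mul_left _).const_smul _
  calc coeffs (fun x => ∑' p, (expo p.1 x * expo p.2 x) • A p) k
      = ∫ x, ∑' p, F p x := by simp only [coeffs, F, ← tsum_const_smul'', smul_smul]
    _ = ∑' p, ∫ x, F p x := (integral_tsum_of_summable_integral_norm hF_int hF_sum).symm
    _ = ∑' p, if p.1 = k - p.2 then (fourierNormalization d : ℂ) • A p else 0 := by
        simp only [F, integral_smul_const, integral_expo_mul, ite_smul, zero_smul]
    _ = (fourierNormalization d : ℂ) • ∑' l, A (k - l, l) := by
        rw [tsum_ite_fst_eq_sub, tsum_const_smul'']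

/-- The term `(l • v_h) w_l`: the Fourier coefficient of `-i v • ∂w` of index `h + l` collects these
terms. -/
def advectTerm (v w : VField d) (h l : Fin d → ℤ) : EuclideanSpace ℂ (Fin d) :=
  (∑ s, (l s : ℂ) * v h s) • w l

lemma norm_advectTerm_le (v w : VField d) (h l : Fin d → ℤ) :
    ‖advectTerm v w h l‖ ≤ ‖v h‖ * (kabs l * ‖w l‖) := by
  rw [advectTerm, norm_smul]
  calc ‖∑ s, (l s : ℂ) * v h s‖ * ‖w l‖ ≤ (kabs l * ‖v h‖) * ‖w l‖ := by
        gcongr; exact norm_sum_mul_le l (v h)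
    _ = ‖v h‖ * (kabs l * ‖w l‖) := by ring

lemma hasSum_evalAt {v : VField d} (hv : Summable fun k => ‖v k‖) (x : Torus d) :
    HasSum (fun k => expo k x • v k) (evalAt v x) := by
  refine (Summable.of_norm_bounded (hv.mul_left (fourierNormalization d)) fun k => ?_).hasSum
  rw [norm_smul, norm_expo]

section BilinearMap

variable {v w : VField d}

lemma summable_norm_pderiv (hw : Summable fun k => kabs k * ‖w k‖) (s : Fin d) :
    Summable fun k => ‖pderiv s w k‖ := by
  refine Summable.of_nonneg_of_le (fun _ => norm_nonneg _) (fun k => ?_) hw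
  rw [pderiv, norm_smul]
  gcongr
  simpa using abs_apply_le_kabs k s

lemma hasSum_smul_evalAt (hv : Summable fun k => ‖v k‖) (hw : Summable fun k => ‖w k‖)
    (s : Fin d) (x : Torus d) :
    HasSum (fun p : (Fin d → ℤ) × (Fin d → ℤ) => (expo p.1 x * expo p.2 x) • (v p.1 s • w p.2))
      (evalAt v x s • evalAt w x) := by
  have hvs : HasSum (fun k => expo k x * v k s) (evalAt v x s) :=
    (hasSum_evalAt hv x).mapL (EuclideanSpace.proj s : EuclideanSpace ℂ (Fin d) →L[ℂ] ℂ)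
  have hsum : Summable fun p : (Fin d → ℤ) × (Fin d → ℤ) =>
      (expo p.1 x * v p.1 s) • (expo p.2 x • w p.2) := by
    refine Summable.of_norm_bounded ((summable_mul_of_summable_norm hv.norm hw.norm).mul_left
      (fourierNormalization d ^ 2)) fun p => ?_
    simp only [norm_smul, norm_mul, norm_expo]
    calc fourierNormalization d * ‖v p.1 s‖ * (fourierNormalization d * ‖w p.2‖)
        ≤ fourierNormalization d * ‖v p.1‖ * (fourierNormalization d * ‖w p.2‖) := by
          have := (fourierNormalization_pos d).le
          gcongr
          exact PiLp.norm_apply_le _ s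
      _ = fourierNormalization d ^ 2 * (‖v p.1‖ * ‖w p.2‖) := by ring
  refine (hvs.smul (hasSum_evalAt hw x) hsum).congr_fun fun p => ?_
  module

section Summable

variable (hv : Summable fun k => ‖v k‖) (hw : Summable fun k => kabs k * ‖w k‖)
include hv hw

lemma advect_eq_tsum (x : Torus d) :
    advect v w x = ∑' p : (Fin d → ℤ) × (Fin d → ℤ),
      (expo p.1 x * expo p.2 x) • (Complex.I • advectTerm v w p.1 p.2) := by
  have hsum := hasSum_sum (s := Finset.univ) fun s _ =>
    hasSum_smul_evalAt hv (summable_norm_pderiv hw s) s x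
  rw [advect, ← hsum.tsum_eq]
  refine tsum_congr fun p => ?_
  simp only [pderiv, advectTerm, smul_smul, ← Finset.sum_smul, Finset.mul_sum]
  congr 2
  funext s
  ring

lemma summable_norm_advectTerm :
    Summable fun p : (Fin d → ℤ) × (Fin d → ℤ) => ‖advectTerm v w p.1 p.2‖ :=
  Summable.of_nonneg_of_le (fun _ => norm_nonneg _) (fun p => norm_advectTerm_le v w p.1 p.2)
    (summable_mul_of_summable_norm hv.norm hw.norm)

lemma coeffs_advect (k : Fin d → ℤ) :
    coeffs (advect v w) k =
      ((fourierNormalization d : ℂ) * Complex.I) • ∑' l, advectTerm v w (k - l) l := by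
  have hA : Summable fun p : (Fin d → ℤ) × (Fin d → ℤ) =>
      ‖Complex.I • advectTerm v w p.1 p.2‖ := by
    simpa only [norm_smul, Complex.norm_I, one_mul] using summable_norm_advectTerm hv hw
  rw [funext (advect_eq_tsum hv hw), coeffs_tsum_expo_mul hA, tsum_const_smul'', smul_smul]

lemma summable_advectTerm (k : Fin d → ℤ) : Summable fun l => advectTerm v w (k - l) l :=
  Summable.of_norm_bounded ((summable_sub_mul hv hw).prod_factor k)
    fun l => norm_advectTerm_le v w (k - l) l

end Summable

end BilinearMap

/-! ### The Leray projection -/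

/-- The orthogonal projection of `ℂ^d` onto the complement of `k`, by which `leray` acts on the
Fourier coefficient of index `k`. -/
def lerayAt (k : Fin d → ℤ) : EuclideanSpace ℂ (Fin d) →L[ℂ] EuclideanSpace ℂ (Fin d) :=
  (ℂ ∙ kvec k)ᗮ.starProjection

lemma lerayAt_apply (k : Fin d → ℤ) (x : EuclideanSpace ℂ (Fin d)) :
    lerayAt k x = x - ((∑ s, (k s : ℂ) * x s) / ((kabs k ^ 2 : ℝ) : ℂ)) • kvec k := by
  rw [lerayAt, Submodule.starProjection_orthogonal', sub_apply,
    one_apply_eq_self, Submodule.starProjection_singleton, inner_kvec, norm_kvec]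
  norm_cast

lemma leray_apply (v : VField d) (k : Fin d → ℤ) : leray v k = lerayAt k (v k) :=
  (lerayAt_apply k (v k)).symm

lemma norm_lerayAt_le (k : Fin d → ℤ) (x : EuclideanSpace ℂ (Fin d)) : ‖lerayAt k x‖ ≤ ‖x‖ :=
  Submodule.norm_starProjection_apply_le _ x

lemma sum_mul_lerayAt (k : Fin d → ℤ) (x : EuclideanSpace ℂ (Fin d)) :
    ∑ s, (k s : ℂ) * lerayAt k x s = 0 := by
  rw [← inner_kvec]
  exact Submodule.mem_orthogonal_singleton_iff_inner_right.mp
    (Submodule.starProjection_apply_mem _ x)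

lemma inner_lerayAt (k : Fin d → ℤ) {w : EuclideanSpace ℂ (Fin d)}
    (hw : ∑ s, (k s : ℂ) * w s = 0) (x : EuclideanSpace ℂ (Fin d)) :
    inner ℂ (lerayAt k x) w = inner ℂ x w := by
  rw [← inner_kvec] at hw
  rw [lerayAt, Submodule.inner_starProjection_left_eq_right,
    Submodule.starProjection_eq_self_iff.mpr
      (Submodule.mem_orthogonal_singleton_iff_inner_right.mpr hw)]

/-- Coordinatewise complex conjugation. -/
def conjV (x : EuclideanSpace ℂ (Fin d)) : EuclideanSpace ℂ (Fin d) :=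
  WithLp.toLp 2 fun s => (starRingEnd ℂ) (x s)

@[simp] lemma conjV_apply (x : EuclideanSpace ℂ (Fin d)) (s : Fin d) :
    conjV x s = (starRingEnd ℂ) (x s) := rfl

lemma lerayAt_neg_conjV (k : Fin d → ℤ) (x : EuclideanSpace ℂ (Fin d)) :
    lerayAt (-k) (conjV x) = conjV (lerayAt k x) := by
  ext s
  simp [lerayAt_apply, map_sum, neg_div, sub_eq_add_neg]

lemma tsum_apply_euclidean {ι : Type*} {f : ι → EuclideanSpace ℂ (Fin d)} (hf : Summable f)
    (s : Fin d) : (∑' i, f i) s = ∑' i, f i s :=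
  (EuclideanSpace.proj s : EuclideanSpace ℂ (Fin d) →L[ℂ] ℂ).map_tsum hf

/-! ### Algebraic properties of the bilinear map -/

section BilinearMap

variable {v v' w w' : VField d}

lemma sum_mul_bilin (v w : VField d) (k : Fin d → ℤ) : ∑ s, (k s : ℂ) * bilin v w k s = 0 := by
  rw [← inner_kvec, bilin, Pi.neg_apply, leray_apply, inner_neg_right, inner_kvec,
    sum_mul_lerayAt, neg_zero]

lemma bilin_apply (hv : Summable fun k => ‖v k‖) (hw : Summable fun k => kabs k * ‖w k‖)
    (k : Fin d → ℤ) :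
    bilin v w k = -((fourierNormalization d : ℂ) * Complex.I) •
      lerayAt k (∑' l, advectTerm v w (k - l) l) := by
  rw [bilin, Pi.neg_apply, leray_apply, coeffs_advect hv hw, map_smul, neg_smul]

lemma norm_bilin_le (hv : Summable fun k => ‖v k‖) (hw : Summable fun k => kabs k * ‖w k‖)
    (k : Fin d → ℤ) :
    ‖bilin v w k‖ ≤ fourierNormalization d * ∑' l, ‖v (k - l)‖ * (kabs l * ‖w l‖) := by
  have hterm : ‖∑' l, advectTerm v w (k - l) l‖ ≤ ∑' l, ‖v (k - l)‖ * (kabs l * ‖w l‖) :=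
    tsum_of_norm_bounded ((summable_sub_mul hv hw).prod_factor k).hasSum
      fun l => norm_advectTerm_le v w (k - l) l
  have hnorm : ‖-((fourierNormalization d : ℂ) * Complex.I)‖ = fourierNormalization d := by
    simp [abs_of_pos (fourierNormalization_pos d)]
  rw [bilin_apply hv hw, norm_smul, hnorm]
  exact mul_le_mul_of_nonneg_left ((norm_lerayAt_le k _).trans hterm)
    (fourierNormalization_pos d).le

lemma advectTerm_add_left (v v' w : VField d) (h l : Fin d → ℤ) :
    advectTerm (v + v') w h l = advectTerm v w h l + advectTerm v' w h l := by
  simp [advectTerm, mul_add, Finset.sum_add_distrib, add_smul]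

lemma advectTerm_add_right (v w w' : VField d) (h l : Fin d → ℤ) :
    advectTerm v (w + w') h l = advectTerm v w h l + advectTerm v w' h l := by
  simp [advectTerm]

lemma advectTerm_smul_left (c : ℝ) (v w : VField d) (h l : Fin d → ℤ) :
    advectTerm (c • v) w h l = (c : ℂ) • advectTerm v w h l := by
  simp only [advectTerm, Pi.smul_apply, PiLp.smul_apply, Complex.real_smul, smul_smul,
    Finset.mul_sum, mul_left_comm]

lemma advectTerm_smul_right (c : ℝ) (v w : VField d) (h l : Fin d → ℤ) :
    advectTerm v (c • w) h l = (c : ℂ) • advectTerm v w h l := by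
  rw [advectTerm, advectTerm, Pi.smul_apply, smul_comm, Complex.coe_smul]

lemma summable_norm_add (hv : Summable fun k => ‖v k‖) (hv' : Summable fun k => ‖v' k‖) :
    Summable fun k => ‖(v + v') k‖ :=
  Summable.of_nonneg_of_le (fun _ => norm_nonneg _) (fun _ => norm_add_le _ _) (hv.add hv')

lemma summable_norm_smul (c : ℝ) (hv : Summable fun k => ‖v k‖) :
    Summable fun k => ‖(c • v) k‖ := by
  simpa only [Pi.smul_apply, norm_smul] using hv.mul_left ‖c‖

lemma bilin_add_left (hv : Summable fun k => ‖v k‖) (hv' : Summable fun k => ‖v' k‖)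
    (hw : Summable fun k => kabs k * ‖w k‖) : bilin (v + v') w = bilin v w + bilin v' w := by
  funext k
  rw [Pi.add_apply, bilin_apply (summable_norm_add hv hv') hw, bilin_apply hv hw,
    bilin_apply hv' hw, ← smul_add, ← map_add,
    ← (summable_advectTerm hv hw k).tsum_add (summable_advectTerm hv' hw k)]
  simp only [advectTerm_add_left]

lemma summable_kabs_mul_norm_add (hw : Summable fun k => kabs k * ‖w k‖)
    (hw' : Summable fun k => kabs k * ‖w' k‖) : Summable fun k => kabs k * ‖(w + w') k‖ :=
  Summable.of_nonneg_of_le (fun k => mul_nonneg (kabs_nonneg k) (norm_nonneg _))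
    (fun k => (mul_le_mul_of_nonneg_left (norm_add_le _ _) (kabs_nonneg k)).trans_eq
      (mul_add _ _ _)) (hw.add hw')

lemma summable_kabs_mul_norm_smul (c : ℝ) (hw : Summable fun k => kabs k * ‖w k‖) :
    Summable fun k => kabs k * ‖(c • w) k‖ := by
  simpa only [Pi.smul_apply, norm_smul, mul_left_comm] using hw.mul_left ‖c‖

lemma bilin_add_right (hv : Summable fun k => ‖v k‖) (hw : Summable fun k => kabs k * ‖w k‖)
    (hw' : Summable fun k => kabs k * ‖w' k‖) : bilin v (w + w') = bilin v w + bilin v w' := by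
  funext k
  rw [Pi.add_apply, bilin_apply hv (summable_kabs_mul_norm_add hw hw'), bilin_apply hv hw,
    bilin_apply hv hw', ← smul_add, ← map_add,
    ← (summable_advectTerm hv hw k).tsum_add (summable_advectTerm hv hw' k)]
  simp only [advectTerm_add_right]

lemma bilin_smul_left (c : ℝ) (hv : Summable fun k => ‖v k‖)
    (hw : Summable fun k => kabs k * ‖w k‖) : bilin (c • v) w = c • bilin v w := by
  funext k
  rw [Pi.smul_apply, bilin_apply (summable_norm_smul c hv) hw, bilin_apply hv hw]
  simp only [advectTerm_smul_left]
  rw [tsum_const_smul'', map_smul, smul_comm, Complex.coe_smul]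

lemma bilin_smul_right (c : ℝ) (hv : Summable fun k => ‖v k‖)
    (hw : Summable fun k => kabs k * ‖w k‖) : bilin v (c • w) = c • bilin v w := by
  funext k
  rw [Pi.smul_apply, bilin_apply hv (summable_kabs_mul_norm_smul c hw), bilin_apply hv hw]
  simp only [advectTerm_smul_right]
  rw [tsum_const_smul'', map_smul, smul_comm, Complex.coe_smul]

lemma bilin_self_sub_bilin_self (hv : Summable fun k => ‖v k‖)
    (hv' : Summable fun k => kabs k * ‖v k‖) (hw : Summable fun k => ‖w k‖)
    (hw' : Summable fun k => kabs k * ‖w k‖) :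
    bilin v v - bilin w w = bilin v (v - w) + bilin (v - w) w := by
  have hneg : Summable fun k => ‖((-1 : ℝ) • w) k‖ := summable_norm_smul _ hw
  have hneg' : Summable fun k => kabs k * ‖((-1 : ℝ) • w) k‖ := summable_kabs_mul_norm_smul _ hw'
  have hsub : v - w = v + (-1 : ℝ) • w := by module
  rw [hsub, bilin_add_right hv hv' hneg', bilin_add_left hv hneg hw',
    bilin_smul_right _ hv hw', bilin_smul_left _ hw hw']
  module

lemma tsum_advectTerm_neg (hv : Summable fun k => ‖v k‖) (hw : Summable fun k => kabs k * ‖w k‖)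
    (hvr : ∀ k r, v (-k) r = (starRingEnd ℂ) (v k r))
    (hwr : ∀ k r, w (-k) r = (starRingEnd ℂ) (w k r)) (k : Fin d → ℤ) :
    ∑' l, advectTerm v w (-k - l) l = -conjV (∑' l, advectTerm v w (k - l) l) := by
  ext s
  rw [tsum_apply_euclidean (summable_advectTerm hv hw _), PiLp.neg_apply, conjV_apply,
    tsum_apply_euclidean (summable_advectTerm hv hw _), Complex.conj_tsum, ← tsum_neg,
    ← (Equiv.neg (Fin d → ℤ)).tsum_eq]
  refine tsum_congr fun l => ?_
  have hneg : -k - -l = -(k - l) := by abel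
  simp only [advectTerm, Equiv.neg_apply, hneg, hvr, PiLp.smul_apply, smul_eq_mul, hwr,
    map_mul, map_sum, Pi.neg_apply, Int.cast_neg, neg_mul, Finset.sum_neg_distrib, map_intCast]

lemma bilin_neg_apply (hv : Summable fun k => ‖v k‖) (hw : Summable fun k => kabs k * ‖w k‖)
    (hvr : ∀ k r, v (-k) r = (starRingEnd ℂ) (v k r))
    (hwr : ∀ k r, w (-k) r = (starRingEnd ℂ) (w k r)) (k : Fin d → ℤ) (r : Fin d) :
    bilin v w (-k) r = (starRingEnd ℂ) (bilin v w k r) := by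
  rw [bilin_apply hv hw, bilin_apply hv hw, tsum_advectTerm_neg hv hw hvr hwr, map_neg,
    lerayAt_neg_conjV]
  simp

lemma sum_mul_eq_of_div_eq_zero (hv : ∀ k, ∑ s, (k s : ℂ) * v k s = 0) (k l : Fin d → ℤ) :
    ∑ s, (l s : ℂ) * v (k - l) s = ∑ s, (k s : ℂ) * v (k - l) s := by
  have hdiff : ∑ s, ((k - l) s : ℂ) * v (k - l) s = 0 := hv (k - l)
  simp only [Pi.sub_apply, Int.cast_sub, sub_mul, Finset.sum_sub_distrib] at hdiff
  exact (sub_eq_zero.mp hdiff).symm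

lemma bilin_zero_apply (hv : Summable fun k => ‖v k‖) (hw : Summable fun k => kabs k * ‖w k‖)
    (hdiv : ∀ k, ∑ s, (k s : ℂ) * v k s = 0) : bilin v w 0 = 0 := by
  have hterm : ∀ l, advectTerm v w (0 - l) l = 0 := fun l => by
    rw [advectTerm, sum_mul_eq_of_div_eq_zero hdiv]
    simp
  simp only [bilin_apply hv hw, hterm, tsum_zero, map_zero, smul_zero]

end BilinearMap

/-! ### Sobolev estimates for the bilinear map -/

section Embedding

variable {n : ℝ} {v : VField d}

lemma MemL2.l2NormLE {φ : (Fin d → ℤ) → ℝ} (hv : MemL2 φ v) :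
    L2NormLE (fun k => φ k * ‖v k‖) ‖toL2 φ v‖ := by
  refine .of_tsum_sq_le (norm_nonneg _) ?_ ?_ <;> simp only [mul_pow]
  exacts [memL2_iff_summable.mp hv, (norm_toL2_sq φ v).ge]

lemma MemH.l2NormLE (hv : MemH n v) : L2NormLE (fun k => kabs k ^ n * ‖v k‖) (normH n v) := by
  have h := hv.memL2.l2NormLE
  rwa [norm_toL2_sobolevWeight] at h

lemma summable_of_l2NormLE {M : ℝ} (h : L2NormLE (fun k => kabs k ^ n * ‖v k‖) M) :
    Summable fun k => kabs k ^ (2 * n) * ‖v k‖ ^ 2 := by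
  simpa only [mul_pow, sq_kabs_rpow] using h.summable_sq

lemma normH_le_of_l2NormLE {M : ℝ} (h : L2NormLE (fun k => kabs k ^ n * ‖v k‖) M) :
    normH n v ≤ M := by
  refine Real.sqrt_le_iff.mpr ⟨h.bound_nonneg, ?_⟩
  simpa only [mul_pow, sq_kabs_rpow] using h.tsum_sq_le

/-- The constant of the embedding of `H^n` into the fields with summable `|k| |v_k|`. -/
def wienerConst (d : ℕ) (n : ℝ) : ℝ := √(∑' k : Fin d → ℤ, kabs k ^ (2 - 2 * n))

lemma wienerConst_nonneg (d : ℕ) (n : ℝ) : 0 ≤ wienerConst d n := Real.sqrt_nonneg _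

lemma l2NormLE_kabs_rpow (hn : (d : ℝ) / 2 + 1 < n) :
    L2NormLE (fun k : Fin d → ℤ => kabs k ^ (1 - n)) (wienerConst d n) := by
  have hsq : ∀ k : Fin d → ℤ, (kabs k ^ (1 - n)) ^ 2 = kabs k ^ (2 - 2 * n) := fun k => by
    rw [sq_kabs_rpow]; ring_nf
  refine .of_tsum_sq_le (wienerConst_nonneg d n) ?_ ?_ <;> simp only [hsq]
  · exact summable_kabs_rpow (by linarith)
  · exact (Real.sq_sqrt (tsum_nonneg fun k => Real.rpow_nonneg (kabs_nonneg k) _)).ge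

lemma norm_le_kabs_mul_norm (hv : v 0 = 0) (k : Fin d → ℤ) : ‖v k‖ ≤ kabs k * ‖v k‖ := by
  rcases eq_or_ne k 0 with rfl | hk
  · simp [hv]
  · exact le_mul_of_one_le_left (norm_nonneg _) (one_le_kabs hk)

lemma kabs_rpow_one_sub_mul (hv : v 0 = 0) (k : Fin d → ℤ) :
    kabs k ^ (1 - n) * (kabs k ^ n * ‖v k‖) = kabs k * ‖v k‖ := by
  rcases eq_or_ne k 0 with rfl | hk
  · simp [hv]
  · rw [← mul_assoc, ← Real.rpow_add (kabs_pos hk), sub_add_cancel, Real.rpow_one]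

namespace MemH

variable (hn : (d : ℝ) / 2 + 1 < n) (hv : MemH n v)
include hn hv

lemma summable_kabs_mul_norm : Summable fun k => kabs k * ‖v k‖ :=
  ((l2NormLE_kabs_rpow hn).summable_mul hv.l2NormLE).congr (kabs_rpow_one_sub_mul hv.mean)

lemma tsum_kabs_mul_norm_le : ∑' k, kabs k * ‖v k‖ ≤ wienerConst d n * normH n v := by
  simpa only [kabs_rpow_one_sub_mul hv.mean] using
    (l2NormLE_kabs_rpow hn).tsum_mul_le hv.l2NormLE

lemma summable_norm : Summable fun k => ‖v k‖ :=
  Summable.of_nonneg_of_le (fun _ => norm_nonneg _) (norm_le_kabs_mul_norm hv.mean)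
    (hv.summable_kabs_mul_norm hn)

lemma tsum_norm_le : ∑' k, ‖v k‖ ≤ wienerConst d n * normH n v :=
  ((hv.summable_norm hn).tsum_le_tsum (norm_le_kabs_mul_norm hv.mean)
    (hv.summable_kabs_mul_norm hn)).trans (hv.tsum_kabs_mul_norm_le hn)

end MemH

end Embedding

/-- The constant in the estimate of `𝒫` on `H^n × H^{n+1}`. -/
def bilinConst (d : ℕ) (n : ℝ) : ℝ := fourierNormalization d * 2 ^ n * wienerConst d n

lemma bilinConst_nonneg (d : ℕ) (n : ℝ) : 0 ≤ bilinConst d n := by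
  have := (fourierNormalization_pos d).le
  have := wienerConst_nonneg d n
  unfold bilinConst; positivity

lemma kabs_rpow_mul_tsum_le {n M : ℝ} (hn : 1 ≤ n) {v w : VField d}
    (hv : Summable fun k => ‖v k‖) (hw : Summable fun k => kabs k * ‖w k‖)
    (hv' : L2NormLE (fun k => kabs k ^ n * ‖v k‖) M)
    {N : ℝ} (hw' : L2NormLE (fun k => kabs k ^ n * (kabs k * ‖w k‖)) N) (k : Fin d → ℤ) :
    kabs k ^ n * ∑' l, ‖v (k - l)‖ * (kabs l * ‖w l‖) ≤
      2 ^ (n - 1) * (∑' l, kabs (k - l) ^ n * ‖v (k - l)‖ * (kabs l * ‖w l‖) +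
        ∑' l, ‖v (k - l)‖ * (kabs l ^ n * (kabs l * ‖w l‖))) := by
  have hleft : Summable fun l => kabs (k - l) ^ n * ‖v (k - l)‖ * (kabs l * ‖w l‖) :=
    summable_sub_mul_left hw hv' k
  have hright : Summable fun l => ‖v (k - l)‖ * (kabs l ^ n * (kabs l * ‖w l‖)) :=
    summable_sub_mul_right hv hw' k
  rw [← tsum_mul_left, ← hleft.tsum_add hright, ← tsum_mul_left]
  refine Summable.tsum_le_tsum (fun l => ?_)
    (((summable_sub_mul hv hw).prod_factor k).mul_left _) ((hleft.add hright).mul_left _)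
  have hpow : kabs k ^ n ≤ 2 ^ (n - 1) * (kabs (k - l) ^ n + kabs l ^ n) :=
    (Real.rpow_le_rpow (kabs_nonneg k) (kabs_le_sub_add k l) (by linarith)).trans
      (NNReal.rpow_add_le_mul_rpow_add_rpow ⟨_, kabs_nonneg (k - l)⟩ ⟨_, kabs_nonneg l⟩ hn)
  calc kabs k ^ n * (‖v (k - l)‖ * (kabs l * ‖w l‖))
      ≤ 2 ^ (n - 1) * (kabs (k - l) ^ n + kabs l ^ n) * (‖v (k - l)‖ * (kabs l * ‖w l‖)) := by
        have := kabs_nonneg l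
        gcongr
    _ = _ := by ring

section Bilin

variable {n : ℝ} (hn : (d : ℝ) / 2 + 1 < n) {v w : VField d} (hv : MemH n v) (hw : MemH (n + 1) w)
include hn hv hw

lemma l2NormLE_bilin : L2NormLE (fun k => kabs k ^ n * ‖bilin v w k‖)
    (bilinConst d n * normH n v * normH (n + 1) w) := by
  have hn1 : 1 ≤ n := by have : (0 : ℝ) ≤ d := d.cast_nonneg; linarith
  have hwn : MemH n w := hw.mono (by linarith)
  have hvs := hv.summable_norm hn
  have hws := hwn.summable_kabs_mul_norm hn
  have hw1 : L2NormLE (fun k => kabs k ^ n * (kabs k * ‖w k‖)) (normH (n + 1) w) := by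
    simpa only [Real.rpow_add_one' (kabs_nonneg _) (by linarith : n + 1 ≠ 0), mul_assoc]
      using hw.l2NormLE
  have hX := L2NormLE.tsum_sub_mul' hws
    (fun k => mul_nonneg (kabs_nonneg k) (norm_nonneg _)) hv.l2NormLE
  have hY := L2NormLE.tsum_sub_mul hvs (fun k => norm_nonneg _) hw1
  have hc := fourierNormalization_pos d
  refine (((hX.add hY).const_mul (c := fourierNormalization d * 2 ^ (n - 1)) (by positivity)).mono
    fun k => ?_).mono_bound ?_
  · have hk := Real.rpow_nonneg (kabs_nonneg k) n
    rw [abs_of_nonneg (mul_nonneg hk (norm_nonneg _))]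
    refine le_trans ?_ (le_abs_self _)
    calc kabs k ^ n * ‖bilin v w k‖
        ≤ kabs k ^ n * (fourierNormalization d * ∑' l, ‖v (k - l)‖ * (kabs l * ‖w l‖)) := by
          gcongr; exact norm_bilin_le hvs hws k
      _ = fourierNormalization d * (kabs k ^ n * ∑' l, ‖v (k - l)‖ * (kabs l * ‖w l‖)) := by ring
      _ ≤ _ := by
          rw [mul_assoc]
          refine mul_le_mul_of_nonneg_left ?_ hc.le
          exact kabs_rpow_mul_tsum_le hn1 hvs hws hv.l2NormLE hw1 k
  · have hv0 := normH_nonneg n v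
    have hw0 := normH_nonneg (n + 1) w
    have hW := wienerConst_nonneg d n
    calc _ ≤ fourierNormalization d * 2 ^ (n - 1) *
          (wienerConst d n * normH (n + 1) w * normH n v +
            wienerConst d n * normH n v * normH (n + 1) w) := by
          gcongr
          · exact (hwn.tsum_kabs_mul_norm_le hn).trans
              (by gcongr; exact hw.normH_mono (by linarith))
          · exact hv.tsum_norm_le hn
      _ = _ := by rw [bilinConst, Real.rpow_sub_one two_ne_zero]; ring

lemma MemH.bilin : MemH n (bilin v w) :=
  have hwn : MemH n w := hw.mono (by linarith)
  { real := bilin_neg_apply (hv.summable_norm hn) (hwn.summable_kabs_mul_norm hn) hv.real hw.real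
    mean := bilin_zero_apply (hv.summable_norm hn) (hwn.summable_kabs_mul_norm hn) hv.div
    div := sum_mul_bilin v w
    summable := summable_of_l2NormLE (l2NormLE_bilin hn hv hw) }

lemma normH_bilin_le :
    normH n (EulerNS.bilin v w) ≤ bilinConst d n * normH n v * normH (n + 1) w :=
  normH_le_of_l2NormLE (l2NormLE_bilin hn hv hw)

end Bilin

lemma normH_zero_bilin_le {n : ℝ} (hn : (d : ℝ) / 2 + 1 < n) {v w : VField d} (hv : MemH n v)
    (hw : MemH n w) : normH 0 (bilin v w) ≤ bilinConst d n * normH n w * normH 0 v := by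
  have hn0 : 0 ≤ n := by have : (0 : ℝ) ≤ d := d.cast_nonneg; linarith
  have hv0 : L2NormLE (fun k => ‖v k‖) (normH 0 v) := by
    simpa only [Real.rpow_zero, one_mul] using (hv.mono hn0).l2NormLE
  have hws := hw.summable_kabs_mul_norm hn
  have hX := (L2NormLE.tsum_sub_mul' hws
    (fun k => mul_nonneg (kabs_nonneg k) (norm_nonneg _)) hv0).const_mul
    (fourierNormalization_pos d).le
  have hbilin : normH 0 (bilin v w) ≤
      fourierNormalization d * ((∑' k, kabs k * ‖w k‖) * normH 0 v) := by
    refine normH_le_of_l2NormLE (hX.mono fun k => ?_)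
    rw [Real.rpow_zero, one_mul, abs_norm]
    exact (norm_bilin_le (hv.summable_norm hn) hws k).trans (le_abs_self _)
  have hc := (fourierNormalization_pos d).le
  have hW := wienerConst_nonneg d n
  have hwn := normH_nonneg n w
  have hvn := normH_nonneg 0 v
  calc normH 0 (bilin v w)
      ≤ fourierNormalization d * (wienerConst d n * normH n w * normH 0 v) * 1 := by
        rw [mul_one]
        exact hbilin.trans (by gcongr; exact hw.tsum_kabs_mul_norm_le hn)
    _ ≤ fourierNormalization d * (wienerConst d n * normH n w * normH 0 v) * 2 ^ n := by
        gcongr; exact Real.one_le_rpow one_le_two hn0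
    _ = _ := by rw [bilinConst]; ring

/-! ### Energy estimates -/

/-- The contribution of the pair `(k, l)` of frequencies to the energy balance `⟨𝒫(v,w) | w⟩`, up
to the Fourier normalization. -/
def energyTerm (v w : VField d) (k l : Fin d → ℤ) : ℝ :=
  (inner ℂ (-Complex.I • advectTerm v w (k - l) l) (w k)).re

/-- As `v` is real and divergence free, the factor `l · v_{k-l} = k · v_{k-l}` turns into its
conjugate when `k` and `l` are exchanged. -/
lemma energyTerm_swap {n : ℝ} {v : VField d} (hv : MemH n v) (w : VField d) (k l : Fin d → ℤ) :
    energyTerm v w l k = -energyTerm v w k l := by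
  have hconj : ∑ s, (k s : ℂ) * v (l - k) s = (starRingEnd ℂ) (∑ s, (l s : ℂ) * v (k - l) s) := by
    rw [sum_mul_eq_of_div_eq_zero hv.div, map_sum]
    refine Finset.sum_congr rfl fun s _ => ?_
    rw [map_mul, map_intCast, ← neg_sub k l, hv.real]
  simp only [energyTerm, advectTerm, hconj, smul_smul, inner_smul_left]
  rw [← inner_conj_symm (w k) (w l)]
  simp only [map_mul, map_neg, Complex.conj_I, Complex.conj_conj, Complex.mul_re, Complex.mul_im,
    Complex.neg_re, Complex.neg_im, Complex.I_re, Complex.I_im, Complex.conj_re, Complex.conj_im]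
  ring

lemma abs_energyTerm_le (v w : VField d) (k l : Fin d → ℤ) :
    |energyTerm v w k l| ≤ ‖v (k - l)‖ * (kabs l * ‖w l‖) * ‖w k‖ := by
  refine (Complex.abs_re_le_norm _).trans ((norm_inner_le_norm _ _).trans ?_)
  gcongr
  simpa only [norm_smul, norm_neg, Complex.norm_I, one_mul] using norm_advectTerm_le v w (k - l) l

lemma re_inner_bilin {v w : VField d} (hv : Summable fun k => ‖v k‖)
    (hw : Summable fun k => kabs k * ‖w k‖) (hdiv : ∀ k, ∑ s, (k s : ℂ) * w k s = 0)
    (k : Fin d → ℤ) :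
    (inner ℂ (bilin v w k) (w k)).re = fourierNormalization d * ∑' l, energyTerm v w k l := by
  have hsum : ∑' l, energyTerm v w k l =
      (inner ℂ (∑' l, -Complex.I • advectTerm v w (k - l) l) (w k)).re := by
    have hmap := (innerSL ℝ (w k)).map_tsum
      ((summable_advectTerm hv hw k).const_smul (-Complex.I))
    simp only [innerSL_apply_apply] at hmap
    simp only [energyTerm, re_inner_eq_real_inner, real_inner_comm (w k), hmap]
  rw [hsum, tsum_const_smul'', bilin_apply hv hw, inner_smul_left, inner_lerayAt k (hdiv k),
    inner_smul_left]
  simp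

lemma tsum_antisymm_eq_zero {ι : Type*} {f : ι × ι → ℝ} (h : ∀ a b, f (b, a) = -f (a, b)) :
    ∑' p, f p = 0 := by
  have hswap := (Equiv.prodComm ι ι).tsum_eq f
  have hneg : ∀ p : ι × ι, f (Equiv.prodComm ι ι p) = -f p := fun p => h p.1 p.2
  simp only [hneg, tsum_neg] at hswap
  linarith

section Trilinear

variable {G : Type*} [AddCommGroup G] {a x y : G → ℝ} {M N : ℝ} (ha : Summable a)
  (ha0 : ∀ k, 0 ≤ a k) (hx : L2NormLE x M) (hx0 : ∀ k, 0 ≤ x k) (hy : L2NormLE y N)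
  (hy0 : ∀ k, 0 ≤ y k)
include ha ha0 hx hx0 hy hy0

lemma summable_sub_mul_mul : Summable fun p : G × G => a (p.1 - p.2) * x p.2 * y p.1 := by
  rw [summable_prod_of_nonneg fun p => mul_nonneg (mul_nonneg (ha0 _) (hx0 _)) (hy0 _)]
  refine ⟨fun k => (summable_sub_mul_right ha hx k).mul_right (y k), ?_⟩
  simpa only [tsum_mul_right] using (L2NormLE.tsum_sub_mul ha ha0 hx).summable_mul hy

lemma tsum_sub_mul_mul_le :
    ∑' p : G × G, a (p.1 - p.2) * x p.2 * y p.1 ≤ (∑' k, a k) * M * N := by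
  rw [(summable_sub_mul_mul ha ha0 hx hx0 hy hy0).tsum_prod]
  simpa only [tsum_mul_right] using (L2NormLE.tsum_sub_mul ha ha0 hx).tsum_mul_le hy

omit hy hy0 in
lemma abs_tsum_le_of_abs_le_sub_mul_mul {C : ℝ} (hC : 0 ≤ C) {f : G × G → ℝ}
    (hf : ∀ k l, |f (k, l)| ≤ C * (a (k - l) * x l * x k + a l * x (k - l) * x k)) :
    |∑' p, f p| ≤ 2 * C * (∑' k, a k) * M ^ 2 := by
  have hs := (summable_sub_mul_mul ha ha0 hx hx0 hx hx0).hasSum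
  have hs' := (Equiv.prodShear (Equiv.refl G) Equiv.subLeft).hasSum_iff.mpr hs
  refine (tsum_of_norm_bounded (f := f) ((hs.add hs').mul_left C) fun p => ?_).trans ?_
  · simpa using hf p.1 p.2
  · have := mul_le_mul_of_nonneg_left (tsum_sub_mul_mul_le ha ha0 hx hx0 hx hx0) hC
    linarith

end Trilinear

lemma innerH_zero_bilin {n : ℝ} (hn : (d : ℝ) / 2 + 1 < n) {v w : VField d} (hv : MemH n v)
    (hw : MemH n w) : innerH 0 (bilin v w) w = 0 := by
  have hn1 : 1 ≤ n := by have : (0 : ℝ) ≤ d := d.cast_nonneg; linarith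
  have hw1 := (hw.mono hn1).l2NormLE
  have hw0 := (hw.mono (zero_le_one.trans hn1)).l2NormLE
  simp only [Real.rpow_one] at hw1
  simp only [Real.rpow_zero, one_mul] at hw0
  have hs : Summable fun p : (Fin d → ℤ) × (Fin d → ℤ) => energyTerm v w p.1 p.2 :=
    Summable.of_norm_bounded (summable_sub_mul_mul (hv.summable_norm hn) (fun _ => norm_nonneg _)
      hw1 (fun k => mul_nonneg (kabs_nonneg k) (norm_nonneg _)) hw0 fun _ => norm_nonneg _)
      fun p => abs_energyTerm_le v w p.1 p.2
  simp only [innerH, mul_zero, Real.rpow_zero, one_mul,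
    re_inner_bilin (hv.summable_norm hn) (hw.summable_kabs_mul_norm hn) hw.div]
  rw [tsum_mul_left, ← hs.tsum_prod, tsum_antisymm_eq_zero fun a b => energyTerm_swap hv w a b,
    mul_zero]

/-- A weight for which the commutator estimate for `𝒫` holds. -/
structure IsEnergyWeight (C : ℝ) (φ : (Fin d → ℤ) → ℝ) : Prop where
  nonneg : ∀ k, 0 ≤ φ k
  sub_le : ∀ k l, |φ k - φ l| * kabs l ≤ C * (kabs (k - l) * φ l + kabs l * φ (k - l))

section Commutator

variable {n C : ℝ} {φ : (Fin d → ℤ) → ℝ} {u : VField d}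

lemma tsum_sq_mul_re_inner_bilin (hn : (d : ℝ) / 2 + 1 < n) (φ : (Fin d → ℤ) → ℝ)
    (hu : MemH n u) (hfin : (Function.support u).Finite) :
    ∑' k, φ k ^ 2 * (inner ℂ (bilin u u k) (u k)).re = fourierNormalization d *
      ∑' p : (Fin d → ℤ) × (Fin d → ℤ), φ p.1 * (φ p.1 - φ p.2) * energyTerm u u p.1 p.2 := by
  have hsum (g : (Fin d → ℤ) × (Fin d → ℤ) → ℝ) :
      Summable fun p : (Fin d → ℤ) × (Fin d → ℤ) => g p * energyTerm u u p.1 p.2 := by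
    refine summable_of_hasFiniteSupport ((hfin.prod hfin).subset fun p hp => ?_)
    constructor <;> intro h0 <;> apply hp <;> simp [energyTerm, advectTerm, h0]
  have hantisymm :
      ∑' p : (Fin d → ℤ) × (Fin d → ℤ), φ p.1 * φ p.2 * energyTerm u u p.1 p.2 = 0 :=
    tsum_antisymm_eq_zero fun a b => by
      simp only [energyTerm_swap hu u a b]; ring
  have hfactor (k : Fin d → ℤ) : φ k ^ 2 * (inner ℂ (bilin u u k) (u k)).re =
      fourierNormalization d * ∑' l, φ k ^ 2 * energyTerm u u k l := by
    rw [re_inner_bilin (hu.summable_norm hn) (hu.summable_kabs_mul_norm hn) hu.div, tsum_mul_left]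
    ring
  simp only [hfactor]
  rw [tsum_mul_left, ← (hsum fun p => φ p.1 ^ 2).tsum_prod,
    ← sub_zero (∑' p : (Fin d → ℤ) × (Fin d → ℤ), φ p.1 ^ 2 * energyTerm u u p.1 p.2),
    ← hantisymm, ← (hsum fun p => φ p.1 ^ 2).tsum_sub (hsum fun p => φ p.1 * φ p.2)]
  congr 1
  exact tsum_congr fun p => by ring

lemma IsEnergyWeight.abs_mul_energyTerm_le (hφ : IsEnergyWeight C φ) (u : VField d)
    (k l : Fin d → ℤ) :
    |φ k * (φ k - φ l) * energyTerm u u k l| ≤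
      C * (kabs (k - l) * ‖u (k - l)‖ * (φ l * ‖u l‖) * (φ k * ‖u k‖) +
        kabs l * ‖u l‖ * (φ (k - l) * ‖u (k - l)‖) * (φ k * ‖u k‖)) := by
  have hk := hφ.nonneg k
  rw [abs_mul, abs_mul, abs_of_nonneg hk]
  calc φ k * |φ k - φ l| * |energyTerm u u k l|
      ≤ φ k * |φ k - φ l| * (‖u (k - l)‖ * (kabs l * ‖u l‖) * ‖u k‖) := by
        gcongr; exact abs_energyTerm_le u u k l
    _ = |φ k - φ l| * kabs l * (φ k * (‖u (k - l)‖ * ‖u l‖ * ‖u k‖)) := by ring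
    _ ≤ C * (kabs (k - l) * φ l + kabs l * φ (k - l)) *
          (φ k * (‖u (k - l)‖ * ‖u l‖ * ‖u k‖)) := by
        exact mul_le_mul_of_nonneg_right (hφ.sub_le k l) (by positivity)
    _ = _ := by ring

lemma IsEnergyWeight.abs_tsum_inner_bilin_le (hn : (d : ℝ) / 2 + 1 < n) (hC : 0 ≤ C)
    (hφ : IsEnergyWeight C φ) (hu : MemH n u) (hfin : (Function.support u).Finite) :
    |∑' k, φ k ^ 2 * (inner ℂ (bilin u u k) (u k)).re| ≤
      2 * fourierNormalization d * C * wienerConst d n * normH n u * ‖toL2 φ u‖ ^ 2 := by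
  have hmem : MemL2 φ u := memL2_iff_summable.mpr (summable_of_hasFiniteSupport
    (hfin.subset fun k hk h0 => hk (by simp [h0])))
  have hφu := hmem.l2NormLE
  have hφu0 (k) : 0 ≤ φ k * ‖u k‖ := mul_nonneg (hφ.nonneg k) (norm_nonneg _)
  have hu0 (k) : 0 ≤ kabs k * ‖u k‖ := mul_nonneg (kabs_nonneg k) (norm_nonneg _)
  have hus := hu.summable_kabs_mul_norm hn
  have htotal := abs_tsum_le_of_abs_le_sub_mul_mul hus hu0 hφu hφu0 hC
    (f := fun p => φ p.1 * (φ p.1 - φ p.2) * energyTerm u u p.1 p.2)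
    fun k l => hφ.abs_mul_energyTerm_le u k l
  have hc := (fourierNormalization_pos d).le
  rw [tsum_sq_mul_re_inner_bilin hn φ hu hfin, abs_mul, abs_of_nonneg hc]
  calc fourierNormalization d * _
      ≤ fourierNormalization d * (2 * C * (∑' k, kabs k * ‖u k‖) * ‖toL2 φ u‖ ^ 2) := by gcongr
    _ ≤ fourierNormalization d * (2 * C * (wienerConst d n * normH n u) * ‖toL2 φ u‖ ^ 2) := by
        gcongr; exact hu.tsum_kabs_mul_norm_le hn
    _ = _ := by ring

end Commutator

section TailWeight

lemma rpow_sub_rpow_le {q r s : ℝ} (hq : 1 ≤ q) (hr : 0 ≤ r) (hrs : r ≤ s) :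
    s ^ q - r ^ q ≤ q * s ^ (q - 1) * (s - r) := by
  rcases hrs.eq_or_lt with rfl | hlt
  · simp
  have hslope := (convexOn_rpow hq).slope_le_of_hasDerivAt hr (hr.trans hrs) hlt
    (Real.hasDerivAt_rpow_const (Or.inr hq))
  rwa [slope_def_field, div_le_iff₀ (sub_pos.mpr hlt)] at hslope

lemma abs_rpow_sub_rpow_le {q r s : ℝ} (hq : 1 ≤ q) (hr : 0 ≤ r) (hs : 0 ≤ s) :
    |r ^ q - s ^ q| ≤ q * max r s ^ (q - 1) * |r - s| := by
  wlog hrs : r ≤ s generalizing r s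
  · simpa only [abs_sub_comm, max_comm] using this hs hr (le_of_not_ge hrs)
  rw [abs_sub_comm, abs_sub_comm r, max_eq_right hrs, abs_of_nonneg (sub_nonneg.mpr hrs),
    abs_of_nonneg (sub_nonneg.mpr (Real.rpow_le_rpow hr hrs (by linarith)))]
  exact rpow_sub_rpow_le hq hr hrs

/-- The radial profile `r^p min(r/K, 1)`. It vanishes pointwise as `K → ∞` and is comparable to
`r^p` for each `K`, so that it measures the tail of a field beyond the frequency `K`. -/
def tailProfile (p K r : ℝ) : ℝ := r ^ p * min (r / K) 1

variable {p K r s : ℝ}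

lemma min_div_one_nonneg (hK : 0 < K) (hr : 0 ≤ r) : 0 ≤ min (r / K) 1 :=
  le_min (div_nonneg hr hK.le) zero_le_one

lemma mul_min_div_one_le (hr : 0 ≤ r) (hrs : r ≤ s) : r * min (s / K) 1 ≤ s * min (r / K) 1 := by
  have hs := hr.trans hrs
  rw [mul_min_of_nonneg _ _ hr, mul_min_of_nonneg _ _ hs, mul_one, mul_one, mul_div_left_comm]
  exact min_le_min_left _ hrs

lemma tailProfile_nonneg (p : ℝ) (hK : 0 < K) (hr : 0 ≤ r) : 0 ≤ tailProfile p K r :=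
  mul_nonneg (Real.rpow_nonneg hr _) (min_div_one_nonneg hK hr)

lemma tailProfile_mono (hp : 0 ≤ p) (hK : 0 < K) (hr : 0 ≤ r) (hrs : r ≤ s) :
    tailProfile p K r ≤ tailProfile p K s := by
  have := min_div_one_nonneg hK hr
  have := Real.rpow_nonneg (hr.trans hrs) p
  unfold tailProfile
  gcongr

lemma tailProfile_two_mul_le (p K : ℝ) (hr : 0 ≤ r) :
    tailProfile p K (2 * r) ≤ 2 * 2 ^ p * tailProfile p K r := by
  rcases hr.eq_or_lt with rfl | hpos
  · simp [tailProfile]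
  have hmin : min (2 * r / K) 1 ≤ 2 * min (r / K) 1 := le_of_mul_le_mul_left
    ((mul_min_div_one_le hr (by linarith)).trans_eq (by ring)) hpos
  rw [tailProfile, tailProfile, Real.mul_rpow zero_le_two hr]
  calc _ ≤ 2 ^ p * r ^ p * (2 * min (r / K) 1) := by gcongr
    _ = _ := by ring

lemma mul_abs_tailProfile_sub_le (hp : 0 ≤ p) (hK : 0 < K) (hr : 0 ≤ r) (hs : 0 ≤ s) :
    s * |tailProfile p K r - tailProfile p K s| ≤
      |r ^ (p + 1) - s ^ (p + 1)| * min (s / K) 1 := by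
  have hrp := Real.rpow_nonneg hr p
  rw [Real.rpow_add_one' hr (by linarith), Real.rpow_add_one' hs (by linarith)]
  rcases le_total r s with hrs | hsr
  · have hmin := mul_le_mul_of_nonneg_left (mul_min_div_one_le (K := K) hr hrs) hrp
    have hmono := tailProfile_mono hp hK hr hrs
    rw [abs_sub_comm, abs_of_nonneg (sub_nonneg.mpr hmono)]
    refine le_trans ?_ (mul_le_mul_of_nonneg_right (neg_le_abs _) (min_div_one_nonneg hK hs))
    unfold tailProfile
    linarith
  · have hmin := mul_le_mul_of_nonneg_left (mul_min_div_one_le (K := K) hs hsr) hrp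
    have hmono := tailProfile_mono hp hK hs hsr
    rw [abs_of_nonneg (sub_nonneg.mpr hmono)]
    refine le_trans ?_ (mul_le_mul_of_nonneg_right (le_abs_self _) (min_div_one_nonneg hK hs))
    unfold tailProfile
    linarith

lemma abs_tailProfile_sub_mul_le (hp : 0 ≤ p) (hK : 0 < K) (hr : 0 ≤ r) (hs : 0 ≤ s)
    (hrs : r ≤ 2 * s) :
    |tailProfile p K r - tailProfile p K s| * s ≤
      (p + 1) * 2 ^ p * (|r - s| * tailProfile p K s) := by
  have hmax : max r s ^ p ≤ 2 ^ p * s ^ p := by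
    rw [← Real.mul_rpow zero_le_two hs]
    gcongr
    exact max_le hrs (by linarith)
  have hpow := abs_rpow_sub_rpow_le (q := p + 1) (by linarith) hr hs
  rw [add_sub_cancel_right] at hpow
  rw [mul_comm _ s]
  calc s * |tailProfile p K r - tailProfile p K s|
      ≤ |r ^ (p + 1) - s ^ (p + 1)| * min (s / K) 1 := mul_abs_tailProfile_sub_le hp hK hr hs
    _ ≤ (p + 1) * (2 ^ p * s ^ p) * |r - s| * min (s / K) 1 := by
        exact mul_le_mul_of_nonneg_right (hpow.trans (by gcongr)) (min_div_one_nonneg hK hs)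
    _ = _ := by rw [tailProfile]; ring

lemma abs_tailProfile_sub_le (hp : 0 ≤ p) (hK : 0 < K) {h : ℝ} (hr : 0 ≤ r) (hs : 0 ≤ s)
    (hsh : s ≤ h) (hrh : r ≤ 2 * h) :
    |tailProfile p K r - tailProfile p K s| ≤ 2 * 2 ^ p * tailProfile p K h := by
  have hh := hs.trans hsh
  refine abs_sub_le_of_nonneg_of_le (tailProfile_nonneg p hK hr) ?_ (tailProfile_nonneg p hK hs) ?_
  · exact (tailProfile_mono hp hK hr hrh).trans (tailProfile_two_mul_le p K hh)
  · exact (tailProfile_mono hp hK hs (by linarith)).trans (tailProfile_two_mul_le p K hh)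

/-- The weight `|k|^p min(|k|/K, 1)` on frequencies. -/
def tailWeight (p K : ℝ) (k : Fin d → ℤ) : ℝ := tailProfile p K (kabs k)

lemma tailWeight_nonneg (p : ℝ) (hK : 0 < K) (k : Fin d → ℤ) : 0 ≤ tailWeight p K k :=
  tailProfile_nonneg p hK (kabs_nonneg k)

lemma tailWeight_one (hp : p ≠ 0) (k : Fin d → ℤ) : tailWeight p 1 k = sobolevWeight p k := by
  rw [tailWeight, tailProfile, sobolevWeight]
  rcases eq_or_ne k 0 with rfl | hk
  · simp [Real.zero_rpow hp]
  · rw [div_one, min_eq_right (one_le_kabs hk), mul_one]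

/-- The constant in the commutator estimate for the weights `tailWeight p K`, independent of
`K`. -/
def weightConst (p : ℝ) : ℝ := (p + 2) * 2 ^ p

lemma weightConst_nonneg (hp : 0 ≤ p) : 0 ≤ weightConst p := by
  unfold weightConst
  positivity

lemma isEnergyWeight_tailWeight (hp : 0 ≤ p) (hK : 0 < K) :
    IsEnergyWeight (weightConst p) (tailWeight p K : (Fin d → ℤ) → ℝ) := by
  refine ⟨tailWeight_nonneg p hK, fun k l => ?_⟩
  have hC := weightConst_nonneg hp
  have hl := kabs_nonneg l
  have hkl := kabs_nonneg (k - l)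
  have hwl := tailWeight_nonneg p hK l
  have hwkl := tailWeight_nonneg p hK (k - l)
  have htriangle := kabs_le_sub_add k l
  rw [mul_add]
  rcases le_total (kabs l) (kabs (k - l)) with h | h
  · calc |tailWeight p K k - tailWeight p K l| * kabs l
        ≤ 2 * 2 ^ p * tailWeight p K (k - l) * kabs l := by
          gcongr
          exact abs_tailProfile_sub_le hp hK (kabs_nonneg k) hl h (by linarith)
      _ ≤ (p + 2) * 2 ^ p * tailWeight p K (k - l) * kabs l := by gcongr; linarith
      _ = weightConst p * (kabs l * tailWeight p K (k - l)) := by rw [weightConst]; ring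
      _ ≤ _ := le_add_of_nonneg_left (by positivity)
  · calc |tailWeight p K k - tailWeight p K l| * kabs l
        ≤ (p + 1) * 2 ^ p * (|kabs k - kabs l| * tailWeight p K l) :=
          abs_tailProfile_sub_mul_le hp hK (kabs_nonneg k) hl (by linarith)
      _ ≤ (p + 2) * 2 ^ p * (kabs (k - l) * tailWeight p K l) := by
          gcongr
          · linarith
          · exact abs_kabs_sub_le k l
      _ ≤ _ := le_add_of_nonneg_right (by positivity)

end TailWeight

/-! ### Differential inequalities and dissipative systems -/

lemma hasDerivWithinAt_Ici_of_Icc {F : Type*} [NormedAddCommGroup F] [NormedSpace ℝ F]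
    {f : ℝ → F} {f' : F} {a b t : ℝ} (h : HasDerivWithinAt f f' (Set.Icc a b) t)
    (ht : t ∈ Set.Ico a b) : HasDerivWithinAt f f' (Set.Ici t) t :=
  h.mono_of_mem_nhdsWithin (Icc_mem_nhdsGE_of_mem ht)

lemma le_add_mul_exp_of_deriv_le {f f' : ℝ → ℝ} {a b K ε : ℝ} (hK : 1 ≤ K) (hε : 0 ≤ ε)
    (hf : ∀ t ∈ Set.Icc a b, HasDerivWithinAt f (f' t) (Set.Icc a b) t)
    (hle : ∀ t ∈ Set.Icc a b, f' t ≤ K * f t + ε) {t : ℝ} (ht : t ∈ Set.Icc a b) :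
    f t ≤ (f a + ε) * Real.exp (K * (t - a)) := by
  have hgronwall : f t ≤ gronwallBound (f a) K ε (t - a) := by
    refine le_gronwallBound_of_liminf_deriv_right_le (f' := f') (b := b)
      (fun s hs => (hf s hs).continuousWithinAt) (fun s hs r hr => ?_) le_rfl
      (fun s hs => hle s (Set.Ico_subset_Icc_self hs)) t ht
    have hright := hasDerivWithinAt_Ici_of_Icc (hf s (Set.Ico_subset_Icc_self hs)) hs
    simpa [slope_def_field, div_eq_inv_mul] using hright.liminf_right_slope_le hr
  rw [gronwallBound_of_K_ne_0 (by linarith)] at hgronwall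
  refine hgronwall.trans ?_
  have hdiv : ε / K ≤ ε := div_le_self hε hK
  have hdiv0 : 0 ≤ ε / K := div_nonneg hε (by linarith)
  have hexp := Real.exp_pos (K * (t - a))
  nlinarith

section Dissipative

variable {F : Type*} [NormedAddCommGroup F] [InnerProductSpace ℝ F] {X : F → F} {τ : ℝ}

lemma exists_solution_of_hasCompactSupport [CompleteSpace F] (hX : ContDiff ℝ 1 X)
    (hc : HasCompactSupport X) (x₀ : F) (hτ : 0 ≤ τ) :
    ∃ α : ℝ → F, α 0 = x₀ ∧
      ∀ t ∈ Set.Icc 0 τ, HasDerivWithinAt α (X (α t)) (Set.Icc 0 τ) t := by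
  obtain ⟨K, hK⟩ := hX.lipschitzWith_of_hasCompactSupport hc one_ne_zero
  obtain ⟨L, hL⟩ := hc.exists_bound_of_continuous hX.continuous
  have hL0 : 0 ≤ L := (norm_nonneg _).trans (hL 0)
  have hpicard : IsPicardLindelof (fun _ => X) (tmin := 0) (tmax := τ) ⟨0, le_rfl, hτ⟩ x₀
      ⟨L * τ, by positivity⟩ 0 ⟨L, hL0⟩ K :=
    { lipschitzOnWith := fun _ _ => hK.lipschitzOnWith
      continuousOn := fun _ _ => continuousOn_const
      norm_le := fun _ _ x _ => hL x
      mul_max_le := by simp only [sub_zero, sub_self, max_eq_left hτ, NNReal.coe_zero]; rfl }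
  exact hpicard.exists_eq_forall_mem_Icc_hasDerivWithinAt₀

lemma norm_le_of_inner_nonpos (hX : ∀ x, inner ℝ x (X x) ≤ 0) {α : ℝ → F}
    (hα : ∀ t ∈ Set.Icc 0 τ, HasDerivWithinAt α (X (α t)) (Set.Icc 0 τ) t) {t : ℝ}
    (ht : t ∈ Set.Icc 0 τ) : ‖α t‖ ≤ ‖α 0‖ := by
  have hsq : ‖α t‖ ^ 2 ≤ ‖α 0‖ ^ 2 :=
    image_le_of_deriv_right_le_deriv_boundary (f := fun t => ‖α t‖ ^ 2)
      (B := fun _ => ‖α 0‖ ^ 2) (B' := fun _ => 0)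
      (fun s hs => (hα s hs).norm_sq.continuousWithinAt)
      (fun s hs => hasDerivWithinAt_Ici_of_Icc (hα s (Set.Ico_subset_Icc_self hs)).norm_sq hs)
      le_rfl continuousOn_const (fun _ _ => hasDerivWithinAt_const _ _ _)
      (fun s _ => by have := hX (α s); linarith) ht
  exact pow_le_pow_iff_left₀ (norm_nonneg _) (norm_nonneg _) two_ne_zero |>.mp hsq

/-- The vector field is cut off outside a large ball, which the solution never leaves. -/
lemma exists_solution_of_dissipative [FiniteDimensional ℝ F] (hX : ContDiff ℝ 1 X)
    (hdis : ∀ x, inner ℝ x (X x) ≤ 0) (x₀ : F) (hτ : 0 ≤ τ) :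
    ∃ α : ℝ → F, α 0 = x₀ ∧
      ∀ t ∈ Set.Icc 0 τ, HasDerivWithinAt α (X (α t)) (Set.Icc 0 τ) t := by
  let χ : ContDiffBump (0 : F) := ⟨‖x₀‖ + 1, ‖x₀‖ + 2, by positivity, by linarith⟩
  have hdis' : ∀ x, inner ℝ x (χ x • X x) ≤ 0 := fun x => by
    rw [real_inner_smul_right]
    exact mul_nonpos_of_nonneg_of_nonpos (χ.nonneg' x) (hdis x)
  obtain ⟨α, h0, hα⟩ := exists_solution_of_hasCompactSupport (χ.contDiff.smul hX)
    χ.hasCompactSupport.smul_right x₀ hτ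
  refine ⟨α, h0, fun t ht => ?_⟩
  have hnorm := norm_le_of_inner_nonpos hdis' hα ht
  have hone : χ (α t) = 1 := χ.one_of_mem_closedBall (mem_closedBall_zero_iff.mpr <| by
    change ‖α t‖ ≤ ‖x₀‖ + 1
    rw [h0] at hnorm; linarith)
  simpa only [Pi.smul_apply', hone, one_smul] using hα t ht

end Dissipative

/-! ### Galerkin approximations -/

lemma kabs_rpow_mul_norm_lap (n : ℝ) {v : VField d} (h0 : v 0 = 0) (k : Fin d → ℤ) :
    kabs k ^ n * ‖lap v k‖ = kabs k ^ (n + 2) * ‖v k‖ := by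
  rcases eq_or_ne k 0 with rfl | hk
  · simp [h0, lap]
  · rw [lap, norm_smul, norm_neg, Real.norm_of_nonneg (sq_nonneg _), ← mul_assoc,
      Real.rpow_add (kabs_pos hk), Real.rpow_two]

lemma MemH.l2NormLE_lap {n : ℝ} {v : VField d} (hv : MemH (n + 2) v) :
    L2NormLE (fun k => kabs k ^ n * ‖lap v k‖) (normH (n + 2) v) := by
  simpa only [kabs_rpow_mul_norm_lap n hv.mean] using hv.l2NormLE

lemma MemH.lap {n : ℝ} {v : VField d} (hv : MemH (n + 2) v) : MemH n (lap v) where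
  real k r := by simp [EulerNS.lap, hv.real]
  mean := by simp [EulerNS.lap, hv.mean]
  div k := by
    have h : ∀ s, (k s : ℂ) * EulerNS.lap v k s = -(kabs k ^ 2) * (k s * v k s) := fun s => by
      simp only [EulerNS.lap, PiLp.smul_apply, Complex.real_smul]; push_cast; ring
    simp only [h, ← Finset.mul_sum, hv.div, mul_zero]
  summable := summable_of_l2NormLE hv.l2NormLE_lap

lemma MemH.normH_lap_le {n : ℝ} {v : VField d} (hv : MemH (n + 2) v) :
    normH n (EulerNS.lap v) ≤ normH (n + 2) v :=
  normH_le_of_l2NormLE hv.l2NormLE_lap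

lemma lap_add (v w : VField d) : lap (v + w) = lap v + lap w := by
  funext k; simp [lap]

lemma lap_sub (v w : VField d) : lap (v - w) = lap v - lap w := by
  funext k; simp [lap, sub_eq_add_neg, add_comm]

lemma lap_smul (c : ℝ) (v : VField d) : lap (c • v) = c • lap v := by
  funext k; exact smul_comm (-(kabs k ^ 2)) c (v k)

lemma re_inner_lap (v : VField d) (k : Fin d → ℤ) :
    (inner ℂ (lap v k) (v k)).re = -(kabs k ^ 2 * ‖v k‖ ^ 2) := by
  rw [re_inner_eq_real_inner, lap, real_inner_smul_left, real_inner_self_eq_norm_sq, neg_mul]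

/-- The Fourier truncation to the frequencies `|k| ≤ N`. -/
def trunc (N : ℝ) (v : VField d) : VField d := fun k => if kabs k ≤ N then v k else 0

section Trunc

variable {n : ℝ} {v : VField d}

lemma trunc_of_le {N : ℝ} {k : Fin d → ℤ} (hk : kabs k ≤ N) : trunc N v k = v k := if_pos hk

lemma trunc_of_lt {N : ℝ} {k : Fin d → ℤ} (hk : N < kabs k) : trunc N v k = 0 :=
  if_neg hk.not_ge

lemma trunc_add (N : ℝ) (v w : VField d) : trunc N (v + w) = trunc N v + trunc N w := by
  funext k; by_cases h : kabs k ≤ N <;> simp [trunc, h]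

lemma trunc_smul (N c : ℝ) (v : VField d) : trunc N (c • v) = c • trunc N v := by
  funext k; by_cases h : kabs k ≤ N <;> simp [trunc, h]

lemma norm_smul_trunc_le (φ : (Fin d → ℤ) → ℝ) (N : ℝ) (v : VField d) (k : Fin d → ℤ) :
    ‖φ k • trunc N v k‖ ≤ ‖φ k • v k‖ := by
  unfold trunc; split_ifs <;> simp

lemma MemH.trunc (hv : MemH n v) (N : ℝ) : MemH n (trunc N v) where
  real k r := by by_cases h : kabs k ≤ N <;> simp [EulerNS.trunc, h, hv.real]
  mean := by simp [EulerNS.trunc, hv.mean]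
  div k := by by_cases h : kabs k ≤ N <;> simp [EulerNS.trunc, h, hv.div]
  summable := memL2_sobolevWeight_iff.mp (hv.memL2.mono (norm_smul_trunc_le _ N v))

lemma norm_toL2_trunc_le {φ : (Fin d → ℤ) → ℝ} (hv : MemL2 φ v) (N : ℝ) :
    ‖toL2 φ (trunc N v)‖ ≤ ‖toL2 φ v‖ :=
  norm_toL2_le hv (norm_smul_trunc_le φ N v)

lemma normH_trunc_le (hv : MemH n v) (N : ℝ) : normH n (trunc N v) ≤ normH n v := by
  simpa only [norm_toL2_sobolevWeight] using norm_toL2_trunc_le hv.memL2 N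

lemma normH_sub_trunc_le {N : ℝ} (hN : 0 < N) (hv : MemH (n + 1) v) :
    normH n (v - trunc N v) ≤ N⁻¹ * normH (n + 1) v := by
  refine normH_le_of_l2NormLE ((hv.l2NormLE.const_mul (inv_nonneg.mpr hN.le)).mono fun k => ?_)
  have hk0 := kabs_nonneg k
  refine abs_le_abs_of_nonneg (by positivity) ?_
  rcases le_or_gt (kabs k) N with hk | hk
  · rw [Pi.sub_apply, trunc_of_le hk, sub_self, norm_zero, mul_zero]
    positivity
  · have hpos := hN.trans hk
    have hone : 1 ≤ N⁻¹ * kabs k := by rw [inv_mul_eq_div]; exact (one_le_div hN).mpr hk.le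
    rw [Pi.sub_apply, trunc_of_lt hk, sub_zero, Real.rpow_add_one hpos.ne']
    calc _ ≤ N⁻¹ * kabs k * (kabs k ^ n * ‖v k‖) := le_mul_of_one_le_left (by positivity) hone
      _ = _ := by ring

end Trunc

/-- Real, zero mean, divergence free trigonometric polynomials with frequencies `|k| ≤ N`. -/
structure IsTrigPoly (N : ℝ) (v : VField d) : Prop where
  mem : MemH 0 v
  eq_zero : ∀ k, N < kabs k → v k = 0

namespace IsTrigPoly

variable {N : ℝ} {v w : VField d}

lemma finite_support (h : IsTrigPoly N v) : (Function.support v).Finite :=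
  (finite_setOf_kabs_le N).subset fun k hk => not_lt.mp fun hlt => hk (h.eq_zero k hlt)

lemma summable (h : IsTrigPoly N v) {f : (Fin d → ℤ) → ℝ} (hf : ∀ k, v k = 0 → f k = 0) :
    Summable f :=
  summable_of_hasFiniteSupport (h.finite_support.subset fun k hk h0 => hk (hf k h0))

lemma summable_norm (h : IsTrigPoly N v) : Summable fun k => ‖v k‖ :=
  h.summable fun k hk => by simp [hk]

lemma summable_kabs_mul_norm (h : IsTrigPoly N v) : Summable fun k => kabs k * ‖v k‖ :=
  h.summable fun k hk => by simp [hk]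

lemma memL2 (h : IsTrigPoly N v) (φ : (Fin d → ℤ) → ℝ) : MemL2 φ v :=
  memL2_iff_summable.mpr (h.summable fun k hk => by simp [hk])

lemma memℓp (h : IsTrigPoly N v) : Memℓp v 2 := by
  simpa [MemL2] using h.memL2 fun _ => 1

lemma memH (h : IsTrigPoly N v) (n : ℝ) : MemH n v :=
  ⟨h.mem.real, h.mem.mean, h.mem.div, memL2_sobolevWeight_iff.mp (h.memL2 _)⟩

lemma add (hv : IsTrigPoly N v) (hw : IsTrigPoly N w) : IsTrigPoly N (v + w) :=
  ⟨hv.mem.add hw.mem, fun k hk => by simp [hv.eq_zero k hk, hw.eq_zero k hk]⟩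

lemma smul (hv : IsTrigPoly N v) (c : ℝ) : IsTrigPoly N (c • v) :=
  ⟨hv.mem.smul c, fun k hk => by simp [hv.eq_zero k hk]⟩

lemma lap (h : IsTrigPoly N v) : IsTrigPoly N (lap v) :=
  ⟨(h.memH _).lap, fun k hk => by simp [EulerNS.lap, h.eq_zero k hk]⟩

end IsTrigPoly

lemma MemH.isTrigPoly_trunc {n : ℝ} {v : VField d} (hv : MemH n v) (N : ℝ) :
    IsTrigPoly N (EulerNS.trunc N v) := by
  have h := hv.trunc N
  refine ⟨⟨h.real, h.mean, h.div, ?_⟩, fun k => trunc_of_lt⟩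
  refine summable_of_hasFiniteSupport ((finite_setOf_kabs_le N).subset fun k hk => ?_)
  by_contra hlt
  exact hk (by simp [trunc_of_lt (not_le.mp hlt)])

lemma IsTrigPoly.trunc_bilin {N : ℝ} {v w : VField d} (hv : IsTrigPoly N v)
    (hw : IsTrigPoly N w) : IsTrigPoly N (trunc N (bilin v w)) :=
  (MemH.bilin (n := (d : ℝ) / 2 + 2) (by linarith) (hv.memH _) (hw.memH _)).isTrigPoly_trunc N

/-- The right-hand side of the Galerkin system. -/
def galerkinRHS (ν N : ℝ) (v : VField d) : VField d := ν • lap v + trunc N (bilin v v)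

section GalerkinRHS

variable {N : ℝ} {v : VField d}

lemma IsTrigPoly.galerkinRHS (hv : IsTrigPoly N v) (ν : ℝ) : IsTrigPoly N (galerkinRHS ν N v) :=
  (hv.lap.smul ν).add (hv.trunc_bilin hv)

lemma tsum_sq_mul_re_inner_galerkinRHS (hv : IsTrigPoly N v) (ν : ℝ) (φ : (Fin d → ℤ) → ℝ) :
    ∑' k, φ k ^ 2 * (inner ℂ (galerkinRHS ν N v k) (v k)).re =
      -(ν * ∑' k, φ k ^ 2 * (kabs k ^ 2 * ‖v k‖ ^ 2)) +
        ∑' k, φ k ^ 2 * (inner ℂ (bilin v v k) (v k)).re := by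
  rw [← tsum_mul_left, ← tsum_neg, ← Summable.tsum_add (hv.summable fun k h => by simp [h])
    (hv.summable fun k h => by simp [h])]
  refine tsum_congr fun k => ?_
  by_cases h0 : v k = 0
  · simp [h0]
  have hk : kabs k ≤ N := not_lt.mp fun h => h0 (hv.eq_zero k h)
  have hsplit : (inner ℂ (galerkinRHS ν N v k) (v k)).re =
      ν * (inner ℂ (lap v k) (v k)).re + (inner ℂ (bilin v v k) (v k)).re := by
    simp only [galerkinRHS, Pi.add_apply, Pi.smul_apply, trunc_of_le hk, re_inner_eq_real_inner]
    rw [inner_add_left, real_inner_smul_left]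
  rw [hsplit, re_inner_lap]
  ring

lemma two_mul_inner_galerkinRHS_le {n ν C : ℝ} (hn : (d : ℝ) / 2 + 1 < n) (hν : 0 ≤ ν)
    (hC : 0 ≤ C) {φ : (Fin d → ℤ) → ℝ} (hφ : IsEnergyWeight C φ) (hv : IsTrigPoly N v) :
    2 * inner ℝ (toL2 φ v) (toL2 φ (galerkinRHS ν N v)) ≤
      4 * fourierNormalization d * C * wienerConst d n * normH n v * ‖toL2 φ v‖ ^ 2 := by
  have hbilin := (abs_le.mp (hφ.abs_tsum_inner_bilin_le hn hC (hv.memH n) hv.finite_support)).2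
  have hviscous : 0 ≤ ν * ∑' k, φ k ^ 2 * (kabs k ^ 2 * ‖v k‖ ^ 2) :=
    mul_nonneg hν (tsum_nonneg fun k => by positivity)
  rw [real_inner_comm, inner_toL2 ((hv.galerkinRHS ν).memL2 φ) (hv.memL2 φ),
    tsum_sq_mul_re_inner_galerkinRHS hv]
  linarith

end GalerkinRHS

/-- The space of real, zero mean, divergence free trigonometric polynomials with frequencies
`|k| ≤ N`, as a subspace of `L²`. -/
def trigSpace (d : ℕ) (N : ℝ) : Submodule ℝ (L2 d) where
  carrier := {x | IsTrigPoly N (x : VField d)}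
  add_mem' hx hy := by
    rw [Set.mem_ofPred, lp.coeFn_add]; exact IsTrigPoly.add hx hy
  zero_mem' := by
    rw [Set.mem_ofPred, lp.coeFn_zero]; exact ⟨MemH.zero 0, fun _ _ => rfl⟩
  smul_mem' c x hx := by
    rw [Set.mem_ofPred, lp.coeFn_smul]; exact IsTrigPoly.smul hx c

section TrigSpace

variable {N : ℝ}

/-- The field underlying an element of `trigSpace`. -/
def trigField : trigSpace d N →ₗ[ℝ] VField d where
  toFun x := ((x : L2 d) : VField d)
  map_add' _ _ := lp.coeFn_add _ _
  map_smul' _ _ := lp.coeFn_smul _ _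

lemma trigField_injective : Function.Injective (trigField : trigSpace d N →ₗ[ℝ] VField d) :=
  fun _ _ h => Subtype.ext (Subtype.ext h)

lemma isTrigPoly_trigField (x : trigSpace d N) : IsTrigPoly N (trigField x) := x.2

/-- A trigonometric polynomial as an element of `trigSpace`. -/
def IsTrigPoly.toTrigSpace {v : VField d} (h : IsTrigPoly N v) : trigSpace d N :=
  ⟨⟨v, h.memℓp⟩, h⟩

@[simp] lemma trigField_toTrigSpace {v : VField d} (h : IsTrigPoly N v) :
    trigField h.toTrigSpace = v := rfl

instance : FiniteDimensional ℝ (trigSpace d N) := by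
  have : Finite {k : Fin d → ℤ | kabs k ≤ N} := finite_setOf_kabs_le N
  let restrict : VField d →ₗ[ℝ] ({k : Fin d → ℤ | kabs k ≤ N} → EuclideanSpace ℂ (Fin d)) :=
    LinearMap.funLeft ℝ _ Subtype.val
  refine FiniteDimensional.of_injective (restrict ∘ₗ trigField) fun x y hxy =>
    trigField_injective (funext fun k => ?_)
  rcases le_or_gt (kabs k) N with hk | hk
  · exact congrFun hxy ⟨k, hk⟩
  · rw [(isTrigPoly_trigField x).eq_zero k hk, (isTrigPoly_trigField y).eq_zero k hk]

lemma inner_trigSpace (x y : trigSpace d N) :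
    inner ℝ x y = ∑' k, (inner ℂ (trigField x k) (trigField y k)).re := by
  simp only [Submodule.coe_inner, lp.inner_eq_tsum, re_inner_eq_real_inner]
  rfl

/-- The Laplacian on `trigSpace`. -/
def trigLap (d : ℕ) (N : ℝ) : trigSpace d N →ₗ[ℝ] trigSpace d N where
  toFun x := (isTrigPoly_trigField x).lap.toTrigSpace
  map_add' x y := trigField_injective (by simp [lap_add])
  map_smul' c x := trigField_injective (by simp [lap_smul])

/-- The truncation of `𝒫` on `trigSpace`. -/
def trigBilin (d : ℕ) (N : ℝ) : trigSpace d N →ₗ[ℝ] trigSpace d N →ₗ[ℝ] trigSpace d N :=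
  have hv (x : trigSpace d N) := (isTrigPoly_trigField x).summable_norm
  have hw (x : trigSpace d N) := (isTrigPoly_trigField x).summable_kabs_mul_norm
  LinearMap.mk₂ ℝ
    (fun x y => ((isTrigPoly_trigField x).trunc_bilin (isTrigPoly_trigField y)).toTrigSpace)
    (fun x y z => trigField_injective (by
      simp [bilin_add_left (hv x) (hv y) (hw z), trunc_add]))
    (fun c x y => trigField_injective (by
      simp [bilin_smul_left c (hv x) (hw y), trunc_smul]))
    (fun x y z => trigField_injective (by
      simp [bilin_add_right (hv x) (hw y) (hw z), trunc_add]))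
    (fun c x y => trigField_injective (by
      simp [bilin_smul_right c (hv x) (hw y), trunc_smul]))

/-- The right-hand side of the Galerkin system, as a vector field on `trigSpace`. -/
def trigRHS (ν : ℝ) (x : trigSpace d N) : trigSpace d N := ν • trigLap d N x + trigBilin d N x x

lemma trigField_trigRHS (ν : ℝ) (x : trigSpace d N) :
    trigField (trigRHS ν x) = galerkinRHS ν N (trigField x) := by
  rw [trigRHS, map_add, map_smul]; rfl

lemma contDiff_trigRHS (ν : ℝ) : ContDiff ℝ 1 (trigRHS ν : trigSpace d N → trigSpace d N) := by
  let A : trigSpace d N →L[ℝ] trigSpace d N := (trigLap d N).toContinuousLinearMap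
  let B : trigSpace d N →L[ℝ] trigSpace d N →L[ℝ] trigSpace d N :=
    LinearMap.toContinuousLinearMap
      ((LinearMap.toContinuousLinearMap (𝕜 := ℝ) (E := trigSpace d N)
        (F' := trigSpace d N)).toLinearMap ∘ₗ trigBilin d N)
  have h : ContDiff ℝ 1 fun x => ν • A x + B x x := by fun_prop
  exact h

lemma inner_trigRHS_nonpos {ν : ℝ} (hν : 0 ≤ ν) (x : trigSpace d N) :
    inner ℝ x (trigRHS ν x) ≤ 0 := by
  have hx := isTrigPoly_trigField x
  have henergy := tsum_sq_mul_re_inner_galerkinRHS hx ν fun _ => 1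
  have hbilin : innerH 0 (bilin (trigField x) (trigField x)) (trigField x) = 0 :=
    innerH_zero_bilin (n := (d : ℝ) / 2 + 2) (by linarith) (hx.memH _) (hx.memH _)
  simp only [innerH, mul_zero, Real.rpow_zero, one_mul] at hbilin
  simp only [one_pow, one_mul, hbilin, add_zero] at henergy
  rw [real_inner_comm, inner_trigSpace, trigField_trigRHS, henergy]
  exact neg_nonpos.mpr (mul_nonneg hν (tsum_nonneg fun k => by positivity))

/-- `toL2 φ` on `trigSpace`, where it is linear. -/
def trigToL2 (N : ℝ) (φ : (Fin d → ℤ) → ℝ) : trigSpace d N →ₗ[ℝ] L2 d where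
  toFun x := toL2 φ (trigField x)
  map_add' x y := by
    rw [map_add, toL2_add ((isTrigPoly_trigField x).memL2 φ) ((isTrigPoly_trigField y).memL2 φ)]
  map_smul' c x := by
    rw [map_smul, toL2_smul ((isTrigPoly_trigField x).memL2 φ), RingHom.id_apply]

/-- A solution on `[0, τ]` of the Galerkin system with frequencies `|k| ≤ N`. The equation is
imposed in every weighted `ℓ²` norm; on trigonometric polynomials these are all equivalent. -/
structure IsGalerkin (ν N τ : ℝ) (u₀ : VField d) (u : ℝ → VField d) : Prop where
  init : u 0 = trunc N u₀
  isTrigPoly : ∀ t, IsTrigPoly N (u t)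
  deriv : ∀ φ : (Fin d → ℤ) → ℝ, ∀ t ∈ Set.Icc 0 τ, HasDerivWithinAt (fun t => toL2 φ (u t))
    (toL2 φ (galerkinRHS ν N (u t))) (Set.Icc 0 τ) t

lemma exists_galerkin {n ν τ : ℝ} (hν : 0 ≤ ν) (hτ : 0 ≤ τ) (N : ℝ) {u₀ : VField d}
    (hu₀ : MemH n u₀) : ∃ u : ℝ → VField d, IsGalerkin ν N τ u₀ u := by
  obtain ⟨α, h0, hα⟩ := exists_solution_of_dissipative (contDiff_trigRHS ν)
    (inner_trigRHS_nonpos hν) (hu₀.isTrigPoly_trunc N).toTrigSpace hτ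
  refine ⟨fun t => trigField (α t), by simp [h0], fun t => isTrigPoly_trigField _,
    fun φ t ht => ?_⟩
  rw [← trigField_trigRHS]
  exact (LinearMap.toContinuousLinearMap (trigToL2 N φ)).hasFDerivAt.comp_hasDerivWithinAt t
    (hα t ht)

end TrigSpace

/-! ### The right-hand side of the equation -/

/-- The right-hand side `ν Δv + 𝒫(v, v)` of the Euler/Navier-Stokes equations. -/
def rhs (ν : ℝ) (v : VField d) : VField d := ν • lap v + bilin v v

lemma MemH.norm_toL2_sub {n : ℝ} {v w : VField d} (hv : MemH n v) (hw : MemH n w) :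
    ‖toL2 (sobolevWeight n) v - toL2 (sobolevWeight n) w‖ = normH n (v - w) := by
  rw [← MemH.toL2_sub hv hw, norm_toL2_sobolevWeight]

section RHS

variable {n : ℝ} (hn : (d : ℝ) / 2 + 1 < n) {v w : VField d}

include hn

lemma bilin_sub_bilin_eq (hv : MemH n v) (hw : MemH n w) :
    bilin v v - bilin w w = bilin v (v - w) + bilin (v - w) w :=
  bilin_self_sub_bilin_self (hv.summable_norm hn) (hv.summable_kabs_mul_norm hn)
    (hw.summable_norm hn) (hw.summable_kabs_mul_norm hn)

lemma rhs_sub_rhs_eq (ν : ℝ) (hv : MemH n v) (hw : MemH n w) :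
    rhs ν v - rhs ν w = ν • lap (v - w) + bilin v (v - w) + bilin (v - w) w := by
  rw [add_assoc, ← bilin_sub_bilin_eq hn hv hw, lap_sub, smul_sub, rhs, rhs]
  abel

lemma MemH.bilin_self (hv : MemH (n + 1) v) : MemH n (EulerNS.bilin v v) :=
  .bilin hn (hv.mono (by linarith)) hv

lemma MemH.rhs (hv : MemH (n + 2) v) (ν : ℝ) : MemH n (EulerNS.rhs ν v) :=
  (hv.lap.smul ν).add (MemH.bilin_self hn (hv.mono (by linarith)))

lemma normH_bilin_sub_le {D : ℝ} (hv : MemH (n + 1) v) (hw : MemH (n + 1) w)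
    (hvD : normH (n + 1) v ≤ D) (hwD : normH (n + 1) w ≤ D) :
    normH n (bilin v v - bilin w w) ≤ 2 * bilinConst d n * D * normH (n + 1) (v - w) := by
  have hv0 : MemH n v := hv.mono (by linarith)
  have hw0 : MemH n w := hw.mono (by linarith)
  have hz := hv.sub hw
  have hz0 := hv0.sub hw0
  have hv0D : normH n v ≤ D := (hv.normH_mono (by linarith)).trans hvD
  have hz01 : normH n (v - w) ≤ normH (n + 1) (v - w) := hz.normH_mono (by linarith)
  have hc := bilinConst_nonneg d n
  have hzn := normH_nonneg (n + 1) (v - w)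
  have hwn := normH_nonneg (n + 1) w
  rw [bilin_sub_bilin_eq hn hv0 hw0]
  calc normH n (bilin v (v - w) + bilin (v - w) w)
      ≤ normH n (bilin v (v - w)) + normH n (bilin (v - w) w) :=
        (MemH.bilin hn hv0 hz).normH_add_le (MemH.bilin hn hz0 hw)
    _ ≤ bilinConst d n * normH n v * normH (n + 1) (v - w) +
          bilinConst d n * normH n (v - w) * normH (n + 1) w :=
        add_le_add (normH_bilin_le hn hv0 hz) (normH_bilin_le hn hz0 hw)
    _ ≤ bilinConst d n * D * normH (n + 1) (v - w) +
          bilinConst d n * normH (n + 1) (v - w) * D := by gcongr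
    _ = _ := by ring

lemma normH_rhs_sub_le {D ν : ℝ} (hν : 0 ≤ ν) (hv : MemH (n + 2) v) (hw : MemH (n + 2) w)
    (hvD : normH (n + 2) v ≤ D) (hwD : normH (n + 2) w ≤ D) :
    normH n (rhs ν v - rhs ν w) ≤ (ν + 2 * bilinConst d n * D) * normH (n + 2) (v - w) := by
  have hv1 : MemH (n + 1) v := hv.mono (by linarith)
  have hw1 : MemH (n + 1) w := hw.mono (by linarith)
  have hz := hv.sub hw
  have hz12 : normH (n + 1) (v - w) ≤ normH (n + 2) (v - w) := hz.normH_mono (by linarith)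
  have hD : 0 ≤ D := (normH_nonneg _ _).trans hvD
  have hc := bilinConst_nonneg d n
  have hsplit : rhs ν v - rhs ν w = ν • lap (v - w) + (bilin v v - bilin w w) := by
    rw [lap_sub, smul_sub, rhs, rhs]
    abel
  calc normH n (rhs ν v - rhs ν w)
      ≤ normH n (ν • lap (v - w)) + normH n (bilin v v - bilin w w) := by
        rw [hsplit]
        exact (hz.lap.smul ν).normH_add_le
          ((MemH.bilin_self hn hv1).sub (MemH.bilin_self hn hw1))
    _ ≤ ν * normH (n + 2) (v - w) + 2 * bilinConst d n * D * normH (n + 1) (v - w) := by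
        rw [hz.lap.normH_smul, abs_of_nonneg hν]
        refine add_le_add (mul_le_mul_of_nonneg_left hz.normH_lap_le hν) ?_
        exact normH_bilin_sub_le hn hv1 hw1 ((hv.normH_mono (by linarith)).trans hvD)
          ((hw.normH_mono (by linarith)).trans hwD)
    _ ≤ ν * normH (n + 2) (v - w) + 2 * bilinConst d n * D * normH (n + 2) (v - w) := by gcongr
    _ = _ := by ring

omit hn in
lemma innerH_lap (hv : MemH (n + 2) v) : innerH n (lap v) v = -normH (n + 1) v ^ 2 := by
  rw [innerH, normH_sq, ← tsum_neg]
  refine tsum_congr fun k => ?_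
  rw [re_inner_lap]
  rcases eq_or_ne k 0 with rfl | hk
  · simp [hv.mean]
  · rw [show 2 * (n + 1) = 2 * n + (2 : ℕ) by push_cast; ring,
      Real.rpow_add_natCast (kabs_pos hk).ne']
    ring

lemma innerH_rhs_sub_le {ν : ℝ} (hν : 0 ≤ ν) (hv : MemH (n + 2) v) (hw : MemH (n + 2) w) :
    innerH 0 (rhs ν v - rhs ν w) (v - w) ≤
      bilinConst d n * normH n w * normH 0 (v - w) ^ 2 := by
  have hn0 : 0 ≤ n := by have : (0 : ℝ) ≤ d := d.cast_nonneg; linarith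
  have hv0 : MemH n v := hv.mono (by linarith)
  have hw0 : MemH n w := hw.mono (by linarith)
  have hz := hv.sub hw
  have hzn := hv0.sub hw0
  have hz0 : MemH 0 (v - w) := hzn.mono hn0
  have hz2 : MemH (0 + 2) (v - w) := hz.mono (by linarith)
  have hvz : MemH 0 (bilin v (v - w)) := (MemH.bilin hn hv0 (hz.mono (by linarith))).mono hn0
  have hzw : MemH 0 (bilin (v - w) w) := (MemH.bilin hn hzn (hw.mono (by linarith))).mono hn0
  have hlap := hz2.lap.smul ν
  have hcross : innerH 0 (bilin (v - w) w) (v - w) ≤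
      bilinConst d n * normH n w * normH 0 (v - w) ^ 2 :=
    calc innerH 0 (bilin (v - w) w) (v - w)
        ≤ normH 0 (bilin (v - w) w) * normH 0 (v - w) := hzw.innerH_le hz0
      _ ≤ bilinConst d n * normH n w * normH 0 (v - w) * normH 0 (v - w) :=
          mul_le_mul_of_nonneg_right (normH_zero_bilin_le hn hzn hw0) (normH_nonneg 0 _)
      _ = _ := by ring
  rw [rhs_sub_rhs_eq hn ν hv0 hw0, MemH.innerH_add_left (hlap.add hvz) hzw hz0,
    MemH.innerH_add_left hlap hvz hz0, MemH.innerH_smul_left hz2.lap hz0,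
    innerH_zero_bilin hn hv0 hzn, innerH_lap hz2]
  have hdiss : 0 ≤ ν * normH (0 + 1) (v - w) ^ 2 := by positivity
  linarith

theorem normH_zero_sub_sq_le {ν a b R ε : ℝ} (hν : 0 ≤ ν) (hR : 0 ≤ R) {u v f g : ℝ → VField d}
    (hu : ∀ t ∈ Set.Icc a b, MemH (n + 2) (u t)) (hv : ∀ t ∈ Set.Icc a b, MemH (n + 2) (v t))
    (hf : ∀ t ∈ Set.Icc a b, MemH 0 (f t)) (hg : ∀ t ∈ Set.Icc a b, MemH 0 (g t))
    (hdu : ∀ t ∈ Set.Icc a b, HasDerivWithinAt (fun t => toL2 (sobolevWeight 0) (u t))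
      (toL2 (sobolevWeight 0) (rhs ν (u t) + f t)) (Set.Icc a b) t)
    (hdv : ∀ t ∈ Set.Icc a b, HasDerivWithinAt (fun t => toL2 (sobolevWeight 0) (v t))
      (toL2 (sobolevWeight 0) (rhs ν (v t) + g t)) (Set.Icc a b) t)
    (hvR : ∀ t ∈ Set.Icc a b, normH n (v t) ≤ R)
    (hε : ∀ t ∈ Set.Icc a b, normH 0 (f t - g t) ≤ ε) {t : ℝ} (ht : t ∈ Set.Icc a b) :
    normH 0 (u t - v t) ^ 2 ≤ (normH 0 (u a - v a) ^ 2 + ε ^ 2) *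
      Real.exp ((2 * bilinConst d n * R + 1) * (t - a)) := by
  have hn0 : 0 ≤ n := by have : (0 : ℝ) ≤ d := d.cast_nonneg; linarith
  have hc := bilinConst_nonneg d n
  have hsub (s) (hs : s ∈ Set.Icc a b) : toL2 (sobolevWeight 0) (u s - v s) =
      toL2 (sobolevWeight 0) (u s) - toL2 (sobolevWeight 0) (v s) :=
    MemH.toL2_sub ((hu s hs).mono (by linarith)) ((hv s hs).mono (by linarith))
  have hnorm (s) (hs : s ∈ Set.Icc a b) : normH 0 (u s - v s) ^ 2 =
      ‖toL2 (sobolevWeight 0) (u s) - toL2 (sobolevWeight 0) (v s)‖ ^ 2 := by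
    rw [← norm_toL2_sobolevWeight, hsub s hs]
  rw [hnorm t ht, hnorm a ⟨le_rfl, ht.1.trans ht.2⟩]
  refine le_add_mul_exp_of_deriv_le
    (f := fun t => ‖toL2 (sobolevWeight 0) (u t) - toL2 (sobolevWeight 0) (v t)‖ ^ 2)
    (by nlinarith [mul_nonneg hc hR]) (sq_nonneg _)
    (fun s hs => ((hdu s hs).sub (hdv s hs)).norm_sq) (fun s hs => ?_) ht
  have hz : MemH 0 (u s - v s) := ((hu s hs).sub (hv s hs)).mono (by linarith)
  have hru : MemH 0 (rhs ν (u s)) := (MemH.rhs hn (hu s hs) ν).mono hn0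
  have hrv : MemH 0 (rhs ν (v s)) := (MemH.rhs hn (hv s hs) ν).mono hn0
  have hfg := (hf s hs).sub (hg s hs)
  have hrhs : innerH 0 (rhs ν (u s) - rhs ν (v s)) (u s - v s) ≤
      bilinConst d n * R * normH 0 (u s - v s) ^ 2 :=
    (innerH_rhs_sub_le hn hν (hu s hs) (hv s hs)).trans (by gcongr; exact hvR s hs)
  have hresidual : innerH 0 (f s - g s) (u s - v s) ≤ ε * normH 0 (u s - v s) :=
    (hfg.innerH_le hz).trans (mul_le_mul_of_nonneg_right (hε s hs) (normH_nonneg 0 _))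
  simp only [Pi.sub_apply]
  rw [← hsub s hs, ← MemH.toL2_sub (hru.add (hf s hs)) (hrv.add (hg s hs)), real_inner_comm,
    add_sub_add_comm, MemH.inner_toL2_sobolevWeight ((hru.sub hrv).add hfg) hz,
    MemH.innerH_add_left (hru.sub hrv) hfg hz, norm_toL2_sobolevWeight]
  nlinarith [sq_nonneg (ε - normH 0 (u s - v s))]

end RHS

/-! ### Limits and tails -/

lemma MemH.of_tendsto {m : ℝ} {v : ℕ → VField d} {w : VField d} (hv : ∀ j, MemH m (v j))
    (hlim : ∀ k, Tendsto (fun j => v j k) atTop (𝓝 (w k))) (hw : MemL2 (sobolevWeight m) w) :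
    MemH m w := by
  have happ (k : Fin d → ℤ) (r : Fin d) : Tendsto (fun j => v j k r) atTop (𝓝 (w k r)) :=
    ((EuclideanSpace.proj r : EuclideanSpace ℂ (Fin d) →L[ℂ] ℂ).continuous.tendsto _).comp (hlim k)
  refine ⟨fun k r => ?_, ?_, fun k => ?_, memL2_sobolevWeight_iff.mp hw⟩
  · refine tendsto_nhds_unique (happ (-k) r) ?_
    simp only [(hv _).real]
    exact (Complex.continuous_conj.tendsto _).comp (happ k r)
  · refine tendsto_nhds_unique (hlim 0) ?_
    simp only [(hv _).mean, tendsto_const_nhds]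
  · have hdiv := tendsto_finsetSum (Finset.univ : Finset (Fin d))
      fun s _ => (happ k s).const_mul (k s : ℂ)
    simp only [(hv _).div] at hdiv
    exact tendsto_nhds_unique hdiv tendsto_const_nhds

lemma exists_memH_of_tendsto_toL2 {m : ℝ} {v : ℕ → VField d} (hv : ∀ j, MemH m (v j)) {U : L2 d}
    (hU : Tendsto (fun j => toL2 (sobolevWeight m) (v j)) atTop (𝓝 U)) :
    ∃ w : VField d, MemH m w ∧ toL2 (sobolevWeight m) w = U ∧
      ∀ k, Tendsto (fun j => v j k) atTop (𝓝 (w k)) := by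
  have hcoef (k : Fin d → ℤ) :
      Tendsto (fun j => sobolevWeight m k • v j k) atTop (𝓝 (U k)) := by
    simp only [← toL2_apply (hv _).memL2]
    rw [tendsto_iff_norm_sub_tendsto_zero] at hU ⊢
    exact squeeze_zero (fun _ => norm_nonneg _)
      (fun j => lp.norm_apply_le_norm two_ne_zero (toL2 (sobolevWeight m) (v j) - U) k) hU
  have hlim (k : Fin d → ℤ) : ∃ x, Tendsto (fun j => v j k) atTop (𝓝 x) := by
    rcases eq_or_ne k 0 with rfl | hk
    · exact ⟨0, by simp only [(hv _).mean, tendsto_const_nhds]⟩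
    · have hpos : sobolevWeight m k ≠ 0 := (Real.rpow_pos_of_pos (kabs_pos hk) m).ne'
      exact ⟨_, by simpa only [inv_smul_smul₀ hpos]
        using (hcoef k).const_smul (sobolevWeight m k)⁻¹⟩
  choose w hw using hlim
  have hUw (k : Fin d → ℤ) : sobolevWeight m k • w k = U k :=
    tendsto_nhds_unique ((hw k).const_smul _) (hcoef k)
  have hmem : MemL2 (sobolevWeight m) w := by
    simp only [MemL2, hUw]
    exact lp.memℓp U
  refine ⟨w, .of_tendsto hv hw hmem, ?_, hw⟩
  ext1
  funext k
  rw [toL2_apply hmem, hUw]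

lemma toL2_tailWeight_one {p : ℝ} (hp : p ≠ 0) (v : VField d) :
    toL2 (tailWeight p 1) v = toL2 (sobolevWeight p) v := by
  rw [funext (tailWeight_one hp)]

lemma tailWeight_le_sobolevWeight (p K : ℝ) (k : Fin d → ℤ) :
    tailWeight p K k ≤ sobolevWeight p k :=
  mul_le_of_le_one_right (Real.rpow_nonneg (kabs_nonneg k) p) (min_le_right _ _)

lemma MemH.memL2_tailWeight {p K : ℝ} (hK : 0 < K) {v : VField d} (hv : MemH p v) :
    MemL2 (tailWeight p K) v := by
  refine hv.memL2.mono fun k => ?_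
  rw [norm_smul, norm_smul, Real.norm_of_nonneg (tailWeight_nonneg p hK k),
    Real.norm_of_nonneg (sobolevWeight_nonneg p k)]
  gcongr
  exact tailWeight_le_sobolevWeight p K k

lemma tendsto_tailWeight (p : ℝ) (k : Fin d → ℤ) :
    Tendsto (fun K => tailWeight p K k) atTop (𝓝 0) := by
  have hmin : Tendsto (fun K : ℝ => min (kabs k / K) 1) atTop (𝓝 (min 0 1)) :=
    (tendsto_id.const_div_atTop (kabs k)).min tendsto_const_nhds
  rw [min_eq_left zero_le_one] at hmin
  simpa only [tailWeight, tailProfile, mul_zero] using hmin.const_mul (kabs k ^ p)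

lemma MemH.tendsto_norm_toL2_tailWeight {p : ℝ} {v : VField d} (hv : MemH p v) :
    Tendsto (fun K => ‖toL2 (tailWeight p K) v‖ ^ 2) atTop (𝓝 0) := by
  simp only [norm_toL2_sq]
  rw [← tsum_zero (β := Fin d → ℤ)]
  refine tendsto_tsum_of_dominated_convergence hv.summable (fun k => ?_) ?_
  · simpa using ((tendsto_tailWeight p k).pow 2).mul_const (‖v k‖ ^ 2)
  · filter_upwards [eventually_gt_atTop 0] with K hK k
    have htail := tailWeight_nonneg p hK k
    rw [Real.norm_of_nonneg (by positivity), ← sobolevWeight_sq]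
    gcongr
    exact tailWeight_le_sobolevWeight p K k

lemma MemH.normH_trunc_le_rpow_mul {p K : ℝ} (hp : 0 ≤ p) (hK : 0 < K) {v : VField d}
    (hv : MemH 0 v) : normH p (EulerNS.trunc K v) ≤ K ^ p * normH 0 v := by
  refine normH_le_of_l2NormLE
    ((hv.l2NormLE.const_mul (Real.rpow_nonneg hK.le p)).mono fun k => ?_)
  have hk0 := kabs_nonneg k
  refine abs_le_abs_of_nonneg (by positivity) ?_
  rw [Real.rpow_zero, one_mul]
  rcases le_or_gt (kabs k) K with hk | hk
  · rw [trunc_of_le hk]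
    gcongr
  · rw [trunc_of_lt hk, norm_zero, mul_zero]
    positivity

lemma MemH.normH_sub_trunc_le_norm_tailWeight {p K : ℝ} (hK : 0 < K) {v : VField d}
    (hv : MemH p v) : normH p (v - EulerNS.trunc K v) ≤ ‖toL2 (tailWeight p K) v‖ := by
  refine normH_le_of_l2NormLE ((hv.memL2_tailWeight hK).l2NormLE.mono fun k => ?_)
  have hk0 := kabs_nonneg k
  have htail := tailWeight_nonneg p hK k
  refine abs_le_abs_of_nonneg (by positivity) ?_
  rcases le_or_gt (kabs k) K with hk | hk
  · rw [Pi.sub_apply, trunc_of_le hk, sub_self, norm_zero, mul_zero]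
    positivity
  · rw [Pi.sub_apply, trunc_of_lt hk, sub_zero, tailWeight, tailProfile,
      min_eq_right ((one_le_div hK).mpr hk.le), mul_one]

lemma MemH.normH_le_add_norm_tailWeight {p K : ℝ} (hp : 0 ≤ p) (hK : 0 < K) {v : VField d}
    (hv : MemH p v) : normH p v ≤ K ^ p * normH 0 v + ‖toL2 (tailWeight p K) v‖ :=
  calc normH p v = normH p (EulerNS.trunc K v + (v - EulerNS.trunc K v)) := by
        rw [add_sub_cancel]
    _ ≤ normH p (EulerNS.trunc K v) + normH p (v - EulerNS.trunc K v) :=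
        (hv.trunc K).normH_add_le (hv.sub (hv.trunc K))
    _ ≤ _ := add_le_add (normH_trunc_le_rpow_mul hp hK (hv.mono hp))
        (hv.normH_sub_trunc_le_norm_tailWeight hK)

section UniformLimits

variable {m p : ℝ} {s : Set ℝ} {v : ℕ → ℝ → VField d}

lemma uniformCauchySeqOn_toL2_sobolevWeight (hp : 0 ≤ p)
    (hv : ∀ j, ∀ t ∈ s, MemH p (v j t))
    (htail : ∀ ε > 0, ∃ K > 0, ∀ j, ∀ t ∈ s, ‖toL2 (tailWeight p K) (v j t)‖ ≤ ε)
    (hlow : UniformCauchySeqOn (fun j t => toL2 (sobolevWeight 0) (v j t)) atTop s) :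
    UniformCauchySeqOn (fun j t => toL2 (sobolevWeight p) (v j t)) atTop s := by
  rw [Metric.uniformCauchySeqOn_iff] at hlow ⊢
  intro ε hε
  obtain ⟨K, hK, hKtail⟩ := htail (ε / 4) (by positivity)
  obtain ⟨J, hJ⟩ := hlow (ε / (2 * K ^ p)) (by positivity)
  refine ⟨J, fun i hi j hj t ht => ?_⟩
  have hi0 := hv i t ht
  have hj0 := hv j t ht
  have hlow_ij := hJ i hi j hj t ht
  rw [dist_eq_norm, MemH.norm_toL2_sub (hi0.mono hp) (hj0.mono hp),
    lt_div_iff₀ (by positivity)] at hlow_ij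
  have htail_ij : ‖toL2 (tailWeight p K) (v i t - v j t)‖ ≤ ε / 4 + ε / 4 := by
    rw [toL2_sub (hi0.memL2_tailWeight hK) (hj0.memL2_tailWeight hK)]
    exact (norm_sub_le _ _).trans (add_le_add (hKtail i t ht) (hKtail j t ht))
  have hsplit := (hi0.sub hj0).normH_le_add_norm_tailWeight hp hK
  rw [dist_eq_norm, MemH.norm_toL2_sub hi0 hj0]
  linarith

lemma exists_tendstoUniformlyOn_toL2 (hv : ∀ j, ∀ t ∈ s, MemH m (v j t))
    (hcauchy : UniformCauchySeqOn (fun j t => toL2 (sobolevWeight m) (v j t)) atTop s) :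
    ∃ u : ℝ → VField d, (∀ t ∈ s, MemH m (u t)) ∧
      TendstoUniformlyOn (fun j t => toL2 (sobolevWeight m) (v j t))
        (fun t => toL2 (sobolevWeight m) (u t)) atTop s ∧
      ∀ t ∈ s, ∀ k, Tendsto (fun j => v j t k) atTop (𝓝 (u t k)) := by
  have hlim (t : ℝ) : ∃ w : VField d, t ∈ s → MemH m w ∧
      Tendsto (fun j => toL2 (sobolevWeight m) (v j t)) atTop (𝓝 (toL2 (sobolevWeight m) w)) ∧
      ∀ k, Tendsto (fun j => v j t k) atTop (𝓝 (w k)) := by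
    by_cases ht : t ∈ s
    · obtain ⟨U, hU⟩ := cauchySeq_tendsto_of_complete (hcauchy.cauchySeq ht)
      obtain ⟨w, hw, rfl, hcoef⟩ := exists_memH_of_tendsto_toL2 (fun j => hv j t ht) hU
      exact ⟨w, fun _ => ⟨hw, hU, hcoef⟩⟩
    · exact ⟨0, fun h => absurd h ht⟩
  choose u hu using hlim
  exact ⟨u, fun t ht => (hu t ht).1,
    hcauchy.tendstoUniformlyOn_of_tendsto fun t ht => (hu t ht).2.1, fun t ht => (hu t ht).2.2⟩

end UniformLimits

lemma tendstoUniformlyOn_of_dist_le_mul_add {ι α E F : Type*} [PseudoMetricSpace E]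
    [PseudoMetricSpace F] {l : Filter ι} {s : Set α} {U : ι → α → E} {u : α → E} {V : ι → α → F}
    {v : α → F} {C : ℝ} {c : ι → ℝ} (hU : TendstoUniformlyOn U u l s) (hc : Tendsto c l (𝓝 0))
    (h : ∀ i, ∀ x ∈ s, dist (v x) (V i x) ≤ C * dist (u x) (U i x) + c i) :
    TendstoUniformlyOn V v l s := by
  rw [Metric.tendstoUniformlyOn_iff] at hU ⊢
  intro ε hε
  have hC : 0 < |C| + 1 := by positivity
  filter_upwards [hU (ε / 2 / (|C| + 1)) (by positivity), hc.eventually_lt_const (half_pos hε)]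
    with i hi hci x hx
  have hdist := hi x hx
  rw [lt_div_iff₀ hC] at hdist
  have hdist0 := dist_nonneg (x := u x) (y := U i x)
  nlinarith [h i x hx, le_abs_self C]

lemma hasDerivWithinAt_of_tendstoUniformlyOn {F : Type*} [NormedAddCommGroup F] [NormedSpace ℝ F]
    {s : Set ℝ} (hs : Convex ℝ s) {U U' : ℕ → ℝ → F} {V V' : ℝ → F}
    (hd : ∀ j, ∀ t ∈ s, HasDerivWithinAt (U j) (U' j t) s t)
    (hU : ∀ t ∈ s, Tendsto (fun j => U j t) atTop (𝓝 (V t)))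
    (hU' : TendstoUniformlyOn U' V' atTop s) (hV' : ContinuousOn V' s) {t : ℝ} (ht : t ∈ s) :
    HasDerivWithinAt V (V' t) s t := by
  rw [hasDerivWithinAt_iff_isLittleO, Asymptotics.isLittleO_iff]
  intro ε hε
  obtain ⟨δ, hδ, hV'δ⟩ := Metric.continuousWithinAt_iff.mp (hV' t ht) (ε / 2) (half_pos hε)
  filter_upwards [inter_mem_nhdsWithin s (Metric.ball_mem_nhds t hδ)] with x hx
  have hconv : Convex ℝ (s ∩ Metric.ball t δ) := hs.inter (convex_ball t δ)
  refine le_of_tendsto (((hU x hx.1).sub (hU t ht)).sub tendsto_const_nhds).norm ?_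
  filter_upwards [Metric.tendstoUniformlyOn_iff.mp hU' (ε / 2) (half_pos hε)] with j hj
  have hderiv : ∀ r ∈ s ∩ Metric.ball t δ, ‖U' j r - (1 : ℝ) • V' t‖ ≤ ε := fun r hr =>
    calc ‖U' j r - (1 : ℝ) • V' t‖ ≤ ‖U' j r - V' r‖ + ‖V' r - V' t‖ := by
          rw [one_smul]; exact norm_sub_le_norm_sub_add_norm_sub _ _ _
      _ ≤ ε / 2 + ε / 2 := by
          rw [← dist_eq_norm, ← dist_eq_norm, dist_comm]
          exact add_le_add (hj r hr.1).le (hV'δ hr.1 hr.2).le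
      _ = ε := add_halves ε
  have hmvt := hconv.norm_image_sub_le_of_norm_hasDerivWithin_le
    (f := fun r => U j r - r • V' t)
    (fun r hr => ((hd j r hr.1).mono Set.inter_subset_left).sub
      ((hasDerivWithinAt_id r _).smul_const (V' t)))
    hderiv ⟨ht, Metric.mem_ball_self hδ⟩ hx
  rwa [sub_sub_sub_comm, ← sub_smul] at hmvt

/-! ### Local existence -/

/-- A solution of the unforced equations on the set of times `I`, in the class
`C(I, H^{n+2}) ∩ C¹(I, H^n)`. At the times in `I` the derivative is taken within `I`; it is
automatically continuous, see `SolvesOn.continuousOn_toL2_rhs`. -/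
structure SolvesOn (n ν : ℝ) (I : Set ℝ) (u : ℝ → VField d) : Prop where
  mem : ∀ t ∈ I, MemH (n + 2) (u t)
  cont : ContinuousOn (fun t => toL2 (sobolevWeight (n + 2)) (u t)) I
  deriv : ∀ t ∈ I, HasDerivWithinAt (fun t => toL2 (sobolevWeight n) (u t))
    (toL2 (sobolevWeight n) (rhs ν (u t))) I t

lemma norm_toL2_rhs_sub_le {n ν D : ℝ} (hn : (d : ℝ) / 2 + 1 < n) (hν : 0 ≤ ν) {v w : VField d}
    (hv : MemH (n + 2) v) (hw : MemH (n + 2) w) (hvD : normH (n + 2) v ≤ D)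
    (hwD : normH (n + 2) w ≤ D) :
    ‖toL2 (sobolevWeight n) (rhs ν v) - toL2 (sobolevWeight n) (rhs ν w)‖ ≤
      (ν + 2 * bilinConst d n * D) *
        ‖toL2 (sobolevWeight (n + 2)) v - toL2 (sobolevWeight (n + 2)) w‖ := by
  rw [MemH.norm_toL2_sub (MemH.rhs hn hv ν) (MemH.rhs hn hw ν), MemH.norm_toL2_sub hv hw]
  exact normH_rhs_sub_le hn hν hv hw hvD hwD

lemma continuousOn_toL2_rhs {n ν : ℝ} (hn : (d : ℝ) / 2 + 1 < n) (hν : 0 ≤ ν) {I : Set ℝ}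
    {u : ℝ → VField d} (hu : ∀ t ∈ I, MemH (n + 2) (u t))
    (hcont : ContinuousOn (fun t => toL2 (sobolevWeight (n + 2)) (u t)) I) :
    ContinuousOn (fun t => toL2 (sobolevWeight n) (rhs ν (u t))) I := by
  intro t ht
  set D := normH (n + 2) (u t) + 1
  have hlim := (tendsto_iff_norm_sub_tendsto_zero.mp (hcont t ht)).const_mul
    (ν + 2 * bilinConst d n * D)
  rw [mul_zero] at hlim
  have hbound : ∀ᶠ s in 𝓝[I] t, ‖toL2 (sobolevWeight (n + 2)) (u s)‖ < D :=
    (hcont t ht).norm.eventually (gt_mem_nhds (by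
      simp only [norm_toL2_sobolevWeight]
      exact lt_add_one _))
  rw [ContinuousWithinAt, tendsto_iff_norm_sub_tendsto_zero]
  refine squeeze_zero' (Eventually.of_forall fun _ => norm_nonneg _) ?_ hlim
  filter_upwards [self_mem_nhdsWithin, hbound] with s hs hsD
  rw [norm_toL2_sobolevWeight] at hsD
  exact norm_toL2_rhs_sub_le hn hν (hu s hs) (hu t ht) hsD.le (lt_add_one _).le

/-- The constant in the energy estimate for the Galerkin system with the weights
`tailWeight p K`; it does not depend on `K`. -/
def energyConst (d : ℕ) (n p : ℝ) : ℝ :=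
  4 * fourierNormalization d * weightConst p * wienerConst d n

lemma energyConst_nonneg (d : ℕ) (n : ℝ) {p : ℝ} (hp : 0 ≤ p) : 0 ≤ energyConst d n p :=
  mul_nonneg (mul_nonneg (mul_nonneg zero_le_four (fourierNormalization_pos d).le)
    (weightConst_nonneg hp)) (wienerConst_nonneg d n)

lemma two_mul_inner_galerkinRHS_tailWeight_le {n p K ν N : ℝ} (hn : (d : ℝ) / 2 + 1 < n)
    (hp : 0 ≤ p) (hK : 0 < K) (hν : 0 ≤ ν) {v : VField d} (hv : IsTrigPoly N v) :
    2 * inner ℝ (toL2 (tailWeight p K) v) (toL2 (tailWeight p K) (galerkinRHS ν N v)) ≤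
      energyConst d n p * normH n v * ‖toL2 (tailWeight p K) v‖ ^ 2 :=
  two_mul_inner_galerkinRHS_le hn hν (weightConst_nonneg hp) (isEnergyWeight_tailWeight hp hK) hv

lemma two_mul_inner_galerkinRHS_sobolevWeight_le {n ν N : ℝ} (hn : (d : ℝ) / 2 + 1 < n)
    (hν : 0 ≤ ν) {v : VField d} (hv : IsTrigPoly N v) :
    2 * inner ℝ (toL2 (sobolevWeight n) v) (toL2 (sobolevWeight n) (galerkinRHS ν N v)) ≤
      energyConst d n n * normH n v * normH n v ^ 2 := by
  have hn_pos : 0 < n := by linarith [(Nat.cast_nonneg d : (0 : ℝ) ≤ d)]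
  have henergy := two_mul_inner_galerkinRHS_tailWeight_le hn hn_pos.le one_pos hν hv
  rwa [toL2_tailWeight_one hn_pos.ne', toL2_tailWeight_one hn_pos.ne',
    norm_toL2_sobolevWeight] at henergy

lemma two_mul_inner_galerkinRHS_sobolevWeight_lt {n ν N R : ℝ} (hn : (d : ℝ) / 2 + 1 < n)
    (hν : 0 ≤ ν) {v : VField d} (hv : IsTrigPoly N v) (hvR : normH n v ≤ 2 * R) :
    2 * inner ℝ (toL2 (sobolevWeight n) v) (toL2 (sobolevWeight n) (galerkinRHS ν N v)) <
      8 * energyConst d n n * R ^ 3 + 1 := by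
  have hE := energyConst_nonneg d n (p := n) (by linarith [(Nat.cast_nonneg d : (0 : ℝ) ≤ d)])
  have hv_nonneg := normH_nonneg n v
  calc _ ≤ energyConst d n n * normH n v * normH n v ^ 2 :=
        two_mul_inner_galerkinRHS_sobolevWeight_le hn hν hv
    _ ≤ energyConst d n n * (2 * R) * (2 * R) ^ 2 := by
        have := mul_nonneg hE (hv_nonneg.trans hvR)
        gcongr
    _ < 8 * energyConst d n n * R ^ 3 + 1 := by linarith

/-- A time for which the solutions of the Galerkin system whose datum has `H^n` norm at most `R`
have `H^n` norm at most `2 * R`: see `add_mul_le_sq_of_le_lifespan` for the choice of the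
formula. -/
def lifespan (d : ℕ) (n R : ℝ) : ℝ := 3 * R ^ 2 / (8 * energyConst d n n * R ^ 3 + 1)

lemma lifespan_pos {n R : ℝ} (hn : 0 ≤ n) (hR : 0 < R) : 0 < lifespan d n R := by
  have := energyConst_nonneg d n hn
  unfold lifespan
  positivity

lemma add_mul_le_sq_of_le_lifespan {n R t : ℝ} (hn : 0 ≤ n) (hR : 0 < R)
    (ht : t ≤ lifespan d n R) :
    R ^ 2 + (8 * energyConst d n n * R ^ 3 + 1) * t ≤ (2 * R) ^ 2 := by
  have := energyConst_nonneg d n hn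
  rw [lifespan, le_div_iff₀ (by positivity)] at ht
  linarith

namespace IsGalerkin

variable {n ν N τ : ℝ} {u₀ : VField d} {u : ℝ → VField d}

lemma hasDerivWithinAt_normH_sq (hu : IsGalerkin ν N τ u₀ u) {t : ℝ} (ht : t ∈ Set.Icc 0 τ) :
    HasDerivWithinAt (fun t => normH n (u t) ^ 2)
      (2 * inner ℝ (toL2 (sobolevWeight n) (u t))
        (toL2 (sobolevWeight n) (galerkinRHS ν N (u t)))) (Set.Icc 0 τ) t := by
  simpa only [norm_toL2_sobolevWeight] using (hu.deriv (sobolevWeight n) t ht).norm_sq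

lemma normH_le {R : ℝ} (hn : (d : ℝ) / 2 + 1 < n) (hν : 0 ≤ ν) (hR : 0 < R)
    (hu₀ : MemH n u₀) (hR₀ : normH n u₀ ≤ R) (hu : IsGalerkin ν N (lifespan d n R) u₀ u) {t : ℝ}
    (ht : t ∈ Set.Icc 0 (lifespan d n R)) : normH n (u t) ≤ 2 * R := by
  have hn_nonneg : 0 ≤ n := by linarith [(Nat.cast_nonneg d : (0 : ℝ) ≤ d)]
  set E := energyConst d n n
  set B : ℝ → ℝ := fun s => R ^ 2 + (8 * E * R ^ 3 + 1) * s
  have hB : ∀ s ∈ Set.Icc 0 (lifespan d n R), B s ≤ (2 * R) ^ 2 := fun s hs =>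
    add_mul_le_sq_of_le_lifespan hn_nonneg hR hs.2
  have hinit : normH n (u 0) ^ 2 ≤ B 0 := by
    have htrunc : normH n (trunc N u₀) ≤ R := (normH_trunc_le hu₀ N).trans hR₀
    simp only [B, hu.init, mul_zero, add_zero]
    exact pow_le_pow_left₀ (normH_nonneg _ _) htrunc 2
  have hle := image_le_of_deriv_right_lt_deriv_boundary' (B' := fun _ => 8 * E * R ^ 3 + 1)
    (fun s hs => (hu.hasDerivWithinAt_normH_sq hs).continuousWithinAt)
    (fun s hs => hasDerivWithinAt_Ici_of_Icc
      (hu.hasDerivWithinAt_normH_sq (Set.Ico_subset_Icc_self hs)) hs)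
    hinit (by fun_prop) (fun s _ => by
      simpa [B] using (((hasDerivAt_id s).const_mul (8 * E * R ^ 3 + 1)).const_add
        (R ^ 2)).hasDerivWithinAt)
    (fun s hs heq => two_mul_inner_galerkinRHS_sobolevWeight_lt hn hν (hu.isTrigPoly s) <|
      le_of_pow_le_pow_left₀ two_ne_zero (by positivity)
        (heq.trans_le (hB s (Set.Ico_subset_Icc_self hs)))) ht
  exact le_of_pow_le_pow_left₀ two_ne_zero (by positivity) (hle.trans (hB t ht))

lemma norm_toL2_tailWeight_sq_le {p K M : ℝ} (hn : (d : ℝ) / 2 + 1 < n) (hp : 0 ≤ p)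
    (hK : 0 < K) (hν : 0 ≤ ν) (hM : 0 ≤ M) (hu₀ : MemH p u₀) (hu : IsGalerkin ν N τ u₀ u)
    (huM : ∀ t ∈ Set.Icc 0 τ, normH n (u t) ≤ M) {t : ℝ} (ht : t ∈ Set.Icc 0 τ) :
    ‖toL2 (tailWeight p K) (u t)‖ ^ 2 ≤
      Real.exp ((energyConst d n p * M + 1) * τ) * ‖toL2 (tailWeight p K) u₀‖ ^ 2 := by
  have hE := energyConst_nonneg d n hp
  have hgronwall := le_add_mul_exp_of_deriv_le (ε := 0) (K := energyConst d n p * M + 1)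
    (by linarith [mul_nonneg hE hM]) le_rfl
    (fun s hs => (hu.deriv (tailWeight p K) s hs).norm_sq)
    (fun s hs => by
      calc _ ≤ energyConst d n p * normH n (u s) * ‖toL2 (tailWeight p K) (u s)‖ ^ 2 :=
            two_mul_inner_galerkinRHS_tailWeight_le hn hp hK hν (hu.isTrigPoly s)
        _ ≤ energyConst d n p * M * ‖toL2 (tailWeight p K) (u s)‖ ^ 2 := by
            gcongr
            exact huM s hs
        _ ≤ _ := by linarith [sq_nonneg ‖toL2 (tailWeight p K) (u s)‖]) ht
  refine hgronwall.trans ?_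
  rw [add_zero, sub_zero, hu.init, mul_comm]
  gcongr
  · exact ht.2
  · exact norm_toL2_trunc_le (hu₀.memL2_tailWeight hK) N

end IsGalerkin

/-- The defect of a solution `v` of the Galerkin system, as a solution of the full equations. -/
def galerkinResidual (N : ℝ) (v : VField d) : VField d := trunc N (bilin v v) - bilin v v

lemma galerkinRHS_eq_rhs_add (ν N : ℝ) (v : VField d) :
    galerkinRHS ν N v = rhs ν v + galerkinResidual N v := by
  unfold galerkinRHS rhs galerkinResidual
  abel

lemma MemH.galerkinResidual {n : ℝ} (hn : (d : ℝ) / 2 + 1 < n) {v : VField d}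
    (hv : MemH (n + 1) v) (N : ℝ) : MemH n (galerkinResidual N v) :=
  ((hv.bilin_self hn).trunc N).sub (hv.bilin_self hn)

lemma normH_galerkinResidual_le {n N D : ℝ} (hn : (d : ℝ) / 2 + 1 < n) (hN : 0 < N)
    {v : VField d} (hv : MemH (n + 2) v) (hvD : normH (n + 2) v ≤ D) :
    normH n (galerkinResidual N v) ≤ N⁻¹ * (bilinConst d (n + 1) * D * D) := by
  have hn' : (d : ℝ) / 2 + 1 < n + 1 := by linarith
  have hadd : n + 1 + 1 = n + 2 := by ring
  have hv₁ : MemH (n + 1) v := hv.mono (by linarith)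
  have hv₂ : MemH (n + 1 + 1) v := hadd ▸ hv
  have hv₁D : normH (n + 1) v ≤ D := (hv.normH_mono (by linarith)).trans hvD
  have hbilin : normH (n + 1) (bilin v v) ≤ bilinConst d (n + 1) * D * D := by
    have := bilinConst_nonneg d (n + 1)
    have := (normH_nonneg _ _).trans hvD
    calc normH (n + 1) (bilin v v)
        ≤ bilinConst d (n + 1) * normH (n + 1) v * normH (n + 1 + 1) v :=
          normH_bilin_le hn' hv₁ hv₂
      _ ≤ bilinConst d (n + 1) * D * D := by
          rw [hadd]
          gcongr
          exact normH_nonneg _ _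
  calc normH n (galerkinResidual N v) = normH n (bilin v v - trunc N (bilin v v)) :=
        normH_sub_comm n _ _
    _ ≤ N⁻¹ * normH (n + 1) (bilin v v) := normH_sub_trunc_le hN (hv₁.bilin hn' hv₂)
    _ ≤ _ := by gcongr

lemma normH_zero_galerkinResidual_sub_le {n N N' D : ℝ} (hn : (d : ℝ) / 2 + 1 < n) (hN : 0 < N)
    (hN' : 0 < N') {v w : VField d} (hv : MemH (n + 2) v) (hw : MemH (n + 2) w)
    (hvD : normH (n + 2) v ≤ D) (hwD : normH (n + 2) w ≤ D) :
    normH 0 (galerkinResidual N v - galerkinResidual N' w) ≤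
      (N⁻¹ + N'⁻¹) * (bilinConst d (n + 1) * D * D) := by
  have hn₀ : 0 ≤ n := by linarith [(Nat.cast_nonneg d : (0 : ℝ) ≤ d)]
  have hv' := MemH.galerkinResidual hn (hv.mono (by linarith)) N
  have hw' := MemH.galerkinResidual hn (hw.mono (by linarith)) N'
  calc normH 0 (galerkinResidual N v - galerkinResidual N' w)
      ≤ normH n (galerkinResidual N v) + normH n (galerkinResidual N' w) :=
        ((hv'.sub hw').normH_mono hn₀).trans (hv'.normH_sub_le hw')
    _ ≤ _ := by
        rw [add_mul]
        exact add_le_add (normH_galerkinResidual_le hn hN hv hvD)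
          (normH_galerkinResidual_le hn hN' hw hwD)

lemma normH_zero_trunc_sub_trunc_le {N N' : ℝ} (hN : 0 < N) (hN' : 0 < N') {v : VField d}
    (hv : MemH 1 v) : normH 0 (trunc N v - trunc N' v) ≤ (N⁻¹ + N'⁻¹) * normH 1 v := by
  have hv₀ : MemH 0 v := hv.mono zero_le_one
  have hv₁ : MemH (0 + 1) v := by rwa [zero_add]
  calc normH 0 (trunc N v - trunc N' v)
      = normH 0 ((v - trunc N' v) - (v - trunc N v)) := by rw [sub_sub_sub_cancel_left]
    _ ≤ normH 0 (v - trunc N' v) + normH 0 (v - trunc N v) :=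
        (hv₀.sub (hv₀.trunc N')).normH_sub_le (hv₀.sub (hv₀.trunc N))
    _ ≤ N'⁻¹ * normH (0 + 1) v + N⁻¹ * normH (0 + 1) v :=
        add_le_add (normH_sub_trunc_le hN' hv₁) (normH_sub_trunc_le hN hv₁)
    _ = (N⁻¹ + N'⁻¹) * normH 1 v := by rw [zero_add]; ring

namespace IsGalerkin

lemma deriv_rhs_add {ν N τ : ℝ} {u₀ : VField d} {u : ℝ → VField d} (hu : IsGalerkin ν N τ u₀ u)
    (φ : (Fin d → ℤ) → ℝ) {t : ℝ} (ht : t ∈ Set.Icc 0 τ) :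
    HasDerivWithinAt (fun t => toL2 φ (u t))
      (toL2 φ (rhs ν (u t) + galerkinResidual N (u t))) (Set.Icc 0 τ) t :=
  galerkinRHS_eq_rhs_add ν N (u t) ▸ hu.deriv φ t ht

lemma normH_zero_sub_sq_le {n ν N N' τ D : ℝ} (hn : (d : ℝ) / 2 + 1 < n) (hν : 0 ≤ ν)
    (hN : 0 < N) (hN' : 0 < N') (hD : 0 ≤ D) {u₀ : VField d} (hu₀ : MemH 1 u₀)
    {u v : ℝ → VField d} (hu : IsGalerkin ν N τ u₀ u) (hv : IsGalerkin ν N' τ u₀ v)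
    (huD : ∀ t ∈ Set.Icc 0 τ, normH (n + 2) (u t) ≤ D)
    (hvD : ∀ t ∈ Set.Icc 0 τ, normH (n + 2) (v t) ≤ D) {t : ℝ} (ht : t ∈ Set.Icc 0 τ) :
    normH 0 (u t - v t) ^ 2 ≤
      (N⁻¹ + N'⁻¹) ^ 2 * (normH 1 u₀ ^ 2 + (bilinConst d (n + 1) * D * D) ^ 2) *
        Real.exp ((2 * bilinConst d n * D + 1) * τ) := by
  have hn₀ : 0 ≤ n := by linarith [(Nat.cast_nonneg d : (0 : ℝ) ≤ d)]
  have hbilin := bilinConst_nonneg d n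
  have hmem {w : VField d} {M : ℝ} (hw : IsTrigPoly M w) : MemH 0 (galerkinResidual M w) :=
    (MemH.galerkinResidual hn (hw.memH _) M).mono hn₀
  set C := bilinConst d (n + 1) * D * D
  have hinit : normH 0 (u 0 - v 0) ≤ (N⁻¹ + N'⁻¹) * normH 1 u₀ := by
    rw [hu.init, hv.init]
    exact normH_zero_trunc_sub_trunc_le hN hN' hu₀
  calc normH 0 (u t - v t) ^ 2
      ≤ (normH 0 (u 0 - v 0) ^ 2 + ((N⁻¹ + N'⁻¹) * C) ^ 2) *
          Real.exp ((2 * bilinConst d n * D + 1) * (t - 0)) :=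
        EulerNS.normH_zero_sub_sq_le hn hν hD (fun s _ => (hu.isTrigPoly s).memH _)
          (fun s _ => (hv.isTrigPoly s).memH _) (fun s _ => hmem (hu.isTrigPoly s))
          (fun s _ => hmem (hv.isTrigPoly s)) (fun s hs => hu.deriv_rhs_add _ hs)
          (fun s hs => hv.deriv_rhs_add _ hs)
          (fun s hs => (((hv.isTrigPoly s).memH (n + 2)).normH_mono (by linarith)).trans
            (hvD s hs))
          (fun s hs => normH_zero_galerkinResidual_sub_le hn hN hN' ((hu.isTrigPoly s).memH _)
            ((hv.isTrigPoly s).memH _) (huD s hs) (hvD s hs)) ht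
    _ ≤ (((N⁻¹ + N'⁻¹) * normH 1 u₀) ^ 2 + ((N⁻¹ + N'⁻¹) * C) ^ 2) *
          Real.exp ((2 * bilinConst d n * D + 1) * τ) := by
        have := normH_nonneg 0 (u 0 - v 0)
        gcongr
        rw [sub_zero]
        exact ht.2
    _ = _ := by ring

end IsGalerkin

section GalerkinLimit

variable {n ν τ M D : ℝ} {u₀ : VField d} {v : ℕ → ℝ → VField d}

lemma exists_norm_toL2_tailWeight_le {p : ℝ} (hn : (d : ℝ) / 2 + 1 < n) (hν : 0 ≤ ν) (hp : 0 ≤ p)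
    (hM : 0 ≤ M) (hu₀ : MemH p u₀) (hv : ∀ j : ℕ, IsGalerkin ν (j + 1) τ u₀ (v j))
    (hvM : ∀ j, ∀ t ∈ Set.Icc 0 τ, normH n (v j t) ≤ M) {ε : ℝ} (hε : 0 < ε) :
    ∃ K > 0, ∀ j, ∀ t ∈ Set.Icc 0 τ, ‖toL2 (tailWeight p K) (v j t)‖ ≤ ε := by
  have hlim := hu₀.tendsto_norm_toL2_tailWeight.const_mul
    (Real.exp ((energyConst d n p * M + 1) * τ))
  rw [mul_zero] at hlim
  obtain ⟨K, hKε, hK⟩ :=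
    ((hlim.eventually (gt_mem_nhds (pow_pos hε 2))).and (eventually_gt_atTop 0)).exists
  exact ⟨K, hK, fun j t ht => le_of_pow_le_pow_left₀ two_ne_zero hε.le
    (((hv j).norm_toL2_tailWeight_sq_le hn hp hK hν hM hu₀ (hvM j) ht).trans hKε.le)⟩

lemma exists_normH_le {p : ℝ} (hn : (d : ℝ) / 2 + 1 < n) (hν : 0 ≤ ν) (hp : 0 < p)
    (hM : 0 ≤ M) (hu₀ : MemH p u₀) (hv : ∀ j : ℕ, IsGalerkin ν (j + 1) τ u₀ (v j))
    (hvM : ∀ j, ∀ t ∈ Set.Icc 0 τ, normH n (v j t) ≤ M) :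
    ∃ D ≥ 0, ∀ j, ∀ t ∈ Set.Icc 0 τ, normH p (v j t) ≤ D := by
  refine ⟨√(Real.exp ((energyConst d n p * M + 1) * τ) * normH p u₀ ^ 2), Real.sqrt_nonneg _,
    fun j t ht => Real.le_sqrt_of_sq_le ?_⟩
  simpa only [toL2_tailWeight_one hp.ne', norm_toL2_sobolevWeight] using
    (hv j).norm_toL2_tailWeight_sq_le hn hp.le one_pos hν hM hu₀ (hvM j) ht

lemma uniformCauchySeqOn_toL2_zero (hn : (d : ℝ) / 2 + 1 < n) (hν : 0 ≤ ν) (hD : 0 ≤ D)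
    (hu₀ : MemH 1 u₀) (hv : ∀ j : ℕ, IsGalerkin ν (j + 1) τ u₀ (v j))
    (hvD : ∀ j, ∀ t ∈ Set.Icc 0 τ, normH (n + 2) (v j t) ≤ D) :
    UniformCauchySeqOn (fun j t => toL2 (sobolevWeight 0) (v j t)) atTop (Set.Icc 0 τ) := by
  rw [Metric.uniformCauchySeqOn_iff]
  intro ε hε
  set C := normH 1 u₀ ^ 2 + (bilinConst d (n + 1) * D * D) ^ 2
  set L := Real.exp ((2 * bilinConst d n * D + 1) * τ)
  have hlim : Tendsto (fun J : ℕ => (((J : ℝ) + 1)⁻¹ + ((J : ℝ) + 1)⁻¹) ^ 2 * C * L)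
      atTop (𝓝 0) := by
    have hinv := tendsto_one_div_add_atTop_nhds_zero_nat (𝕜 := ℝ)
    simpa [one_div] using (((hinv.add hinv).pow 2).mul_const C).mul_const L
  obtain ⟨J, hJ⟩ := (hlim.eventually (gt_mem_nhds (pow_pos hε 2))).exists
  refine ⟨J, fun i hi j hj t ht => ?_⟩
  rw [dist_eq_norm, MemH.norm_toL2_sub (((hv i).isTrigPoly t).memH 0)
    (((hv j).isTrigPoly t).memH 0)]
  refine lt_of_pow_lt_pow_left₀ 2 hε.le (lt_of_le_of_lt ?_ hJ)
  calc normH 0 (v i t - v j t) ^ 2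
      ≤ (((i : ℝ) + 1)⁻¹ + ((j : ℝ) + 1)⁻¹) ^ 2 * C * L :=
        (hv i).normH_zero_sub_sq_le hn hν (by positivity) (by positivity) hD hu₀ (hv j)
          (hvD i) (hvD j) ht
    _ ≤ (((J : ℝ) + 1)⁻¹ + ((J : ℝ) + 1)⁻¹) ^ 2 * C * L := by gcongr

lemma tendstoUniformlyOn_toL2_galerkinRHS (hn : (d : ℝ) / 2 + 1 < n) (hν : 0 ≤ ν)
    (hv : ∀ j : ℕ, IsGalerkin ν (j + 1) τ u₀ (v j))
    (hvD : ∀ j, ∀ t ∈ Set.Icc 0 τ, normH (n + 2) (v j t) ≤ D) {u : ℝ → VField d}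
    (hu : ∀ t ∈ Set.Icc 0 τ, MemH (n + 2) (u t))
    (hlim : TendstoUniformlyOn (fun j t => toL2 (sobolevWeight (n + 2)) (v j t))
      (fun t => toL2 (sobolevWeight (n + 2)) (u t)) atTop (Set.Icc 0 τ)) :
    TendstoUniformlyOn (fun (j : ℕ) t => toL2 (sobolevWeight n) (galerkinRHS ν (j + 1) (v j t)))
      (fun t => toL2 (sobolevWeight n) (rhs ν (u t))) atTop (Set.Icc 0 τ) := by
  have huD : ∀ t ∈ Set.Icc 0 τ, normH (n + 2) (u t) ≤ D := fun t ht => by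
    rw [← norm_toL2_sobolevWeight]
    refine le_of_tendsto (hlim.tendsto_at ht).norm (Eventually.of_forall fun j => ?_)
    rw [norm_toL2_sobolevWeight]
    exact hvD j t ht
  have hresidual : Tendsto (fun j : ℕ => ((j : ℝ) + 1)⁻¹ * (bilinConst d (n + 1) * D * D))
      atTop (𝓝 0) := by
    simpa [one_div] using (tendsto_one_div_add_atTop_nhds_zero_nat (𝕜 := ℝ)).mul_const
      (bilinConst d (n + 1) * D * D)
  refine tendstoUniformlyOn_of_dist_le_mul_add (C := ν + 2 * bilinConst d n * D) hlim hresidual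
    fun j t ht => ?_
  have hvj (p : ℝ) : MemH p (v j t) := ((hv j).isTrigPoly t).memH p
  have hres : MemH n (galerkinResidual (j + 1) (v j t)) := (hvj (n + 1)).galerkinResidual hn _
  rw [dist_eq_norm, dist_eq_norm, galerkinRHS_eq_rhs_add,
    toL2_add (MemH.rhs hn (hvj _) ν).memL2 hres.memL2, ← sub_sub]
  refine (norm_sub_le _ _).trans (add_le_add
    (norm_toL2_rhs_sub_le hn hν (hu t ht) (hvj _) (huD t ht) (hvD j t ht)) ?_)
  rw [norm_toL2_sobolevWeight]
  exact normH_galerkinResidual_le hn (by positivity) (hvj _) (hvD j t ht)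

lemma tendsto_toL2_of_tendsto_toL2 {m p : ℝ} (hmp : m ≤ p) {w : ℕ → VField d} {w₀ : VField d}
    (hw : ∀ j, MemH p (w j)) (hw₀ : MemH p w₀)
    (hlim : Tendsto (fun j => toL2 (sobolevWeight p) (w j)) atTop
      (𝓝 (toL2 (sobolevWeight p) w₀))) :
    Tendsto (fun j => toL2 (sobolevWeight m) (w j)) atTop (𝓝 (toL2 (sobolevWeight m) w₀)) := by
  rw [tendsto_iff_norm_sub_tendsto_zero] at hlim ⊢
  refine squeeze_zero (fun _ => norm_nonneg _) (fun j => ?_) hlim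
  rw [MemH.norm_toL2_sub ((hw j).mono hmp) (hw₀.mono hmp), MemH.norm_toL2_sub (hw j) hw₀]
  exact ((hw j).sub hw₀).normH_mono hmp

lemma tendsto_trunc_apply (u₀ : VField d) (k : Fin d → ℤ) :
    Tendsto (fun j : ℕ => trunc ((j : ℝ) + 1) u₀ k) atTop (𝓝 (u₀ k)) := by
  have hlarge : ∀ᶠ j : ℕ in atTop, kabs k ≤ j + 1 :=
    (tendsto_natCast_atTop_atTop.atTop_add tendsto_const_nhds).eventually_ge_atTop (kabs k)
  exact tendsto_const_nhds.congr' (hlarge.mono fun j hj => (trunc_of_le hj).symm)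

lemma exists_solvesOn_of_isGalerkin (hn : (d : ℝ) / 2 + 1 < n) (hν : 0 ≤ ν) (hτ : 0 ≤ τ)
    (hM : 0 ≤ M) (hu₀ : MemH (n + 2) u₀) (hv : ∀ j : ℕ, IsGalerkin ν (j + 1) τ u₀ (v j))
    (hvM : ∀ j, ∀ t ∈ Set.Icc 0 τ, normH n (v j t) ≤ M) :
    ∃ u : ℝ → VField d, u 0 = u₀ ∧ SolvesOn n ν (Set.Icc 0 τ) u := by
  have hn₀ : 0 ≤ n := by linarith [(Nat.cast_nonneg d : (0 : ℝ) ≤ d)]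
  have hmem (j : ℕ) (t p : ℝ) : MemH p (v j t) := ((hv j).isTrigPoly t).memH p
  obtain ⟨D, hD, hvD⟩ := exists_normH_le hn hν (by linarith) hM hu₀ hv hvM
  have hcauchy : UniformCauchySeqOn (fun j t => toL2 (sobolevWeight (n + 2)) (v j t)) atTop
      (Set.Icc 0 τ) :=
    uniformCauchySeqOn_toL2_sobolevWeight (by linarith) (fun j t _ => hmem j t _)
      (fun _ hε => exists_norm_toL2_tailWeight_le hn hν (by linarith) hM hu₀ hv hvM hε)
      (uniformCauchySeqOn_toL2_zero hn hν hD (hu₀.mono (by linarith)) hv hvD)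
  obtain ⟨u, hu, hlim, hlim_apply⟩ :=
    exists_tendstoUniformlyOn_toL2 (fun j t _ => hmem j t _) hcauchy
  have hcont : ContinuousOn (fun t => toL2 (sobolevWeight (n + 2)) (u t)) (Set.Icc 0 τ) :=
    hlim.continuousOn (Frequently.of_forall fun j t ht => ((hv j).deriv _ t ht).continuousWithinAt)
  have hinit : u 0 = u₀ := funext fun k =>
    tendsto_nhds_unique (hlim_apply 0 (Set.left_mem_Icc.mpr hτ) k)
      (by simpa only [(hv _).init] using tendsto_trunc_apply u₀ k)
  refine ⟨u, hinit, hu, hcont, fun t ht => ?_⟩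
  exact hasDerivWithinAt_of_tendstoUniformlyOn (convex_Icc 0 τ)
    (fun j => (hv j).deriv (sobolevWeight n))
    (fun s hs => tendsto_toL2_of_tendsto_toL2 (by linarith) (fun j => hmem j s _) (hu s hs)
      (hlim.tendsto_at hs))
    (tendstoUniformlyOn_toL2_galerkinRHS hn hν hv hvD hu hlim)
    (continuousOn_toL2_rhs hn hν hu hcont) ht

end GalerkinLimit

theorem exists_solvesOn {n ν R : ℝ} (hn : (d : ℝ) / 2 + 1 < n) (hν : 0 ≤ ν) (hR : 0 < R)
    {u₀ : VField d} (hu₀ : MemH (n + 2) u₀) (hR₀ : normH n u₀ ≤ R) :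
    ∃ u : ℝ → VField d, u 0 = u₀ ∧ SolvesOn n ν (Set.Icc 0 (lifespan d n R)) u := by
  have hn₀ : 0 ≤ n := by linarith [(Nat.cast_nonneg d : (0 : ℝ) ≤ d)]
  have hτ := (lifespan_pos (d := d) hn₀ hR).le
  choose v hv using fun j : ℕ => exists_galerkin hν hτ ((j : ℝ) + 1) hu₀
  exact exists_solvesOn_of_isGalerkin hn hν hτ (by positivity) hu₀ hv fun j t ht =>
    (hv j).normH_le hn hν hR (hu₀.mono (by linarith)) hR₀ ht

/-! ### Maximal solutions -/

lemma tendsto_normH_sub_iff {n : ℝ} {I : Set ℝ} {u : ℝ → VField d} (hu : ∀ t ∈ I, MemH n (u t))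
    {t : ℝ} (ht : t ∈ I) :
    Tendsto (fun s => normH n (u s - u t)) (𝓝[I] t) (𝓝 0) ↔
      ContinuousWithinAt (fun s => toL2 (sobolevWeight n) (u s)) I t := by
  rw [ContinuousWithinAt,
    tendsto_iff_norm_sub_tendsto_zero (f := fun s => toL2 (sobolevWeight n) (u s))]
  refine tendsto_congr' ?_
  filter_upwards [self_mem_nhdsWithin] with s hs
  exact (MemH.norm_toL2_sub (hu s hs) (hu t ht)).symm

lemma tendsto_normH_slope_sub_iff {n : ℝ} {I : Set ℝ} {u : ℝ → VField d}
    (hu : ∀ t ∈ I, MemH n (u t)) {t : ℝ} (ht : t ∈ I) {w : VField d} (hw : MemH n w) :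
    Tendsto (fun s => normH n ((s - t)⁻¹ • (u s - u t) - w)) (𝓝[I \ {t}] t) (𝓝 0) ↔
      HasDerivWithinAt (fun s => toL2 (sobolevWeight n) (u s)) (toL2 (sobolevWeight n) w) I t := by
  rw [hasDerivWithinAt_iff_tendsto_slope,
    tendsto_iff_norm_sub_tendsto_zero (b := toL2 (sobolevWeight n) w)]
  refine tendsto_congr' ?_
  filter_upwards [self_mem_nhdsWithin] with s hs
  have hdiff := (hu s hs.1).sub (hu t ht)
  rw [← MemH.norm_toL2_sub (hdiff.smul _) hw, toL2_smul hdiff.memL2,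
    MemH.toL2_sub (hu s hs.1) (hu t ht), slope_def_module]

lemma hasDerivWithinAt_toL2_mono {m n : ℝ} (hmn : m ≤ n) {I : Set ℝ} {u : ℝ → VField d}
    (hu : ∀ t ∈ I, MemH n (u t)) {t : ℝ} (ht : t ∈ I) {w : VField d} (hw : MemH n w)
    (h : HasDerivWithinAt (fun s => toL2 (sobolevWeight n) (u s)) (toL2 (sobolevWeight n) w) I t) :
    HasDerivWithinAt (fun s => toL2 (sobolevWeight m) (u s)) (toL2 (sobolevWeight m) w) I t := by
  rw [← tendsto_normH_slope_sub_iff hu ht hw] at h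
  rw [← tendsto_normH_slope_sub_iff (fun s hs => (hu s hs).mono hmn) ht (hw.mono hmn)]
  refine squeeze_zero' (Eventually.of_forall fun _ => normH_nonneg _ _) ?_ h
  filter_upwards [self_mem_nhdsWithin] with s hs
  exact ((((hu s hs.1).sub (hu t ht)).smul _).sub hw).normH_mono hmn

lemma isSolution_zero_iff {n ν : ℝ} (hn : (d : ℝ) / 2 + 1 < n) (hν : 0 ≤ ν) {u₀ : VField d}
    {T : EReal} {u : ℝ → VField d} :
    IsSolution n ν (fun _ => 0) u₀ T u ↔ 0 < T ∧ SolvesOn n ν (timeIco T) u ∧ u 0 = u₀ := by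
  have hmono (h : ∀ t ∈ timeIco T, MemH (n + 2) (u t)) : ∀ t ∈ timeIco T, MemH n (u t) :=
    fun t ht => (h t ht).mono (by linarith)
  constructor
  · intro h
    obtain ⟨u', -, hderiv, heqn⟩ := h.eqn
    refine ⟨h.pos, ⟨h.cont.1, fun t ht => (tendsto_normH_sub_iff h.cont.1 ht).mp (h.cont.2 t ht),
      fun t ht => ?_⟩, h.init⟩
    have hrhs : u' t = rhs ν (u t) := by rw [heqn t ht, rhs, add_zero]
    have hslope := hderiv t ht
    rw [hrhs] at hslope
    exact (tendsto_normH_slope_sub_iff (hmono h.cont.1) ht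
      (MemH.rhs hn (h.cont.1 t ht) ν)).mp hslope
  · rintro ⟨hT, h, hinit⟩
    have hrhs : ∀ t ∈ timeIco T, MemH n (rhs ν (u t)) := fun t ht => MemH.rhs hn (h.mem t ht) ν
    exact {
      pos := hT
      cont := ⟨h.mem, fun t ht => (tendsto_normH_sub_iff h.mem ht).mpr (h.cont t ht)⟩
      eqn := ⟨fun t => rhs ν (u t),
        ⟨hrhs, fun t ht => (tendsto_normH_sub_iff hrhs ht).mpr
          (continuousOn_toL2_rhs hn hν h.mem h.cont t ht)⟩,
        fun t ht => (tendsto_normH_slope_sub_iff (hmono h.mem) ht (hrhs t ht)).mpr (h.deriv t ht),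
        fun t _ => (add_zero _).symm⟩
      init := hinit }

lemma Icc_subset_timeIco {T : EReal} {a t : ℝ} (ha : 0 ≤ a) (ht : (t : EReal) < T) :
    Set.Icc a t ⊆ timeIco T := fun _ hs =>
  ⟨ha.trans hs.1, lt_of_le_of_lt (EReal.coe_le_coe_iff.mpr hs.2) ht⟩

lemma timeIco_mem_nhdsWithin {T T' : EReal} {t : ℝ} (ht : (t : EReal) < T) :
    timeIco T ∈ 𝓝[timeIco T'] t := by
  have hopen : {s : ℝ | (s : EReal) < T} ∈ 𝓝 t :=
    (isOpen_Iio.preimage continuous_coe_real_ereal).mem_nhds ht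
  filter_upwards [self_mem_nhdsWithin, mem_nhdsWithin_of_mem_nhds hopen] with s hs hs'
  exact ⟨hs.1, hs'⟩

namespace SolvesOn

variable {n ν : ℝ} {I J : Set ℝ} {u v : ℝ → VField d}

lemma mono (h : SolvesOn n ν J u) (hIJ : I ⊆ J) : SolvesOn n ν I u :=
  ⟨fun t ht => h.mem t (hIJ ht), h.cont.mono hIJ, fun t ht => (h.deriv t (hIJ ht)).mono hIJ⟩

lemma congr (hv : SolvesOn n ν I v) (huv : Set.EqOn u v I) : SolvesOn n ν I u where
  mem t ht := huv ht ▸ hv.mem t ht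
  cont := hv.cont.congr fun t ht => by rw [huv ht]
  deriv t ht := by
    rw [huv ht]
    exact (hv.deriv t ht).congr (fun s hs => by rw [huv hs]) (by rw [huv ht])

lemma of_forall_exists_nhdsWithin
    (h : ∀ t ∈ I, ∃ (J : Set ℝ) (v : ℝ → VField d), J ∈ 𝓝[I] t ∧ SolvesOn n ν J v ∧
      Set.EqOn u v J) : SolvesOn n ν I u := by
  have hlocal : ∀ t ∈ I, ∃ J ∈ 𝓝[I] t, t ∈ J ∧ SolvesOn n ν J u := fun t ht => by
    obtain ⟨J, v, hJ, hv, huv⟩ := h t ht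
    exact ⟨J, hJ, mem_of_mem_nhdsWithin ht hJ, hv.congr huv⟩
  refine ⟨fun t ht => ?_, fun t ht => ?_, fun t ht => ?_⟩ <;>
    obtain ⟨J, hJ, htJ, hu⟩ := hlocal t ht
  · exact hu.mem t htJ
  · exact (hu.cont t htJ).mono_of_mem_nhdsWithin hJ
  · exact (hu.deriv t htJ).mono_of_mem_nhdsWithin hJ

lemma comp_sub_const (h : SolvesOn n ν I u) (c : ℝ) :
    SolvesOn n ν ((fun t => t - c) ⁻¹' I) (fun t => u (t - c)) where
  mem t ht := h.mem _ ht
  cont := h.cont.comp (f := fun t : ℝ => t - c) (by fun_prop) (Set.mapsTo_preimage _ _)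
  deriv t ht := by
    have hshift : HasDerivWithinAt (fun t : ℝ => t - c) 1 ((fun t => t - c) ⁻¹' I) t :=
      (hasDerivWithinAt_id t _).sub_const c
    simpa only [one_smul, Function.comp_def] using
      (h.deriv _ ht).scomp t hshift (Set.mapsTo_preimage _ _)

lemma continuousOn_normH (h : SolvesOn n ν I u) : ContinuousOn (fun t => normH n (u t)) I := by
  simp only [← norm_toL2_sobolevWeight]
  exact fun t ht => (h.deriv t ht).continuousWithinAt.norm

lemma exists_normH_le {a b : ℝ} (h : SolvesOn n ν (Set.Icc a b) u) :
    ∃ R, 0 ≤ R ∧ ∀ t ∈ Set.Icc a b, normH n (u t) ≤ R := by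
  obtain ⟨R, hR⟩ := isCompact_Icc.exists_bound_of_continuousOn h.continuousOn_normH
  exact ⟨max R 0, le_max_right _ _, fun t ht =>
    (Real.le_norm_self _).trans ((hR t ht).trans (le_max_left _ _))⟩

theorem eqOn_Icc {a b : ℝ} (hn : (d : ℝ) / 2 + 1 < n) (hν : 0 ≤ ν)
    (hu : SolvesOn n ν (Set.Icc a b) u) (hv : SolvesOn n ν (Set.Icc a b) v)
    (hinit : u a = v a) : Set.EqOn u v (Set.Icc a b) := by
  intro t ht
  have hn₀ : 0 ≤ n := by linarith [(Nat.cast_nonneg d : (0 : ℝ) ≤ d)]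
  have hderiv {w : ℝ → VField d} (hw : SolvesOn n ν (Set.Icc a b) w) {s : ℝ}
      (hs : s ∈ Set.Icc a b) : HasDerivWithinAt (fun t => toL2 (sobolevWeight 0) (w t))
        (toL2 (sobolevWeight 0) (rhs ν (w s) + 0)) (Set.Icc a b) s := by
    rw [add_zero]
    exact hasDerivWithinAt_toL2_mono hn₀ (fun r hr => (hw.mem r hr).mono (by linarith)) hs
      (MemH.rhs hn (hw.mem s hs) ν) (hw.deriv s hs)
  obtain ⟨R, hR₀, hR⟩ := hv.exists_normH_le
  have hstable := normH_zero_sub_sq_le (f := fun _ => 0) (g := fun _ => 0) (ε := 0) hn hν hR₀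
    hu.mem hv.mem (fun _ _ => MemH.zero 0) (fun _ _ => MemH.zero 0) (fun _ => hderiv hu)
    (fun _ => hderiv hv) hR (fun _ _ => by rw [sub_zero, normH_zero]) ht
  have hzero : normH 0 (u t - v t) ^ 2 = 0 :=
    le_antisymm (by simpa [hinit] using hstable) (sq_nonneg _)
  exact sub_eq_zero.mp <| MemH.eq_zero_of_normH_eq_zero
    (((hu.mem t ht).sub (hv.mem t ht)).mono (by linarith)) (pow_eq_zero_iff two_ne_zero |>.mp hzero)

lemma ite_lt {b c e : ℝ} (hn : (d : ℝ) / 2 + 1 < n) (hν : 0 ≤ ν) (hc : 0 ≤ c) (hcb : c < b)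
    (hu : SolvesOn n ν (timeIco b) u) (hv : SolvesOn n ν (Set.Icc c e) v) (huv : u c = v c) :
    SolvesOn n ν (timeIco e) (fun t => if t < b then u t else v t) := by
  have heq_u : Set.EqOn (fun t => if t < b then u t else v t) u (timeIco b) := fun t ht =>
    if_pos (EReal.coe_lt_coe_iff.mp ht.2)
  have heq_v : Set.EqOn (fun t => if t < b then u t else v t) v (Set.Icc c e) := by
    intro t ht
    by_cases htb : t < b
    · have hut : SolvesOn n ν (Set.Icc c t) u :=
        hu.mono (Icc_subset_timeIco hc (EReal.coe_lt_coe_iff.mpr htb))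
      exact (if_pos htb).trans
        (eqOn_Icc hn hν hut (hv.mono (Set.Icc_subset_Icc_right ht.2)) huv ⟨ht.1, le_rfl⟩)
    · exact if_neg htb
  refine of_forall_exists_nhdsWithin fun t ht => ?_
  by_cases htb : t < b
  · exact ⟨timeIco b, u, timeIco_mem_nhdsWithin (EReal.coe_lt_coe_iff.mpr htb), hu, heq_u⟩
  · exact ⟨Set.Icc c e, v, mem_nhdsWithin_of_mem_nhds
      (Icc_mem_nhds (by linarith) (EReal.coe_lt_coe_iff.mp ht.2)), hv, heq_v⟩

end SolvesOn

section MaximalSolution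

variable {n ν : ℝ} (hn : (d : ℝ) / 2 + 1 < n) (hν : 0 ≤ ν) {u₀ : VField d}

include hn hν

lemma eq_of_isSolution {T T' : EReal} {u v : ℝ → VField d}
    (hu : IsSolution n ν (fun _ => 0) u₀ T u) (hv : IsSolution n ν (fun _ => 0) u₀ T' v) {t : ℝ}
    (ht : t ∈ timeIco T) (ht' : t ∈ timeIco T') : u t = v t := by
  obtain ⟨-, hu_solves, hu_init⟩ := (isSolution_zero_iff hn hν).mp hu
  obtain ⟨-, hv_solves, hv_init⟩ := (isSolution_zero_iff hn hν).mp hv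
  exact SolvesOn.eqOn_Icc hn hν (hu_solves.mono (Icc_subset_timeIco le_rfl ht.2))
    (hv_solves.mono (Icc_subset_timeIco le_rfl ht'.2)) (hu_init.trans hv_init.symm) ⟨ht.1, le_rfl⟩

lemma exists_forall_eqOn_of_isSolution (u₀ : VField d) :
    ∃ U : ℝ → VField d, ∀ T v, IsSolution n ν (fun _ => 0) u₀ T v → Set.EqOn U v (timeIco T) := by
  have hvalue (t : ℝ) : ∃ x : VField d, ∀ T v, IsSolution n ν (fun _ => 0) u₀ T v →
      t ∈ timeIco T → x = v t := by
    by_cases h : ∃ T v, IsSolution n ν (fun _ => 0) u₀ T v ∧ t ∈ timeIco T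
    · obtain ⟨T, v, hv, ht⟩ := h
      exact ⟨v t, fun T' w hw ht' => eq_of_isSolution hn hν hv hw ht ht'⟩
    · exact ⟨0, fun T v hv ht => absurd ⟨T, v, hv, ht⟩ h⟩
  choose U hU using hvalue
  exact ⟨U, fun T v hv t ht => hU t T v hv ht⟩

lemma exists_isSolution (hu₀ : MemH (n + 2) u₀) :
    ∃ T u, IsSolution n ν (fun _ => 0) u₀ T u := by
  have hn₀ : 0 ≤ n := by linarith [(Nat.cast_nonneg d : (0 : ℝ) ≤ d)]
  have hR : 0 < normH n u₀ + 1 := by linarith [normH_nonneg n u₀]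
  obtain ⟨u, hinit, hu⟩ := exists_solvesOn hn hν hR hu₀ (by linarith)
  refine ⟨(lifespan d n (normH n u₀ + 1) : ℝ), u, (isSolution_zero_iff hn hν).mpr
    ⟨EReal.coe_pos.mpr (lifespan_pos hn₀ hR), hu.mono fun t ht => ?_, hinit⟩⟩
  exact ⟨ht.1, (EReal.coe_lt_coe_iff.mp ht.2).le⟩

theorem exists_isMaximalSolution (hu₀ : MemH (n + 2) u₀) :
    ∃ T u, IsMaximalSolution n ν (fun _ => 0) u₀ T u := by
  obtain ⟨U, hU⟩ := exists_forall_eqOn_of_isSolution hn hν u₀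
  obtain ⟨T₀, v₀, hv₀⟩ := exists_isSolution hn hν hu₀
  let S : Set EReal := {T | ∃ v, IsSolution n ν (fun _ => 0) u₀ T v}
  have hpos : 0 < sSup S := hv₀.pos.trans_le (le_sSup ⟨v₀, hv₀⟩)
  have hsolves : SolvesOn n ν (timeIco (sSup S)) U := by
    refine SolvesOn.of_forall_exists_nhdsWithin fun t ht => ?_
    obtain ⟨T, ⟨v, hv⟩, htT⟩ := lt_sSup_iff.mp ht.2
    exact ⟨timeIco T, v, timeIco_mem_nhdsWithin htT, ((isSolution_zero_iff hn hν).mp hv).2.1,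
      hU T v hv⟩
  have hinit : U 0 = u₀ := (hU T₀ v₀ hv₀ ⟨le_rfl, hv₀.pos⟩).trans hv₀.init
  refine ⟨sSup S, U, (isSolution_zero_iff hn hν).mpr ⟨hpos, hsolves, hinit⟩, ?_⟩
  rintro ⟨T', v, hlt, hv, -⟩
  exact (le_sSup (show T' ∈ S from ⟨v, hv⟩)).not_gt hlt

-- Restart the solution from a time closer to `b` than the lifespan given by the bound `R`.
theorem exists_continuation {R b : ℝ} (hR : 0 < R) {u : ℝ → VField d}
    (hu : IsSolution n ν (fun _ => 0) u₀ b u) (hb : ∀ t ∈ timeIco b, normH n (u t) ≤ R) :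
    ∃ (T : EReal) (v : ℝ → VField d), b < T ∧ IsSolution n ν (fun _ => 0) u₀ T v ∧
      Set.EqOn v u (timeIco b) := by
  obtain ⟨hpos, hsolves, hinit⟩ := (isSolution_zero_iff hn hν).mp hu
  have hb₀ : 0 < b := EReal.coe_pos.mp hpos
  set τ := lifespan d n R
  have hτ : 0 < τ := lifespan_pos (by linarith [(Nat.cast_nonneg d : (0 : ℝ) ≤ d)]) hR
  obtain ⟨c, hc, hcb, hbc⟩ : ∃ c, 0 ≤ c ∧ c < b ∧ b < c + τ :=
    ⟨max 0 (b - τ / 2), le_max_left _ _, max_lt hb₀ (by linarith),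
      by linarith [le_max_right 0 (b - τ / 2)]⟩
  have hc_mem : c ∈ timeIco b := ⟨hc, EReal.coe_lt_coe_iff.mpr hcb⟩
  obtain ⟨v, hv_init, hv⟩ := exists_solvesOn hn hν hR (hsolves.mem c hc_mem) (hb c hc_mem)
  have hv_shift : SolvesOn n ν (Set.Icc c (c + τ)) fun t => v (t - c) :=
    (hv.comp_sub_const c).mono fun t ht => ⟨by linarith [ht.1], by linarith [ht.2]⟩
  have hglue := hsolves.ite_lt hn hν hc hcb hv_shift (by rw [sub_self, hv_init])
  exact ⟨(c + τ : ℝ), _, EReal.coe_lt_coe_iff.mpr hbc, (isSolution_zero_iff hn hν).mpr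
    ⟨EReal.coe_pos.mpr (hb₀.trans hbc), hglue, (if_pos hb₀).trans hinit⟩,
    fun t ht => if_pos (EReal.coe_lt_coe_iff.mp ht.2)⟩

end MaximalSolution

/-! ### The control inequality -/

lemma eNu_zero_right (ν : ℝ) : eNu ν 0 = 0 := by simp [eNu]

lemma mul_eNu (ν t : ℝ) : ν * eNu ν t = 1 - Real.exp (-ν * t) := by
  rcases eq_or_ne ν 0 with rfl | hν
  · simp
  · rw [eNu, if_neg hν, mul_div_cancel₀ _ hν]

lemma hasDerivAt_exp_neg_mul (ν t : ℝ) :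
    HasDerivAt (fun s => Real.exp (-ν * s)) (Real.exp (-ν * t) * -ν) t :=
  (hasDerivAt_const_mul (-ν)).exp

lemma hasDerivAt_eNu (ν t : ℝ) : HasDerivAt (eNu ν) (Real.exp (-ν * t)) t := by
  rcases eq_or_ne ν 0 with rfl | hν
  · have heq : eNu 0 = id := funext fun s => if_pos rfl
    simpa [heq] using hasDerivAt_id t
  · have heq : eNu ν = fun s => (1 - Real.exp (-ν * s)) / ν := funext fun s => if_neg hν
    rw [heq]
    refine (((hasDerivAt_exp_neg_mul ν t).const_sub 1).div_const ν).congr_deriv ?_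
    field_simp

lemma monotone_eNu (ν : ℝ) : Monotone (eNu ν) :=
  monotone_of_deriv_nonneg (fun t => (hasDerivAt_eNu ν t).differentiableAt)
    fun t => by rw [(hasDerivAt_eNu ν t).deriv]; exact (Real.exp_pos _).le

lemma eNu_nonneg (ν : ℝ) {t : ℝ} (ht : 0 ≤ t) : 0 ≤ eNu ν t :=
  eNu_zero_right ν ▸ monotone_eNu ν ht

lemma antitone_one_sub_mul_eNu (ν : ℝ) {c : ℝ} (hc : 0 ≤ c) :
    Antitone fun t => 1 - c * eNu ν t :=
  fun _ _ h => sub_le_sub_left (mul_le_mul_of_nonneg_left (monotone_eNu ν h) hc) 1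

lemma one_sub_div_le_one_sub_mul_eNu {ν c : ℝ} (hν : 0 < ν) (hc : 0 ≤ c) (t : ℝ) :
    1 - c / ν ≤ 1 - c * eNu ν t := by
  have h : eNu ν t ≤ 1 / ν := by
    rw [le_div_iff₀' hν, mul_eNu]
    linarith [Real.exp_pos (-ν * t)]
  simpa only [mul_one_div] using sub_le_sub_left (mul_le_mul_of_nonneg_left h hc) 1

lemma one_sub_mul_eNu_pos_of_le {ν c t : ℝ} (hc : c ≤ ν) (ht : 0 ≤ t) :
    0 < 1 - c * eNu ν t := by
  have h := mul_le_mul_of_nonneg_right hc (eNu_nonneg ν ht)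
  rw [mul_eNu] at h
  linarith [Real.exp_pos (-ν * t)]

lemma one_sub_mul_eNu_pos_of_lt_log {ν c t : ℝ} (hν : 0 < ν) (hc : ν < c)
    (ht : t < -(1 / ν) * Real.log (1 - ν / c)) : 0 < 1 - c * eNu ν t := by
  have hc₀ : 0 < c := hν.trans hc
  have hlog : Real.log (1 - ν / c) < -ν * t := by
    have h := mul_lt_mul_of_pos_left ht hν
    rw [← mul_assoc, mul_neg, mul_one_div_cancel hν.ne'] at h
    linarith
  have hexp : 1 - ν / c < Real.exp (-ν * t) :=
    (Real.log_lt_iff_lt_exp (sub_pos.mpr ((div_lt_one hc₀).mpr hc))).mp hlog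
  have h : ν * eNu ν t < ν * (1 / c) := by
    rw [mul_eNu, mul_one_div]
    linarith
  have h' := (lt_div_iff₀' hc₀).mp (lt_of_mul_lt_mul_left h hν.le)
  linarith

lemma one_sub_mul_eNu_pos_of_mem_timeIco_Tc {ν G a t : ℝ} (hν : 0 ≤ ν) (hG : 0 < G) (ha : 0 ≤ a)
    (ht : t ∈ timeIco (Tc ν G a)) : 0 < 1 - G * a * eNu ν t := by
  obtain ⟨ht₀, ht⟩ := ht
  unfold Tc at ht
  split_ifs at ht with hν₀ ha₀ hsmall
  · simp [ha₀]
  · have hGa : 0 < G * a := mul_pos hG (ha.lt_of_ne' ha₀)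
    have ht' := (lt_div_iff₀' hGa).mp (EReal.coe_lt_coe_iff.mp ht)
    rw [eNu, if_pos hν₀]
    linarith
  · exact one_sub_mul_eNu_pos_of_le ((le_div_iff₀' hG).mp hsmall) ht₀
  · exact one_sub_mul_eNu_pos_of_lt_log (hν.lt_of_ne' hν₀)
      ((div_lt_iff₀' hG).mp (not_le.mp hsmall)) (EReal.coe_lt_coe_iff.mp ht)

lemma Tc_eq_top {ν G a : ℝ} (ha : 0 ≤ a) (h : a ≤ ν / G) : Tc ν G a = ⊤ := by
  unfold Tc
  split_ifs with hν ha₀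
  · rfl
  · rw [hν, zero_div] at h
    exact absurd (le_antisymm h ha) ha₀
  · rfl

/-- The solution of the Riccati equation `B' = -νB + GB²` with `B(0) = A`, which controls the
norm `‖u(t)‖_n`. Its domain of interest is where the denominator is positive. -/
def barrier (ν G A t : ℝ) : ℝ := A * Real.exp (-ν * t) / (1 - G * A * eNu ν t)

lemma barrier_zero (ν G A : ℝ) : barrier ν G A 0 = A := by
  simp [barrier, eNu_zero_right]

lemma barrier_pos {ν G A t : ℝ} (hA : 0 < A) (h : 0 < 1 - G * A * eNu ν t) :
    0 < barrier ν G A t :=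
  div_pos (mul_pos hA (Real.exp_pos _)) h

lemma barrier_le {ν G A q t : ℝ} (hA : 0 ≤ A) (hq : 0 < q) (hqt : q ≤ 1 - G * A * eNu ν t) :
    barrier ν G A t ≤ A / q * Real.exp (-ν * t) := by
  rw [barrier, div_mul_eq_mul_div]
  gcongr

lemma hasDerivAt_barrier {ν G A t : ℝ} (h : 1 - G * A * eNu ν t ≠ 0) :
    HasDerivAt (barrier ν G A) (-ν * barrier ν G A t + G * barrier ν G A t ^ 2) t := by
  have hden := ((hasDerivAt_eNu ν t).const_mul (G * A)).const_sub 1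
  refine (((hasDerivAt_exp_neg_mul ν t).const_mul A).div hden h).congr_deriv ?_
  simp only [barrier]
  field_simp
  ring

section Comparison

variable {ν G A a b : ℝ} {g D : ℝ → ℝ} (hG : 0 ≤ G) (hab : a ≤ b)
  (hg : ∀ t ∈ Set.Icc a b, 0 ≤ g t)
  (hD : ∀ t ∈ Set.Icc a b, HasDerivWithinAt (fun t => g t ^ 2) (D t) (Set.Icc a b) t)
  (hpos : 0 < 1 - G * A * eNu ν (b - a))

include hG hab hg hD hpos

lemma le_barrier_of_lt (hA : 0 < A) (hga : g a ≤ A)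
    (hlt : ∀ t ∈ Set.Icc a b, 0 < g t → D t < -2 * ν * g t ^ 2 + 2 * G * g t ^ 3) :
    g b ≤ barrier ν G A (b - a) := by
  have hden : ∀ t ∈ Set.Icc a b, 0 < 1 - G * A * eNu ν (t - a) := fun t ht =>
    hpos.trans_le (antitone_one_sub_mul_eNu ν (by positivity) (sub_le_sub_right ht.2 a))
  have hB : ∀ t ∈ Set.Icc a b, 0 < barrier ν G A (t - a) := fun t ht => barrier_pos hA (hden t ht)
  have hB' : ∀ t ∈ Set.Icc a b, HasDerivAt (fun t => barrier ν G A (t - a) ^ 2)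
      (-2 * ν * barrier ν G A (t - a) ^ 2 + 2 * G * barrier ν G A (t - a) ^ 3) t := fun t ht => by
    refine (((hasDerivAt_barrier (hden t ht).ne').comp_sub_const t a).fun_pow 2).congr_deriv ?_
    ring
  have hb : b ∈ Set.Icc a b := ⟨hab, le_rfl⟩
  have hsq : g b ^ 2 ≤ barrier ν G A (b - a) ^ 2 := by
    refine image_le_of_deriv_right_lt_deriv_boundary' (f := fun t => g t ^ 2) (f' := D)
      (B := fun t => barrier ν G A (t - a) ^ 2) (fun t ht => (hD t ht).continuousWithinAt)
      (fun t ht => hasDerivWithinAt_Ici_of_Icc (hD t (Set.Ico_subset_Icc_self ht)) ht) ?_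
      (fun t ht => (hB' t ht).continuousAt.continuousWithinAt)
      (fun t ht => (hB' t (Set.Ico_subset_Icc_self ht)).hasDerivWithinAt) (fun t ht heq => ?_) hb
    · rw [sub_self, barrier_zero]
      exact pow_le_pow_left₀ (hg a ⟨le_rfl, hab⟩) hga 2
    · have ht' := Set.Ico_subset_Icc_self ht
      have hgB : g t = barrier ν G A (t - a) :=
        (pow_left_inj₀ (hg t ht') (hB t ht').le two_ne_zero).mp heq
      simpa only [hgB] using hlt t ht' (hgB ▸ hB t ht')
  exact le_of_pow_le_pow_left₀ two_ne_zero (hB b hb).le hsq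

/-- The comparison theorem needs a strict inequality, which is obtained by perturbing `G` and
`A`. -/
lemma le_barrier (hA : 0 ≤ A) (hga : g a ≤ A)
    (hle : ∀ t ∈ Set.Icc a b, D t ≤ -2 * ν * g t ^ 2 + 2 * G * g t ^ 3) :
    g b ≤ barrier ν G A (b - a) := by
  have hden : ContinuousAt (fun ε => 1 - (G + ε) * (A + ε) * eNu ν (b - a)) 0 := by fun_prop
  have hden₀ : 0 < 1 - (G + 0) * (A + 0) * eNu ν (b - a) := by simpa only [add_zero] using hpos
  have hbarrier : ContinuousAt (fun ε => barrier ν (G + ε) (A + ε) (b - a)) 0 := by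
    refine ContinuousAt.div ?_ hden hden₀.ne'
    fun_prop
  have hlim : Tendsto (fun ε => barrier ν (G + ε) (A + ε) (b - a)) (𝓝[>] 0)
      (𝓝 (barrier ν G A (b - a))) := by
    simpa only [add_zero] using hbarrier.tendsto.mono_left nhdsWithin_le_nhds
  refine ge_of_tendsto hlim ?_
  filter_upwards [(hden.eventually (lt_mem_nhds hden₀)).filter_mono nhdsWithin_le_nhds,
    self_mem_nhdsWithin] with ε hε (hε₀ : 0 < ε)
  refine le_barrier_of_lt (by positivity) hab hg hD hε (by positivity)
    (hga.trans (le_add_of_nonneg_right hε₀.le)) fun t ht hgt => ?_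
  have hgain : 0 < ε * g t ^ 3 := by positivity
  linarith [hle t ht]

end Comparison

section KatoBound

variable {n ν G : ℝ} (hn : (d : ℝ) / 2 + 1 < n)

lemma kabs_eq_one_of_normH_eq {m : ℝ} (hmn : m < n) {v : VField d} (hv : MemH n v)
    (h : normH m v = normH n v) {k : Fin d → ℤ} (hk : v k ≠ 0) : kabs k = 1 := by
  have hk₀ : k ≠ 0 := fun h₀ => hk (h₀ ▸ hv.mean)
  by_contra hne
  have hk₁ : 1 < kabs k := (one_le_kabs hk₀).lt_of_ne' hne
  have hmono : ∀ l, kabs l ^ (2 * m) * ‖v l‖ ^ 2 ≤ kabs l ^ (2 * n) * ‖v l‖ ^ 2 := fun l => by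
    rcases eq_or_ne l 0 with rfl | hl
    · simp [hv.mean]
    · gcongr
      exact one_le_kabs hl
  have hstrict : kabs k ^ (2 * m) * ‖v k‖ ^ 2 < kabs k ^ (2 * n) * ‖v k‖ ^ 2 := by
    refine mul_lt_mul_of_pos_right ?_ (by positivity)
    exact Real.rpow_lt_rpow_of_exponent_lt hk₁ (by linarith)
  have hlt := (hv.mono hmn.le).summable.tsum_lt_tsum hmono hstrict hv.summable
  rw [← normH_sq, ← normH_sq, h] at hlt
  exact hlt.false

lemma innerH_congr_order {v w : VField d} (hw : ∀ k, w k ≠ 0 → kabs k = 1) (m n : ℝ) :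
    innerH m v w = innerH n v w := by
  refine tsum_congr fun k => ?_
  rcases eq_or_ne (w k) 0 with hk | hk
  · simp [hk]
  · simp [hw k hk]

include hn

lemma innerH_rhs {u : VField d} (hu : MemH (n + 2) u) :
    innerH n (rhs ν u) u = -ν * normH (n + 1) u ^ 2 + innerH n (bilin u u) u := by
  have hu_n : MemH n u := hu.mono (by linarith)
  have hbilin := MemH.bilin hn hu_n (hu.mono (by linarith))
  rw [rhs, (hu.lap.smul ν).innerH_add_left hbilin hu_n, hu.lap.innerH_smul_left hu_n,
    innerH_lap hu]
  ring

lemma SolvesOn.hasDerivWithinAt_normH_sq {I : Set ℝ} {u : ℝ → VField d} (h : SolvesOn n ν I u)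
    {t : ℝ} (ht : t ∈ I) :
    HasDerivWithinAt (fun t => normH n (u t) ^ 2) (2 * innerH n (rhs ν (u t)) (u t)) I t := by
  have hderiv := (h.deriv t ht).norm_sq
  rw [real_inner_comm, MemH.inner_toL2_sobolevWeight ((h.mem t ht).rhs hn ν)
    ((h.mem t ht).mono (by linarith))] at hderiv
  simpa only [norm_toL2_sobolevWeight] using hderiv

lemma IsKatoConstant.innerH_rhs_le (hG : IsKatoConstant d n G) {u : VField d}
    (hu : MemH (n + 2) u) :
    2 * innerH n (rhs ν u) u ≤ -2 * ν * normH (n + 1) u ^ 2 + 2 * G * normH n u ^ 3 := by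
  have hkato := (abs_le.mp (hG.2 u u (hu.mono (by linarith)) (hu.mono (by linarith)))).2
  rw [innerH_rhs hn hu]
  linarith

/-- If the norms of orders `n` and `n + 1` agree, then `u` is supported on `|k| = 1`, and
`⟨𝒫(u,u) | u⟩_n = ⟨𝒫(u,u) | u⟩_{L²} = 0`. -/
lemma IsKatoConstant.innerH_rhs_lt (hG : IsKatoConstant d n G) (hν : 0 < ν) {u : VField d}
    (hu : MemH (n + 2) u) (hu₀ : 0 < normH n u) :
    2 * innerH n (rhs ν u) u < -2 * ν * normH n u ^ 2 + 2 * G * normH n u ^ 3 := by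
  have hu₁ : MemH (n + 1) u := hu.mono (by linarith)
  have hun : MemH n u := hu.mono (by linarith)
  rcases (hu₁.normH_mono (by linarith : n ≤ n + 1)).lt_or_eq with hlt | heq
  · have hsq : 2 * ν * normH n u ^ 2 < 2 * ν * normH (n + 1) u ^ 2 := by gcongr
    linarith [hG.innerH_rhs_le (ν := ν) hn hu]
  · have hsupp : ∀ k, u k ≠ 0 → kabs k = 1 := fun k =>
      kabs_eq_one_of_normH_eq (by linarith) hu₁ heq
    have hzero : innerH n (bilin u u) u = 0 :=
      (innerH_congr_order hsupp n 0).trans (innerH_zero_bilin hn hun hun)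
    have hgain : 0 < G * normH n u ^ 3 := mul_pos hG.1 (pow_pos hu₀ 3)
    rw [innerH_rhs hn hu, hzero, ← heq]
    linarith

theorem SolvesOn.normH_le_barrier (hG : IsKatoConstant d n G) (hν : 0 ≤ ν) {a b : ℝ} (hab : a ≤ b)
    {u : ℝ → VField d} (h : SolvesOn n ν (Set.Icc a b) u)
    (hpos : 0 < 1 - G * normH n (u a) * eNu ν (b - a)) :
    normH n (u b) ≤ barrier ν G (normH n (u a)) (b - a) := by
  refine le_barrier hG.1.le hab (fun _ _ => normH_nonneg _ _)
    (fun _ ht => h.hasDerivWithinAt_normH_sq hn ht) hpos (normH_nonneg _ _) le_rfl fun t ht => ?_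
  have hsq : 2 * ν * normH n (u t) ^ 2 ≤ 2 * ν * normH (n + 1) (u t) ^ 2 := by
    have hmem : MemH (n + 1) (u t) := (h.mem t ht).mono (by linarith)
    gcongr
    · exact normH_nonneg _ _
    · exact hmem.normH_mono (by linarith)
  linarith [hG.innerH_rhs_le (ν := ν) hn (h.mem t ht)]

lemma SolvesOn.normH_le_barrier_of_mem_timeIco (hG : IsKatoConstant d n G) (hν : 0 ≤ ν)
    {T : EReal} {u : ℝ → VField d} (h : SolvesOn n ν (timeIco T) u) {t : ℝ} (ht : t ∈ timeIco T)
    (hpos : 0 < 1 - G * normH n (u 0) * eNu ν t) :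
    normH n (u t) ≤ barrier ν G (normH n (u 0)) t := by
  simpa only [sub_zero] using (h.mono (Icc_subset_timeIco le_rfl ht.2)).normH_le_barrier hn hG hν
    ht.1 (by rwa [sub_zero])

/-- The norm cannot stay at the critical value `ν/G`, where the energy inequality is strict. -/
lemma SolvesOn.exists_normH_lt (hG : IsKatoConstant d n G) (hν : 0 < ν) {u : ℝ → VField d}
    (h : SolvesOn n ν (timeIco ⊤) u) (hsmall : normH n (u 0) ≤ ν / G) :
    ∃ a, 0 ≤ a ∧ normH n (u a) < ν / G := by
  rcases hsmall.lt_or_eq with hlt | heq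
  · exact ⟨0, le_rfl, hlt⟩
  have hmem : (0 : ℝ) ∈ timeIco ⊤ := ⟨le_rfl, EReal.coe_lt_top 0⟩
  have hpos : 0 < normH n (u 0) := heq ▸ div_pos hν hG.1
  have hneg : 2 * innerH n (rhs ν (u 0)) (u 0) < 0 := by
    refine (hG.innerH_rhs_lt hn hν (h.mem 0 hmem) hpos).trans_eq ?_
    have hG₀ := hG.1.ne'
    rw [heq]
    field_simp
    ring
  have hderiv : HasDerivWithinAt (fun t => normH n (u t) ^ 2)
      (2 * innerH n (rhs ν (u 0)) (u 0)) (Set.Ioi 0) 0 :=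
    (h.hasDerivWithinAt_normH_sq hn hmem).mono fun t ht => ⟨le_of_lt ht, EReal.coe_lt_top t⟩
  obtain ⟨a, hslope, ha⟩ := ((((hasDerivWithinAt_iff_tendsto_slope' (by simp)).mp
    hderiv).eventually (gt_mem_nhds hneg)).and self_mem_nhdsWithin).exists
  have hsq : normH n (u a) ^ 2 < normH n (u 0) ^ 2 := by
    rw [slope_def_field, sub_zero] at hslope
    exact sub_neg.mp (neg_of_div_neg_left hslope (le_of_lt ha))
  exact ⟨a, le_of_lt ha, heq ▸ lt_of_pow_lt_pow_left₀ 2 hpos.le hsq⟩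

lemma SolvesOn.exists_exponential_decay (hG : IsKatoConstant d n G) (hν : 0 < ν)
    {u : ℝ → VField d} (h : SolvesOn n ν (timeIco ⊤) u) (hsmall : normH n (u 0) ≤ ν / G) :
    ∃ C : ℝ, ∀ t : ℝ, 0 ≤ t → normH n (u t) ≤ C * Real.exp (-ν * t) := by
  obtain ⟨a, ha, hua⟩ := h.exists_normH_lt hn hG hν hsmall
  have hsolves : ∀ s t, 0 ≤ s → SolvesOn n ν (Set.Icc s t) u := fun s t hs =>
    h.mono (Icc_subset_timeIco hs (EReal.coe_lt_top t))
  obtain ⟨R, hR, huR⟩ := (hsolves 0 a le_rfl).exists_normH_le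
  set A := normH n (u a)
  have hA : 0 ≤ A := normH_nonneg _ _
  set q := 1 - G * A / ν
  have hq : 0 < q := sub_pos.mpr ((div_lt_one hν).mpr ((lt_div_iff₀' hG.1).mp hua))
  refine ⟨(R + A / q) * Real.exp (ν * a), fun t ht => ?_⟩
  have hexp : Real.exp (ν * a) * Real.exp (-ν * t) = Real.exp (-ν * (t - a)) := by
    rw [← Real.exp_add]
    ring_nf
  rw [mul_assoc, hexp]
  rcases le_total t a with hta | hta
  · have hone : 1 ≤ Real.exp (-ν * (t - a)) := Real.one_le_exp (by nlinarith)
    calc normH n (u t) ≤ R + A / q := (huR t ⟨ht, hta⟩).trans (by simpa using by positivity)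
      _ ≤ _ := le_mul_of_one_le_right (by positivity) hone
  · have hqt : q ≤ 1 - G * A * eNu ν (t - a) :=
      one_sub_div_le_one_sub_mul_eNu hν (mul_nonneg hG.1.le hA) _
    calc normH n (u t) ≤ barrier ν G A (t - a) :=
          (hsolves a t ha).normH_le_barrier hn hG hν.le hta (hq.trans_le hqt)
      _ ≤ A / q * Real.exp (-ν * (t - a)) := barrier_le hA hq hqt
      _ ≤ _ := by gcongr; exact le_add_of_nonneg_left hR

theorem Tc_le_of_isMaximalSolution (hG : IsKatoConstant d n G) (hν : 0 ≤ ν) {u₀ : VField d}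
    {T : EReal} {u : ℝ → VField d} (hu : IsMaximalSolution n ν (fun _ => 0) u₀ T u) :
    Tc ν G (normH n u₀) ≤ T := by
  by_contra! hlt
  obtain ⟨hT, hsolves, rfl⟩ := (isSolution_zero_iff hn hν).mp hu.1
  set A := normH n (u 0)
  have hA : 0 ≤ A := normH_nonneg _ _
  induction T with
  | bot => exact not_lt_bot hT
  | top => exact not_top_lt hlt
  | coe b =>
    have hb : 0 ≤ b := EReal.coe_nonneg.mp hT.le
    set q := 1 - G * A * eNu ν b
    have hq : 0 < q := one_sub_mul_eNu_pos_of_mem_timeIco_Tc hν hG.1 hA ⟨hb, hlt⟩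
    refine hu.2 (exists_continuation (R := A / q + 1) hn hν (by positivity) hu.1 fun t ht => ?_)
    have hqt : q ≤ 1 - G * A * eNu ν t := antitone_one_sub_mul_eNu ν (mul_nonneg hG.1.le hA)
      (EReal.coe_lt_coe_iff.mp ht.2).le
    have hexp : Real.exp (-ν * t) ≤ 1 := Real.exp_le_one_iff.mpr (by nlinarith [ht.1])
    calc normH n (u t) ≤ barrier ν G A t :=
          hsolves.normH_le_barrier_of_mem_timeIco hn hG hν ht (hq.trans_le hqt)
      _ ≤ A / q * Real.exp (-ν * t) := barrier_le hA hq hqt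
      _ ≤ A / q := mul_le_of_le_one_right (by positivity) hexp
      _ ≤ A / q + 1 := by linarith

end KatoBound

end EulerNS

end

theorem mainTheorem2 (d : ℕ) (hd : 2 ≤ d) (n ν G : ℝ) (hn : (d : ℝ) / 2 + 1 < n) (hν : 0 ≤ ν)
    (hG : IsKatoConstant d n G) (u₀ : VField d) (hu₀ : MemH (n + 2) u₀) :
    (∃ (T : EReal) (u : ℝ → VField d), IsMaximalSolution n ν (fun _ => 0) u₀ T u) ∧
    ∀ (T : EReal) (u : ℝ → VField d), IsMaximalSolution n ν (fun _ => 0) u₀ T u →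
      Tc ν G (normH n u₀) ≤ T ∧
      (∀ t ∈ timeIco (Tc ν G (normH n u₀)),
        0 < 1 - G * normH n u₀ * eNu ν t ∧
        normH n (u t) ≤
          normH n u₀ * Real.exp (-ν * t) / (1 - G * normH n u₀ * eNu ν t)) ∧
      (normH n u₀ ≤ ν / G →
        T = ⊤ ∧ Tc ν G (normH n u₀) = ⊤ ∧
        (0 < ν → ∃ C : ℝ, ∀ t : ℝ, 0 ≤ t → normH n (u t) ≤ C * Real.exp (-ν * t))) := by
  refine ⟨exists_isMaximalSolution hn hν hu₀, fun T u hu => ?_⟩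
  have hT := Tc_le_of_isMaximalSolution hn hG hν hu
  obtain ⟨-, hsolves, rfl⟩ := (isSolution_zero_iff hn hν).mp hu.1
  have hnorm := normH_nonneg n (u 0)
  refine ⟨hT, fun t ht => ?_, fun hsmall => ?_⟩
  · have hpos := one_sub_mul_eNu_pos_of_mem_timeIco_Tc hν hG.1 hnorm ht
    exact ⟨hpos, hsolves.normH_le_barrier_of_mem_timeIco hn hG hν ⟨ht.1, ht.2.trans_le hT⟩ hpos⟩
  · have hTc := Tc_eq_top hnorm hsmall
    obtain rfl : T = ⊤ := top_le_iff.mp (hTc ▸ hT)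
    exact ⟨rfl, hTc, fun hν₀ => hsolves.exists_exponential_decay hn hG hν₀ hsmall⟩
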